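/- **Setting.** Let $\rho_f,\rho_b,g>0$, $p_{atm},\eta_0\in\mathbb R$, let $k$ be the upward unit vector, and let $\mathcal S=\{z=h\}$ be a flat bottom ($\mathcal S$ absent if $h=-\infty$). For $t$ in an open set $I\subset\mathbb R$ of times, a rigid body occupies $B(t)=\{Q(t)l+r_c(t): l\in B_0\}$, where $B_0$ is compact with $C^2$ boundary and centroid $0$, $Q(t)$ is a rotation, and $\dot r_c=V$, $\frac{d}{dt}(Ql)=\Omega\times Ql$ with $V,\Omega$ continuous; $\mathcal V_B$ is its volume, $L_b=\rho_b\mathcal V_BV$, $I\Omega=\rho_b\int_{B(t)}(r-r_c)\times(\Omega\times(r-r_c))$, $A_b=r_c\times L_b+I\Omega$. The fluid occupies $D(t)=\{h<z<\eta(t,x,y)\}\setminus B(t)$, where $\eta>h$ is $C^2$ and $B(t)$ touches neither $\mathcal S$ nor the free surface $\Sigma_f=\{z=\eta\}$; put $\Sigma_b=\partial B(t)$. Normals: $n_f$ on $\Sigma_f$ points out of $D$ (upwards), $n_b$ on $\Sigma_b$ points out of the body, $n_s=k$. The potential $\Phi(t,\cdot)$ is $C^2$ in $(t,r)$ up to the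 boundary of $D$, and the pressure is $$p=p_{atm}+\rho_fg(\eta_0-z)-\rho_f\Big(\frac{\partial\Phi}{\partial t}+\frac{|\nabla\Phi|^2}{2}\Big).$$ The equations of motion are: $\nabla^2\Phi=0$ in $D$; $\nabla\Phi\cdot n_s=0$ on $\mathcal S$; $\nabla\Phi\cdot n_b=(V+\Omega\times(r-r_c))\cdot n_b$ on $\Sigma_b$; $\partial_t\eta=\partial_z\Phi-\partial_x\Phi\,\partial_x\eta-\partial_y\Phi\,\partial_y\eta$ and $p=p_{atm}$ on $\Sigma_f$; and $$\frac{dL_b}{dt}=-\int_{\Sigma_b}p\,n_b\,\nu-\rho_bg\mathcal V_Bk,\qquad \frac{d(I\Omega)}{dt}=-\int_{\Sigma_b}(r-r_c)\times p\,n_b\,\nu .$$ **Assumptions.** (i) Far field, with an integer $m$: $\eta(t,\cdot)\to\eta_0$ at infinity for each $t$, and, locally uniformly in $t\in I$, for large $|r|$, $\Phi=O(|r|^{-2})$, $\partial_t\Phi=O(|r|^{-2})$, $\nabla\Phi=O(|r|^{-m})$, and $\partial_x\eta,\partial_y\eta$ are bounded far out. (ii) For each $t\in I$, with $C_R$ the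 horizontal disc of radius $R$ about the vertical axis through the origin, $$\lim_{R\to\infty}\rho_fg\int_{C_R}(\eta_0-\eta)\,\nu_s=0,\qquad \lim_{R\to\infty}\rho_fg\int_{C_R}r\times(\eta_0-\eta)k\,\nu_s=0 .$$ (iii) For each $t\in I$ the integrals over $\Sigma_f$ below converge as limits for $R\to\infty$ of the integrals over the part of $\Sigma_f$ above $C_R$. Define $$\mathcal L=\frac{\rho_f}{2}\int_{\Sigma_b}r\times(n_b\times\nabla\Phi)\,\nu+L_b+\rho_f\int_{\Sigma_f}\Phi\,n_f\,\nu,$$ $$\mathcal A=-\frac{\rho_f}{2}\int_{\Sigma_b}|r|^2(n_b\times\nabla\Phi)\,\nu+A_b+\rho_f\int_{\Sigma_f}r\times\Phi\,n_f\,\nu .$$ **Statement.** (1) If $h$ is finite and the assumptions hold with $m=2$, then the integrals over $\mathcal S$ below converge absolutely, $\mathcal L$ and $\mathcal A$ are differentiable on $I$, and $$\frac{d\mathcal L}{dt}=-\rho_f\int_{\mathcal S}\frac{|\nabla\Phi|^2}{2}\,n_s\,\nu+(\rho_f-\rho_b)g\mathcal V_Bk,$$ $$\frac{d\mathcal A}{dt}=-\rho_f\int_{\mathcal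 S}r\times\frac{|\nabla\Phi|^2}{2}\,n_s\,\nu+r_c\times(\rho_f-\rho_b)g\mathcal V_Bk .$$ (2) For any sequence of such motions with bottoms $z=h_n$, $h_n\to-\infty$, obeying at a time $t$ the far-field bounds ($m=2$) with the same constants, the bottom integrals $\int_{\mathcal S}\frac{|\nabla\Phi|^2}{2}n_s\,\nu$ and $\int_{\mathcal S}r\times\frac{|\nabla\Phi|^2}{2}n_s\,\nu$ at time $t$ tend to $0$. (3) If the bottom is at $z=-\infty$, $\rho_b=\rho_f$, $I$ is an interval, and the assumptions hold with $m=3$, then $\frac{d\mathcal L}{dt}=0$ and $\frac{d\mathcal A}{dt}=0$ on $I$, so that $\mathcal L$ and $\mathcal A$ are constant on $I$. -/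

import Mathlib

open MeasureTheory Filter Topology Set

noncomputable section

namespace WaterBody

/-- Physical space, with coordinates `(x 0, x 1, x 2) = (x, y, z)`, `z` pointing upwards. -/
abbrev E3 : Type := EuclideanSpace ℝ (Fin 3)

/-- The vector product of `ℝ³`. -/
def cross (a b : E3) : E3 := WithLp.toLp 2 (crossProduct a.ofLp b.ofLp)

/-- The point with horizontal coordinates `u` and elevation `z`. -/
def point (u : ℝ × ℝ) (z : ℝ) : E3 := !₂[u.1, u.2, z]

/-- The horizontal coordinates of a point. -/
def horiz (x : E3) : ℝ × ℝ := (x 0, x 1)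

/-- The upward unit vector. -/
def kvec : E3 := !₂[0, 0, 1]

/-- The disc of radius `R` in the horizontal plane, centred at the origin. -/
def disc (R : ℝ) : Set (ℝ × ℝ) := {u | u.1 ^ 2 + u.2 ^ 2 ≤ R ^ 2}

/-! ### Graphs `z = ψ (x, y)` -/

/-- The point of the graph of `ψ` above `u`. -/
def graphPoint (ψ : ℝ × ℝ → ℝ) (u : ℝ × ℝ) : E3 := point u (ψ u)

/-- The upward normal vector `(-∂ψ/∂x, -∂ψ/∂y, 1)` of the graph of `ψ`. -/
def graphNormalVec (ψ : ℝ × ℝ → ℝ) (u : ℝ × ℝ) : E3 :=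
  !₂[-(fderiv ℝ ψ u (1, 0)), -(fderiv ℝ ψ u (0, 1)), 1]

/-- The area density `√(1 + (∂ψ/∂x)² + (∂ψ/∂y)²)` of the graph of `ψ` with respect to `dx dy`. -/
def areaDensity (ψ : ℝ × ℝ → ℝ) (u : ℝ × ℝ) : ℝ :=
  Real.sqrt (1 + (fderiv ℝ ψ u (1, 0)) ^ 2 + (fderiv ℝ ψ u (0, 1)) ^ 2)

/-- The upward unit normal of the graph of `ψ`. -/
def graphNormal (ψ : ℝ × ℝ → ℝ) (u : ℝ × ℝ) : E3 :=
  (areaDensity ψ u)⁻¹ • graphNormalVec ψ u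

/-- The integral of `F (x, n)` (`x` the point, `n` the upward unit normal) with respect to surface
area, over the part of the graph of `ψ` that lies above `s`. -/
def graphIntegral (ψ : ℝ × ℝ → ℝ) (s : Set (ℝ × ℝ)) (F : E3 → E3 → E3) : E3 :=
  ∫ u in s, areaDensity ψ u • F (graphPoint ψ u) (graphNormal ψ u)

/-! ### The body in its reference position -/

/-- A local description of the boundary of `B`: on a neighbourhood of the support of the function
`weight`, the set `B` is, in the Cartesian coordinates `frame`, the region below the graph of the
`C²` function `ψ`. -/
structure BoundaryChart (B : Set E3) where
  frame : E3 ≃ᵃⁱ[ℝ] E3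
  ψ : ℝ × ℝ → ℝ
  weight : E3 → ℝ
  contDiff_ψ : ContDiff ℝ 2 ψ
  contDiff_weight : ContDiff ℝ 2 weight
  weight_nonneg : ∀ x, 0 ≤ weight x
  hasCompactSupport_weight : HasCompactSupport weight
  mem_iff : ∀ x ∈ tsupport weight, ∀ᶠ y in 𝓝 x,
    (y ∈ B ↔ (frame y) 2 ≤ ψ (horiz (frame y)))

namespace BoundaryChart

variable {B : Set E3} (c : BoundaryChart B)

/-- The boundary point with local parameter `u`. -/
def pt (u : ℝ × ℝ) : E3 := c.frame.symm (graphPoint c.ψ u)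

/-- The unit normal, pointing out of the body, at the boundary point with parameter `u`. -/
def normal (u : ℝ × ℝ) : E3 := c.frame.symm.linearIsometryEquiv (graphNormal c.ψ u)

end BoundaryChart

/-- A body in reference position: a compact set with `C²` boundary, given with a finite atlas of its
boundary and a subordinate partition of unity, and with its centroid at the origin. -/
structure RigidBody where
  carrier : Set E3
  isCompact_carrier : IsCompact carrier
  numCharts : ℕ
  chart : Fin numCharts → BoundaryChart carrier
  sum_weight : ∀ x ∈ frontier carrier, ∀ᶠ y in 𝓝 x, ∑ i, (chart i).weight y = 1
  centroid_eq_zero : ∫ x in carrier, x = 0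

namespace RigidBody

variable (B : RigidBody)

/-- The volume of the body. -/
def vol : ℝ := (volume B.carrier).toReal

/-- `n` is the unit normal at the boundary point `x`, pointing out of the body. -/
def IsOutwardNormal (x n : E3) : Prop :=
  ∃ i u, x = (B.chart i).pt u ∧ (B.chart i).weight x ≠ 0 ∧ n = (B.chart i).normal u

/-- The integral of `F (x, n)` (`x` the point, `n` the unit normal pointing out of the body) over
the boundary of the body with respect to surface area: in each chart the surface is a graph, and the
contributions of the charts are put together by the partition of unity. -/
def boundaryIntegral (F : E3 → E3 → E3) : E3 :=
  ∑ i, ∫ u : ℝ × ℝ, ((B.chart i).weight ((B.chart i).pt u) * areaDensity (B.chart i).ψ u) •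
    F ((B.chart i).pt u) ((B.chart i).normal u)

end RigidBody

/-! ### Physical constants, and the time-dependent unknowns -/

/-- Densities of fluid and body, gravitational acceleration, atmospheric pressure, and the elevation
of the undisturbed free surface. -/
structure Params where
  ρf : ℝ
  ρb : ℝ
  g : ℝ
  patm : ℝ
  η₀ : ℝ
  ρf_pos : 0 < ρf
  ρb_pos : 0 < ρb
  g_pos : 0 < g

/-- The unknowns of the problem: elevation of the flat bottom (`⊥`, that is `-∞`, for an infinitely
deep fluid), elevation `η` of the free surface, velocity potential `Φ`, attitude `Q` and centre of
mass `c` of the body, its velocity `V` and its angular velocity `Ω`. -/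
structure Motion where
  bottom : WithBot ℝ
  η : ℝ → ℝ × ℝ → ℝ
  Φ : ℝ → E3 → ℝ
  Q : ℝ → (E3 ≃ₗᵢ[ℝ] E3)
  c : ℝ → E3
  V : ℝ → E3
  Ω : ℝ → E3

section

variable (P : Params) (B : RigidBody) (M : Motion)

/-- Position at time `t` of the body particle with reference position `l`. -/
def place (t : ℝ) (l : E3) : E3 := M.Q t l + M.c t

/-- The region occupied by the body. -/
def bodyAt (t : ℝ) : Set E3 := place M t '' B.carrier

/-- The fluid domain `D`. -/
def fluid (t : ℝ) : Set E3 :=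
  {x | M.bottom < ((x 2 : ℝ) : WithBot ℝ) ∧ x 2 < M.η t (horiz x)} \ bodyAt B M t

/-- The fluid domain together with its three boundary pieces. -/
def closedFluid (t : ℝ) : Set E3 :=
  {x | M.bottom ≤ ((x 2 : ℝ) : WithBot ℝ) ∧ x 2 ≤ M.η t (horiz x)} \ interior (bodyAt B M t)

/-- The fluid velocity `∇Φ`. -/
def vel (t : ℝ) (x : E3) : E3 := gradient (M.Φ t) x

/-- `∂Φ/∂t`. -/
def potRate (t : ℝ) (x : E3) : ℝ := deriv (fun s => M.Φ s x) t

/-- The pressure, given by Bernoulli's equation. -/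
def pressure (t : ℝ) (x : E3) : ℝ :=
  P.patm + P.ρf * P.g * (P.η₀ - x 2) - P.ρf * (potRate M t x + ‖vel M t x‖ ^ 2 / 2)

/-- The integral of `F (r, n_b)` over the surface `Σ_b` of the moving body, with respect to area,
pulled back to the reference position by the rigid motion. -/
def bodySurfaceIntegral (t : ℝ) (F : E3 → E3 → E3) : E3 :=
  B.boundaryIntegral fun l n => F (place M t l) (M.Q t n)

/-- The integral of `F (r, n_f)` over the part `Σ_R` of the free surface above the disc of radius
`R`. -/
def freeSurfaceIntegralOn (R t : ℝ) (F : E3 → E3 → E3) : E3 := graphIntegral (M.η t) (disc R) F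

/-- The (improper) integral over the whole free surface converges. -/
def FreeSurfaceConvergent (t : ℝ) (F : E3 → E3 → E3) : Prop :=
  ∃ J : E3, Tendsto (fun R => freeSurfaceIntegralOn M R t F) atTop (𝓝 J)

/-- The integral of `F (r, n_f)` over the free surface, the limit as `R → ∞` of the integrals over
`Σ_R`. -/
def freeSurfaceIntegral (t : ℝ) (F : E3 → E3 → E3) : E3 :=
  limUnder atTop fun R => freeSurfaceIntegralOn M R t F

/-- Linear momentum of the body. -/
def bodyLinear (t : ℝ) : E3 := (P.ρb * B.vol) • M.V t

/-- `I Ω`: the inertia tensor of the body about its centre of mass, applied to `Ω`. -/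
def bodySpin (t : ℝ) : E3 :=
  P.ρb • ∫ l in B.carrier, cross (M.Q t l) (cross (M.Ω t) (M.Q t l))

/-- Angular momentum of the body about the origin. -/
def bodyAngular (t : ℝ) : E3 := cross (M.c t) (bodyLinear P B M t) + bodySpin P B M t

/-- The modified total linear momentum `𝓛`. -/
def linearMomentum (t : ℝ) : E3 :=
  (P.ρf / 2) • bodySurfaceIntegral B M t (fun r n => cross r (cross n (vel M t r)))
    + bodyLinear P B M t
    + P.ρf • freeSurfaceIntegral M t (fun r n => M.Φ t r • n)

/-- The modified total angular momentum `𝓐`. -/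
def angularMomentum (t : ℝ) : E3 :=
  -((P.ρf / 2) • bodySurfaceIntegral B M t (fun r n => ‖r‖ ^ 2 • cross n (vel M t r)))
    + bodyAngular P B M t
    + P.ρf • freeSurfaceIntegral M t (fun r n => cross r (M.Φ t r • n))

/-- `M` is a motion, during the times `t ∈ I`, of the coupled system of an ideal fluid in
irrotational motion with a free surface and a submerged rigid body. -/
structure IsSolution (I : Set ℝ) : Prop where
  /-- The surface elevation is `C²`. -/
  contDiffAt_η : ∀ t ∈ I, ∀ u, ContDiffAt ℝ 2 (fun q : ℝ × (ℝ × ℝ) => M.η q.1 q.2) (t, u)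
  /-- The potential is `C²` up to the boundary of the fluid. -/
  contDiffAt_Φ : ∀ t ∈ I, ∀ x ∈ closedFluid B M t,
    ContDiffAt ℝ 2 (fun q : ℝ × E3 => M.Φ q.1 q.2) (t, x)
  /-- The free surface is above the bottom. -/
  bottom_lt : ∀ t ∈ I, ∀ u, M.bottom < ((M.η t u : ℝ) : WithBot ℝ)
  /-- The body is submerged: it touches neither the bottom nor the free surface. -/
  submerged : ∀ t ∈ I, ∀ x ∈ bodyAt B M t,
    M.bottom < ((x 2 : ℝ) : WithBot ℝ) ∧ x 2 < M.η t (horiz x)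
  /-- The attitude of the body is a rotation. -/
  rotation : ∀ t ∈ I, LinearMap.det ((M.Q t).toLinearEquiv : E3 →ₗ[ℝ] E3) = 1
  /-- `V` is the velocity of the centre of mass. -/
  hasDerivAt_c : ∀ t ∈ I, HasDerivAt M.c (M.V t) t
  /-- `Ω` is the angular velocity. -/
  hasDerivAt_Q : ∀ t ∈ I, ∀ l, HasDerivAt (fun s => M.Q s l) (cross (M.Ω t) (M.Q t l)) t
  continuousOn_V : ContinuousOn M.V I
  continuousOn_Ω : ContinuousOn M.Ω I
  /-- Incompressibility. -/
  laplace : ∀ t ∈ I, ∀ x ∈ fluid B M t, Laplacian.laplacian (M.Φ t) x = 0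
  /-- No flow through the bottom. -/
  bottom_condition : ∀ t ∈ I, ∀ x : E3, M.bottom = ((x 2 : ℝ) : WithBot ℝ) →
    inner ℝ (vel M t x) kvec = 0
  /-- No flow through the surface of the body. -/
  body_condition : ∀ t ∈ I, ∀ l n, B.IsOutwardNormal l n →
    inner ℝ (vel M t (place M t l)) (M.Q t n)
      = inner ℝ (M.V t + cross (M.Ω t) (place M t l - M.c t)) (M.Q t n)
  /-- Kinematic condition on the free surface: `∂η/∂t = ∂Φ/∂z - ∇Φ · ∇η`. -/
  kinematic : ∀ t ∈ I, ∀ u, deriv (fun s => M.η s u) t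
    = inner ℝ (vel M t (graphPoint (M.η t) u)) (graphNormalVec (M.η t) u)
  /-- Dynamic condition on the free surface (no surface tension). -/
  dynamic : ∀ t ∈ I, ∀ u, pressure P M t (graphPoint (M.η t) u) = P.patm
  /-- Newton's law for the body: pressure force and weight. -/
  newton : ∀ t ∈ I, HasDerivAt (bodyLinear P B M)
    (-bodySurfaceIntegral B M t (fun r n => pressure P M t r • n)
      - (P.ρb * P.g * B.vol) • kvec) t
  /-- Euler's law for the body: moment of the pressure about the centre of mass. -/
  euler : ∀ t ∈ I, HasDerivAt (bodySpin P B M)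
    (-bodySurfaceIntegral B M t (fun r n => cross (r - M.c t) (pressure P M t r • n))) t

/-- Far-field bounds at time `t`, with constant `C`, outside the ball of radius `R₀`: `Φ` and `∂Φ/∂t`
are at most `C / |r|²`, `|∇Φ|` is at most `C / |r| ^ m`, the slope of the free surface at most
`C`. -/
def FarFieldAt (m : ℕ) (C R₀ t : ℝ) : Prop :=
  (∀ x ∈ closedFluid B M t, R₀ ≤ ‖x‖ →
    |M.Φ t x| ≤ C / ‖x‖ ^ 2 ∧ |potRate M t x| ≤ C / ‖x‖ ^ 2 ∧ ‖vel M t x‖ ≤ C / ‖x‖ ^ m) ∧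
  ∀ u, u ∉ disc R₀ → |fderiv ℝ (M.η t) u (1, 0)| ≤ C ∧ |fderiv ℝ (M.η t) u (0, 1)| ≤ C

/-- Far-field assumptions: the surface is undisturbed at infinity, and the far-field bounds hold
locally uniformly in time. -/
def FarField (m : ℕ) (I : Set ℝ) : Prop :=
  (∀ t ∈ I, Tendsto (M.η t) (cocompact (ℝ × ℝ)) (𝓝 P.η₀)) ∧
  ∀ K ⊆ I, IsCompact K → ∃ C R₀ : ℝ, 0 < R₀ ∧ ∀ t ∈ K, FarFieldAt B M m C R₀ t

/-- `ρ_f g ∫ (η₀ - η) = 0`. -/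
def MassCondition (t : ℝ) : Prop :=
  Tendsto (fun R => P.ρf * P.g * ∫ u in disc R, (P.η₀ - M.η t u)) atTop (𝓝 0)

/-- `ρ_f g ∫ r × (η₀ - η) k = 0`; note that `r × k` does not depend on the elevation of `r`. -/
def AngularMassCondition (t : ℝ) : Prop :=
  Tendsto (fun R => (P.ρf * P.g) • ∫ u in disc R, cross (point u 0) ((P.η₀ - M.η t u) • kvec))
    atTop (𝓝 0)

/-- The free-surface integrals that enter `𝓛` and `𝓐` converge. -/
def MomentaConverge (t : ℝ) : Prop :=
  FreeSurfaceConvergent M t (fun r n => M.Φ t r • n) ∧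
  FreeSurfaceConvergent M t (fun r n => cross r (M.Φ t r • n))

/-- All the assumptions on the motion, during the times `t ∈ I`. -/
structure Admissible (m : ℕ) (I : Set ℝ) : Prop where
  isSolution : IsSolution P B M I
  farField : FarField P B M m I
  mass : ∀ t ∈ I, MassCondition P M t
  angularMass : ∀ t ∈ I, AngularMassCondition P M t
  momentaConverge : ∀ t ∈ I, MomentaConverge M t

/-- The integrand `(|∇Φ|² / 2) n_s` on the bottom `z = h`, where `n_s = k`. -/
def bottomDensity (h t : ℝ) (u : ℝ × ℝ) : E3 := (‖vel M t (point u h)‖ ^ 2 / 2) • kvec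

/-- The moment `r × (|∇Φ|² / 2) n_s` on the bottom `z = h`. -/
def bottomMoment (h t : ℝ) (u : ℝ × ℝ) : E3 := cross (point u h) (bottomDensity M h t u)

end

end WaterBody

end

/-!
The proof tests the two momenta with rigid velocity fields `ξ = a + b × x` (`killing`), `b = 0`
for the linear and `a = 0` for the angular one. Such fields are divergence free and have an
antisymmetric gradient, so that both momenta are treated at once.

By the divergence theorem in the body, the surface integrals of `n × ∇Φ` in the two momenta turn
into the flux of `Φ ξ` through the surface of the body (`inner_linear_surface`,
`inner_angular_surface`); only the values of `Φ` near that surface matter, so `Φ` may be extended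
into the body. The component of the momenta along `ξ` then is the limit of `cutMomentum`: the
momentum of the body plus `ρ_f` times the difference of the fluxes of `Φ ξ` through the free
surface, with a cutoff of radius `R`, and through the surface of the body.

The rate of change of each flux is the integral of `(∂Φ/∂t) ξ · n + (∇Φ · ξ) (∇Φ · n)`, since both
surfaces move with the fluid (`hasDerivAt_bodyFlux`, `hasDerivAt_surfaceFlux`). Bernoulli's
equation replaces `∂Φ/∂t` by pressure and gravity. The pressure on the body cancels against the
laws of Newton and Euler and leaves the buoyancy; what remains is the flux of the stress
`(∇Φ · ξ) ∇Φ - (|∇Φ|² / 2) ξ`, which is divergence free (`div_stress`) and therefore passes from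
the free surface to the body with no loss but the one to the bottom (`stress_balance`). The result
is the exact balance `hasDerivAt_cutMomentum`. Besides the terms of the theorem it contains

* `momentumError`, integrals in which the derivative of the cutoff occurs. The far-field bounds
  make them `O(1 / R)`: the volume of the region where the cutoff varies is of order `R²` over a
  bottom of finite depth and `R³` without a bottom, which is why the decay of `∇Φ` is required
  with exponent `2` and `3` respectively (`abs_momentumError_le`).
* `elevationMoment`, the hydrostatic contribution of the elevation. At each time it tends to zero
  as `R → ∞`, by the conditions on the mass, but the limit has to be exchanged with the time
  derivative. Its own rate of change is bounded uniformly in `R`: by the kinematic condition and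
  by the divergence theorem for `β ∇Φ - Φ ∇β`, with `β` the vertical component of `ξ`, it is a
  horizontal momentum up to bounded terms, and the horizontal cutoff momenta are bounded because
  the balance for them contains no hydrostatic term. Hence it tends to zero uniformly near each
  time (`tendsto_elevationMoment_prod`).

The cutoff is smooth, while the improper integrals are limits over discs; an integral with the
cutoff is an average of integrals over discs (`tendsto_integral_cut`). The derivatives of the
cutoff momenta converge uniformly near each time and the momenta converge, so that the limits may
be differentiated (`hasDerivAt_limit`).

The integrands on the bottom are bounded by a multiple of `|r|⁻³`, hence by an integrable function
of the horizontal coordinates that does not depend on the depth; dominated convergence gives the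
limit of a receding bottom (`tendsto_integral_bottom`). Without a bottom and with equal densities
all terms on the right of the balance vanish, and the momenta are constant.
-/

noncomputable section

namespace WaterBody

/-! ### Coordinates and integration by parts -/

/-- The coordinates `(u, z) ↦ point u z` as a continuous linear equivalence. -/
def pointL : ((ℝ × ℝ) × ℝ) ≃L[ℝ] E3 :=
  LinearEquiv.toContinuousLinearEquiv
    { toFun := fun q => point q.1 q.2
      invFun := fun x => (horiz x, x 2)
      map_add' := by
        intro p q; ext i; fin_cases i <;> simp [point]
      map_smul' := by
        intro r q; ext i; fin_cases i <;> simp [point]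
      left_inv := by
        intro q; simp [point, horiz]
      right_inv := by
        intro x; ext i; fin_cases i <;> simp [point, horiz] }

@[simp] lemma pointL_apply (q : (ℝ × ℝ) × ℝ) : pointL q = point q.1 q.2 := rfl

@[simp] lemma pointL_symm_apply (x : E3) : pointL.symm x = (horiz x, x 2) := rfl

@[simp] lemma horiz_point (u : ℝ × ℝ) (z : ℝ) : horiz (point u z) = u := by simp [horiz, point]

@[simp] lemma point_two (u : ℝ × ℝ) (z : ℝ) : point u z 2 = z := by simp [point]

@[simp] lemma point_zero (u : ℝ × ℝ) (z : ℝ) : point u z 0 = u.1 := by simp [point]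

@[simp] lemma point_one (u : ℝ × ℝ) (z : ℝ) : point u z 1 = u.2 := by simp [point]

@[simp] lemma point_horiz (x : E3) : point (horiz x) (x 2) = x := pointL.apply_symm_apply x

lemma contDiff_point {n : WithTop ℕ∞} : ContDiff ℝ n (fun q : (ℝ × ℝ) × ℝ => point q.1 q.2) :=
  pointL.contDiff

@[fun_prop] lemma continuous_horiz : Continuous horiz := by
  unfold horiz; fun_prop

lemma continuous_point : Continuous (fun q : (ℝ × ℝ) × ℝ => point q.1 q.2) := pointL.continuous

lemma measurePreserving_pointL : MeasurePreserving pointL volume volume := by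
  have h1 := (PiLp.volume_preserving_toLp (Fin 3))
  have h2 := (volume_preserving_piFinSuccAbove (fun _ : Fin 3 => ℝ) 2).symm
  have h3 : MeasurePreserving (Prod.map (id : ℝ → ℝ) (MeasurableEquiv.finTwoArrow (α := ℝ)).symm)
      volume volume :=
    (MeasurePreserving.id volume).prod (volume_preserving_finTwoArrow ℝ).symm
  have h4 : MeasurePreserving (Prod.swap : (ℝ × ℝ) × ℝ → ℝ × (ℝ × ℝ)) volume volume :=
    Measure.measurePreserving_swap
  have h := h1.comp (h2.comp (h3.comp h4))
  convert! h using 1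
  funext q
  ext i
  fin_cases i
  · simp [point, MeasurableEquiv.piFinSuccAbove, Fin.insertNthEquiv, MeasurableEquiv.finTwoArrow]
    rfl
  · simp [point, MeasurableEquiv.piFinSuccAbove, Fin.insertNthEquiv, MeasurableEquiv.finTwoArrow]
    rfl
  · simp [point, MeasurableEquiv.piFinSuccAbove, Fin.insertNthEquiv, MeasurableEquiv.finTwoArrow]

lemma measurableEmbedding_pointL : MeasurableEmbedding pointL :=
  pointL.toHomeomorph.measurableEmbedding

section

variable {E : Type*} [NormedAddCommGroup E] [NormedSpace ℝ E]
  [MeasurableSpace E] [BorelSpace E]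

lemma integrable_fderiv_apply (μ : Measure E) [IsFiniteMeasureOnCompacts μ] {f : E → ℝ}
    (hf : ContDiff ℝ 1 f) (hc : HasCompactSupport f) (v : E) :
    Integrable (fun x => fderiv ℝ f x v) μ :=
  ((hf.continuous_fderiv one_ne_zero).clm_apply continuous_const).integrable_of_hasCompactSupport
    (hc.fderiv_apply ℝ v)

lemma integral_fderiv_apply_eq_zero [FiniteDimensional ℝ E] (μ : Measure E) [μ.IsAddHaarMeasure]
    {f : E → ℝ} (hf : ContDiff ℝ 1 f) (hc : HasCompactSupport f)
    (v : E) : ∫ x, fderiv ℝ f x v ∂μ = 0 := by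
  have h := integral_mul_fderiv_eq_neg_fderiv_mul_of_integrable (μ := μ) (𝕜 := ℝ)
    (f := fun _ => (1 : ℝ)) (g := f) (v := v) (by simp)
    (by simpa using integrable_fderiv_apply μ hf hc v)
    (by simpa using hf.continuous.integrable_of_hasCompactSupport hc)
    (fun x _ => by fun_prop) (fun x _ => hf.differentiable one_ne_zero x)
  simpa using h

end

/-- The vertical shear which flattens the graph of `ψ`. -/
def shear (ψ : ℝ × ℝ → ℝ) (hψ : Continuous ψ) : ((ℝ × ℝ) × ℝ) ≃ₜ ((ℝ × ℝ) × ℝ) where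
  toFun q := (q.1, ψ q.1 + q.2)
  invFun q := (q.1, -ψ q.1 + q.2)
  left_inv q := by simp
  right_inv q := by simp
  continuous_toFun := by fun_prop
  continuous_invFun := by fun_prop

lemma measurePreserving_shear (ψ : ℝ × ℝ → ℝ) (hψ : Continuous ψ) :
    MeasurePreserving (shear ψ hψ) volume volume := by
  refine (MeasurePreserving.id (volume : Measure (ℝ × ℝ))).skew_product
    (μc := (volume : Measure ℝ)) (μd := (volume : Measure ℝ)) (g := fun u z => ψ u + z) ?_ ?_
  · exact (by fun_prop : Continuous fun q : (ℝ × ℝ) × ℝ => ψ q.1 + q.2).measurable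
  · exact Eventually.of_forall fun u => map_add_left_eq_self volume (ψ u)

/-- The divergence theorem in the region below a graph: after the shear the region is a half space,
in which the tangential derivatives integrate to zero. -/
theorem integral_below_graph {ψ : ℝ × ℝ → ℝ} (hψ : ContDiff ℝ 1 ψ) {f : E3 → ℝ}
    (hf : ContDiff ℝ 1 f) (hc : HasCompactSupport f) (v : E3) :
    ∫ x in {x : E3 | x 2 ≤ ψ (horiz x)}, fderiv ℝ f x v
      = ∫ u, f (graphPoint ψ u) * inner ℝ (graphNormalVec ψ u) v := by
  set S := shear ψ hψ.continuous
  set Z : (ℝ × ℝ) × ℝ → ℝ := fun q => f (pointL (S q)) with hZ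
  have hS : ContDiff ℝ 1 (fun q => S q) := by
    change ContDiff ℝ 1 (fun q : (ℝ × ℝ) × ℝ => (q.1, ψ q.1 + q.2))
    fun_prop
  have hZc : ContDiff ℝ 1 Z := hf.comp (pointL.contDiff.comp hS)
  have hZs : HasCompactSupport Z :=
    hc.comp_homeomorph (S.trans pointL.toHomeomorph)
  have hmp : MeasurePreserving (fun q => pointL (S q)) volume volume :=
    measurePreserving_pointL.comp (measurePreserving_shear ψ hψ.continuous)
  have hme : MeasurableEmbedding (fun q => pointL (S q)) :=
    (S.trans pointL.toHomeomorph).measurableEmbedding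
  have hset : (fun q => pointL (S q)) ⁻¹' {x : E3 | x 2 ≤ ψ (horiz x)} = univ ×ˢ Iic 0 := by
    ext q
    simp [S, shear]
  have key : ∀ q, fderiv ℝ f (pointL (S q)) v
      = fderiv ℝ Z q (horiz v, 0) + (inner ℝ (graphNormalVec ψ q.1) v) * fderiv ℝ Z q (0, 1) := by
    intro q
    have hψ' : HasFDerivAt ψ (fderiv ℝ ψ q.1) q.1 :=
      (hψ.differentiable one_ne_zero q.1).hasFDerivAt
    have h1 : HasFDerivAt (fun q : (ℝ × ℝ) × ℝ => (q.1, ψ q.1 + q.2))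
        ((ContinuousLinearMap.fst ℝ (ℝ × ℝ) ℝ).prod
          ((fderiv ℝ ψ q.1).comp (ContinuousLinearMap.fst ℝ (ℝ × ℝ) ℝ)
            + ContinuousLinearMap.snd ℝ (ℝ × ℝ) ℝ)) q :=
      hasFDerivAt_fst.prodMk ((hψ'.comp q hasFDerivAt_fst).add hasFDerivAt_snd)
    have h2 : HasFDerivAt Z _ q :=
      ((hf.differentiable one_ne_zero (pointL (S q))).hasFDerivAt).comp q
        ((pointL.hasFDerivAt (x := S q)).comp q h1)
    rw [h2.fderiv]
    have e1 : inner ℝ (graphNormalVec ψ q.1) v = v 2 - fderiv ℝ ψ q.1 (horiz v) := by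
      have : horiz v = v 0 • ((1 : ℝ), (0 : ℝ)) + v 1 • ((0 : ℝ), (1 : ℝ)) := by simp [horiz]
      rw [this, map_add, map_smul, map_smul]
      simp [graphNormalVec, PiLp.inner_apply, Fin.sum_univ_three]
      ring
    rw [e1]
    rw [← smul_eq_mul, ← map_smul, ← map_add]
    simp only [ContinuousLinearMap.comp_apply]
    congr 1
    apply pointL.symm.injective
    simp
  rw [← hmp.setIntegral_preimage_emb hme, hset]
  simp_rw [key]
  have hi : ∀ w, Integrable (fun q => fderiv ℝ Z q w) volume :=
    fun w => integrable_fderiv_apply volume hZc hZs w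
  have hN : Continuous fun u => inner ℝ (graphNormalVec ψ u) v := by
    have := hψ.continuous_fderiv one_ne_zero
    simp only [graphNormalVec, PiLp.inner_apply, Fin.sum_univ_three]
    simp only [Fin.isValue, Matrix.cons_val_zero, Matrix.cons_val_one,
      Matrix.cons_val]
    fun_prop
  have hi2 : Integrable (fun q : (ℝ × ℝ) × ℝ =>
      (inner ℝ (graphNormalVec ψ q.1) v) * fderiv ℝ Z q (0, 1)) volume := by
    apply Continuous.integrable_of_hasCompactSupport
    · exact (hN.comp continuous_fst).mul
        ((hZc.continuous_fderiv one_ne_zero).clm_apply continuous_const)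
    · exact (hZs.fderiv_apply ℝ _).mul_left
  rw [integral_add (hi _).integrableOn hi2.integrableOn]
  have z1 : ∫ q in univ ×ˢ Iic 0, fderiv ℝ Z q (horiz v, 0) = 0 := by
    change ∫ q in univ ×ˢ Iic 0, fderiv ℝ Z q (horiz v, 0) ∂(volume.prod volume) = 0
    rw [← Measure.prod_restrict, ← integral_prod_swap, Measure.restrict_univ, integral_prod]
    · refine integral_eq_zero_of_ae (Eventually.of_forall fun s => ?_)
      have hs : ContDiff ℝ 1 (fun u : ℝ × ℝ => Z (u, s)) := by fun_prop
      have hsc : HasCompactSupport (fun u : ℝ × ℝ => Z (u, s)) :=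
        hZs.comp_isClosedEmbedding
          (Topology.IsClosedEmbedding.of_continuous_injective_isClosedMap (by fun_prop)
            (fun a b h => by simpa using h) (isClosedMap_prodMk_right s))
      have := integral_fderiv_apply_eq_zero volume hs hsc (horiz v)
      simp only [Pi.zero_apply, Prod.swap_prod_mk]
      refine (integral_congr_ae (Eventually.of_forall fun u => ?_)).trans this
      have h3 : HasFDerivAt (fun u : ℝ × ℝ => Z (u, s)) _ u :=
        HasFDerivAt.comp (g := Z) u (hZc.differentiable one_ne_zero (u, s)).hasFDerivAt
          (hasFDerivAt_prodMk_left u s)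
      simp only [h3.fderiv]
      simp
    · have h4 : Integrable (fun q => fderiv ℝ Z q (horiz v, 0))
          ((volume : Measure (ℝ × ℝ)).prod (volume.restrict (Iic (0 : ℝ)))) := by
        rw [← Measure.restrict_univ (μ := (volume : Measure (ℝ × ℝ))), Measure.prod_restrict]
        exact (hi (horiz v, 0)).integrableOn
      exact h4.swap
  rw [z1, zero_add]
  change ∫ q in univ ×ˢ Iic 0, _ ∂(volume.prod volume) = _
  rw [setIntegral_prod _ hi2.integrableOn, Measure.restrict_univ]
  congr 1
  funext u
  change ∫ y in Iic 0, inner ℝ (graphNormalVec ψ u) v * (fderiv ℝ Z (u, y)) (0, 1) = _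
  rw [integral_const_mul, mul_comm]
  congr 1
  have hs : ContDiff ℝ 1 (fun s : ℝ => Z (u, s)) := by fun_prop
  have hsc : HasCompactSupport (fun s : ℝ => Z (u, s)) :=
    hZs.comp_isClosedEmbedding
      (Topology.IsClosedEmbedding.of_continuous_injective_isClosedMap (by fun_prop)
        (fun a b h => by simpa using h) (isClosedMap_prodMk_left u))
  have := hsc.integral_Iic_deriv_eq hs 0
  have e : Z (u, 0) = f (graphPoint ψ u) := by simp [hZ, S, shear, graphPoint]
  rw [← e, ← this]
  congr 1
  funext s
  have h3 : HasFDerivAt (fun s : ℝ => Z (u, s)) _ s :=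
    HasFDerivAt.comp (g := Z) s (hZc.differentiable one_ne_zero (u, s)).hasFDerivAt
      (hasFDerivAt_prodMk_right u s)
  rw [← fderiv_apply_one_eq_deriv, h3.fderiv]
  simp

/-! ### The divergence theorem for the body -/

/-- The divergence of a vector field. -/
def div (X : E3 → E3) (x : E3) : ℝ := ∑ i : Fin 3, fderiv ℝ X x (EuclideanSpace.single i 1) i

lemma affineIsometryEquiv_eq (A : E3 ≃ᵃⁱ[ℝ] E3) :
    (A : E3 → E3) = fun x => A.linearIsometryEquiv x + A 0 := by
  funext x
  simpa using A.map_vadd 0 x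

lemma contDiff_affineIsometryEquiv (A : E3 ≃ᵃⁱ[ℝ] E3) {n : WithTop ℕ∞} : ContDiff ℝ n A := by
  rw [affineIsometryEquiv_eq A]
  exact A.linearIsometryEquiv.contDiff.add contDiff_const

lemma measurePreserving_affineIsometryEquiv (A : E3 ≃ᵃⁱ[ℝ] E3) :
    MeasurePreserving A volume volume := by
  have h := (measurePreserving_add_right (volume : Measure E3) (A 0)).comp
    A.linearIsometryEquiv.measurePreserving
  rw [affineIsometryEquiv_eq A]
  exact h

lemma areaDensity_pos (ψ : ℝ × ℝ → ℝ) (u : ℝ × ℝ) : 0 < areaDensity ψ u := by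
  unfold areaDensity; positivity

lemma areaDensity_smul_graphNormal (ψ : ℝ × ℝ → ℝ) (u : ℝ × ℝ) :
    areaDensity ψ u • graphNormal ψ u = graphNormalVec ψ u := by
  rw [graphNormal, smul_smul, mul_inv_cancel₀ (areaDensity_pos ψ u).ne', one_smul]

section Graph

variable {ψ : ℝ × ℝ → ℝ} (hψ : ContDiff ℝ 1 ψ)
include hψ

lemma continuous_graphPoint : Continuous (graphPoint ψ) := by
  have := hψ.continuous
  exact continuous_point.comp (by fun_prop : Continuous fun u => (u, ψ u))

lemma continuous_areaDensity : Continuous (areaDensity ψ) := by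
  have := hψ.continuous_fderiv one_ne_zero
  unfold areaDensity
  fun_prop

lemma continuous_graphNormalVec : Continuous (graphNormalVec ψ) := by
  have := hψ.continuous_fderiv one_ne_zero
  refine (PiLp.continuous_toLp 2 _).comp (continuous_pi fun i => ?_)
  fin_cases i <;> simp <;> fun_prop

lemma continuous_graphNormal : Continuous (graphNormal ψ) :=
  ((continuous_areaDensity hψ).inv₀ fun u => (areaDensity_pos ψ u).ne').smul
    (continuous_graphNormalVec hψ)

lemma isClosedEmbedding_graphPoint : Topology.IsClosedEmbedding (graphPoint ψ) := by
  have h : graphPoint ψ = fun u => pointL (shear ψ hψ.continuous (u, 0)) := by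
    funext u; simp [shear, graphPoint]
  rw [h]
  exact ((shear ψ hψ.continuous).trans pointL.toHomeomorph).isClosedEmbedding.comp
    (Topology.IsClosedEmbedding.of_continuous_injective_isClosedMap (by fun_prop)
        (fun a b h => by simpa using h) (isClosedMap_prodMk_right 0))

end Graph

namespace BoundaryChart

variable {B : Set E3} (c : BoundaryChart B)

lemma contDiff_one_ψ : ContDiff ℝ 1 c.ψ := c.contDiff_ψ.of_le one_le_two

lemma isClosedEmbedding_pt : Topology.IsClosedEmbedding c.pt :=
  c.frame.symm.toHomeomorph.isClosedEmbedding.comp (isClosedEmbedding_graphPoint c.contDiff_one_ψ)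

lemma continuous_pt : Continuous c.pt := c.isClosedEmbedding_pt.continuous

lemma continuous_normal : Continuous c.normal :=
  c.frame.symm.linearIsometryEquiv.continuous.comp (continuous_graphNormal c.contDiff_one_ψ)

lemma continuous_density :
    Continuous fun u => c.weight (c.pt u) * areaDensity c.ψ u :=
  (c.contDiff_weight.continuous.comp c.continuous_pt).mul (continuous_areaDensity c.contDiff_one_ψ)

lemma hasCompactSupport_density :
    HasCompactSupport fun u => c.weight (c.pt u) * areaDensity c.ψ u :=
  (c.hasCompactSupport_weight.comp_isClosedEmbedding c.isClosedEmbedding_pt).mul_right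

/-- The divergence theorem for a function multiplied by the weight of a chart: in the frame of the
chart the body may be replaced by the whole region below the graph. -/
lemma setIntegral_fderiv_weight_mul (hB : MeasurableSet B) {f : E3 → ℝ}
    (hf : ContDiff ℝ 1 f) (v : E3) :
    ∫ x in B, fderiv ℝ (fun x => c.weight x * f x) x v ∂volume
      = ∫ u, (c.weight (c.pt u) * areaDensity c.ψ u) * (f (c.pt u) * inner ℝ (c.normal u) v) := by
  set g : E3 → ℝ := fun x => c.weight x * f x with hgdef
  have hg : ContDiff ℝ 1 g := (c.contDiff_weight.of_le one_le_two).mul hf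
  have hgc : HasCompactSupport g := c.hasCompactSupport_weight.mul_right
  set h : E3 → ℝ := fun y => g (c.frame.symm y)
  have hh : ContDiff ℝ 1 h := hg.comp (contDiff_affineIsometryEquiv _)
  have hhc : HasCompactSupport h := hgc.comp_homeomorph c.frame.symm.toHomeomorph
  have key : ∀ x, fderiv ℝ g x v = fderiv ℝ h (c.frame x) (c.frame.linearIsometryEquiv v) := by
    intro x
    have e : g = fun x => h (c.frame x) := by funext x; simp [h]
    have h1 : HasFDerivAt c.frame (c.frame.linearIsometryEquiv : E3 →L[ℝ] E3) x := by
      rw [affineIsometryEquiv_eq c.frame]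
      exact (c.frame.linearIsometryEquiv : E3 →L[ℝ] E3).hasFDerivAt.add_const _
    have h2 : HasFDerivAt (fun x => h (c.frame x)) _ x :=
      HasFDerivAt.comp (g := h) x (hh.differentiable one_ne_zero _).hasFDerivAt h1
    rw [e, h2.fderiv]
    rfl
  have hmeas : MeasurableSet {y : E3 | y 2 ≤ c.ψ (horiz y)} :=
    (isClosed_le (by fun_prop) (c.contDiff_ψ.continuous.comp continuous_horiz)).measurableSet
  have hind : ∀ x, indicator B (fun x => fderiv ℝ g x v) x
      = indicator (c.frame ⁻¹' {y : E3 | y 2 ≤ c.ψ (horiz y)}) (fun x => fderiv ℝ g x v) x := by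
    intro x
    by_cases hx : x ∈ tsupport c.weight
    · have := (c.mem_iff x hx).self_of_nhds
      by_cases hxB : x ∈ B
      · have h' : x ∈ c.frame ⁻¹' {y : E3 | y 2 ≤ c.ψ (horiz y)} := this.1 hxB
        rw [indicator_of_mem hxB, indicator_of_mem h']
      · have h' : x ∉ c.frame ⁻¹' {y : E3 | y 2 ≤ c.ψ (horiz y)} := fun h => hxB (this.2 h)
        rw [indicator_of_notMem hxB, indicator_of_notMem h']
    · have h0 : fderiv ℝ g x = 0 := by
        by_contra hne
        exact hx (tsupport_mul_subset_left (tsupport_fderiv_subset ℝ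
          (subset_tsupport _ (Function.mem_support.2 hne))))
      simp [indicator, h0]
  rw [← integral_indicator hB, funext hind,
    integral_indicator (c.frame.continuous.measurable hmeas)]
  simp_rw [key]
  rw [(measurePreserving_affineIsometryEquiv c.frame).setIntegral_preimage_emb
    c.frame.toHomeomorph.measurableEmbedding
    (fun y => fderiv ℝ h y (c.frame.linearIsometryEquiv v)),
    integral_below_graph c.contDiff_one_ψ hh hhc]
  congr 1
  funext u
  have e1 : inner ℝ (graphNormalVec c.ψ u) (c.frame.linearIsometryEquiv v)
      = areaDensity c.ψ u * inner ℝ (c.normal u) v := by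
    rw [← areaDensity_smul_graphNormal, real_inner_smul_left, normal]
    congr 1
    rw [← c.frame.linearIsometryEquiv.inner_map_map
      (c.frame.symm.linearIsometryEquiv (graphNormal c.ψ u)) v]
    congr 1
    exact (c.frame.linearIsometryEquiv.apply_symm_apply _).symm
  rw [e1]
  simp only [h, g, pt]
  ring

lemma mem_frontier_of_weight_ne_zero (u : ℝ × ℝ) (h : c.weight (c.pt u) ≠ 0) :
    c.pt u ∈ frontier B := by
  have h1 := c.mem_iff (c.pt u) (subset_tsupport _ (Function.mem_support.2 h))
  have h2 : c.pt u ∈ B := by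
    rw [h1.self_of_nhds]
    simp [pt, graphPoint]
  refine ⟨subset_closure h2, fun hint => ?_⟩
  -- Points straight above the graph, in the frame of the chart, are outside the body.
  have h3 : Tendsto (fun ε : ℝ => c.frame.symm (point u (c.ψ u + ε))) (𝓝[>] 0) (𝓝 (c.pt u)) := by
    have : Continuous (fun ε : ℝ => c.frame.symm (point u (c.ψ u + ε))) :=
      c.frame.symm.continuous.comp (continuous_point.comp
        (by fun_prop : Continuous fun ε : ℝ => (u, c.ψ u + ε)))
    have h4 := this.tendsto 0
    simp only [add_zero] at h4
    exact h4.mono_left nhdsWithin_le_nhds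
  obtain ⟨ε, ⟨h5, h6⟩, h7⟩ := ((h3.eventually (h1.and (mem_interior_iff_mem_nhds.1 hint))).and
    self_mem_nhdsWithin).exists
  have := h5.1 h6
  simp at this
  exact absurd this (not_le.2 h7)

end BoundaryChart

namespace RigidBody

variable (B : RigidBody)

/-- The integral of a scalar function of the boundary point and of the outward unit normal over the
boundary of the body. -/
def bdry (F : E3 → E3 → ℝ) : ℝ :=
  ∑ i, ∫ u : ℝ × ℝ, ((B.chart i).weight ((B.chart i).pt u) * areaDensity (B.chart i).ψ u) *
    F ((B.chart i).pt u) ((B.chart i).normal u)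

variable {B}

lemma bdry_congr {F G : E3 → E3 → ℝ} (h : ∀ x n, B.IsOutwardNormal x n → F x n = G x n) :
    B.bdry F = B.bdry G := by
  refine Finset.sum_congr rfl fun i _ => ?_
  congr 1
  funext u
  by_cases hw : (B.chart i).weight ((B.chart i).pt u) = 0
  · simp [hw]
  · rw [h _ _ ⟨i, u, rfl, hw, rfl⟩]

lemma integrable_bdry_chart {F : E3 → E3 → ℝ} (hF : Continuous fun p : E3 × E3 => F p.1 p.2)
    (i : Fin B.numCharts) :
    Integrable fun u : ℝ × ℝ =>
      ((B.chart i).weight ((B.chart i).pt u) * areaDensity (B.chart i).ψ u) *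
        F ((B.chart i).pt u) ((B.chart i).normal u) :=
  ((B.chart i).continuous_density.mul (hF.comp ((B.chart i).continuous_pt.prodMk
    (B.chart i).continuous_normal))).integrable_of_hasCompactSupport
    (B.chart i).hasCompactSupport_density.mul_right

lemma bdry_sum {ι : Type*} (s : Finset ι) {F : ι → E3 → E3 → ℝ}
    (hF : ∀ j ∈ s, Continuous fun p : E3 × E3 => F j p.1 p.2) :
    B.bdry (fun x n => ∑ j ∈ s, F j x n) = ∑ j ∈ s, B.bdry (F j) := by
  simp only [bdry]
  rw [Finset.sum_comm]
  refine Finset.sum_congr rfl fun i _ => ?_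
  simp_rw [Finset.mul_sum]
  exact integral_finsetSum _ fun j hj => integrable_bdry_chart (hF j hj) i

lemma bdry_add {F G : E3 → E3 → ℝ} (hF : Continuous fun p : E3 × E3 => F p.1 p.2)
    (hG : Continuous fun p : E3 × E3 => G p.1 p.2) :
    B.bdry (fun x n => F x n + G x n) = B.bdry F + B.bdry G := by
  simp only [bdry, ← Finset.sum_add_distrib]
  refine Finset.sum_congr rfl fun i _ => ?_
  simp_rw [mul_add]
  exact integral_add (integrable_bdry_chart hF i) (integrable_bdry_chart hG i)

lemma bdry_const_mul (r : ℝ) (F : E3 → E3 → ℝ) :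
    B.bdry (fun x n => r * F x n) = r * B.bdry F := by
  simp only [bdry, Finset.mul_sum]
  refine Finset.sum_congr rfl fun i _ => ?_
  rw [← integral_const_mul]
  congr 1
  funext u
  ring

lemma inner_boundaryIntegral {F : E3 → E3 → E3} (hF : Continuous fun p : E3 × E3 => F p.1 p.2)
    (a : E3) : inner ℝ (B.boundaryIntegral F) a = B.bdry (fun x n => inner ℝ (F x n) a) := by
  simp only [boundaryIntegral, bdry, sum_inner]
  refine Finset.sum_congr rfl fun i _ => ?_
  have hi : Integrable fun u : ℝ × ℝ =>
      ((B.chart i).weight ((B.chart i).pt u) * areaDensity (B.chart i).ψ u) •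
        F ((B.chart i).pt u) ((B.chart i).normal u) :=
    ((B.chart i).continuous_density.smul (hF.comp ((B.chart i).continuous_pt.prodMk
      (B.chart i).continuous_normal))).integrable_of_hasCompactSupport
      (B.chart i).hasCompactSupport_density.smul_right
  rw [real_inner_comm, ← integral_inner hi]
  congr 1
  funext u
  rw [real_inner_smul_right, real_inner_comm]

lemma boundaryIntegral_congr {F G : E3 → E3 → E3}
    (h : ∀ x n, B.IsOutwardNormal x n → F x n = G x n) :
    B.boundaryIntegral F = B.boundaryIntegral G := by
  refine Finset.sum_congr rfl fun i _ => ?_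
  congr 1
  funext u
  by_cases hw : (B.chart i).weight ((B.chart i).pt u) = 0
  · simp [hw]
  · rw [h _ _ ⟨i, u, rfl, hw, rfl⟩]

lemma IsOutwardNormal.mem_frontier {x n : E3} (h : B.IsOutwardNormal x n) :
    x ∈ frontier B.carrier := by
  obtain ⟨i, u, rfl, hw, -⟩ := h
  exact (B.chart i).mem_frontier_of_weight_ne_zero u hw

/-- The divergence theorem for the body, for a field of constant direction: the partition of unity
localizes to the charts, and what it leaves over vanishes near the boundary. -/
theorem setIntegral_fderiv {f : E3 → ℝ} (hf : ContDiff ℝ 1 f) (v : E3) :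
    ∫ x in B.carrier, fderiv ℝ f x v = B.bdry fun x n => f x * inner ℝ n v := by
  have hBm : MeasurableSet B.carrier := B.isCompact_carrier.isClosed.measurableSet
  set W : E3 → ℝ := fun x => ∑ i, (B.chart i).weight x with hW
  have hWd : ContDiff ℝ 1 W :=
    ContDiff.sum fun i _ => (B.chart i).contDiff_weight.of_le one_le_two
  -- The part of `f` off the charts vanishes near the boundary: cut off to zero outside the body it
  -- is a regular function `G` of compact support.
  set g : E3 → ℝ := fun x => (1 - W x) * f x with hg
  have hgd : ContDiff ℝ 1 g := (contDiff_const.sub hWd).mul hf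
  have hgfr : ∀ x ∈ frontier B.carrier, g =ᶠ[𝓝 x] 0 := by
    intro x hx
    filter_upwards [B.sum_weight x hx] with y hy
    simp [hg, hW, hy]
  set G : E3 → ℝ := B.carrier.indicator g with hG
  have hloc : ∀ x, (G =ᶠ[𝓝 x] g ∧ x ∈ B.carrier) ∨ (G =ᶠ[𝓝 x] 0 ∧ x ∉ B.carrier)
      ∨ (G =ᶠ[𝓝 x] 0 ∧ g =ᶠ[𝓝 x] 0) := by
    intro x
    by_cases hx : x ∈ frontier B.carrier
    · right; right
      refine ⟨?_, hgfr x hx⟩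
      filter_upwards [hgfr x hx] with y hy
      simp [hG, indicator, hy]
    · by_cases hxB : x ∈ B.carrier
      · left
        refine ⟨?_, hxB⟩
        have : x ∈ interior B.carrier := by
          by_contra h
          exact hx ⟨subset_closure hxB, h⟩
        filter_upwards [mem_interior_iff_mem_nhds.1 this] with y hy
        simp [hG, hy]
      · right; left
        refine ⟨?_, hxB⟩
        filter_upwards [B.isCompact_carrier.isClosed.isOpen_compl.mem_nhds hxB] with y hy
        have hy' : y ∉ B.carrier := hy
        simp [hG, hy']
  have hGd : ContDiff ℝ 1 G := by
    rw [contDiff_iff_contDiffAt]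
    intro x
    rcases hloc x with h | h | h
    · exact hgd.contDiffAt.congr_of_eventuallyEq h.1
    · exact contDiffAt_const.congr_of_eventuallyEq h.1
    · exact contDiffAt_const.congr_of_eventuallyEq h.1
  have hGc : HasCompactSupport G :=
    HasCompactSupport.intro B.isCompact_carrier fun x hx => by simp [hG, hx]
  have h1 : ∫ x in B.carrier, fderiv ℝ g x v = 0 := by
    rw [← integral_fderiv_apply_eq_zero volume hGd hGc v, ← integral_indicator hBm]
    congr 1
    funext x
    rcases hloc x with h | h | h
    · rw [indicator_of_mem h.2, h.1.fderiv_eq]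
    · rw [indicator_of_notMem h.2, h.1.fderiv_eq]; simp
    · rw [h.1.fderiv_eq]; simp [indicator, h.2.fderiv_eq]
  have hint : ∀ {k : E3 → ℝ}, ContDiff ℝ 1 k →
      IntegrableOn (fun x => fderiv ℝ k x v) B.carrier := fun hk =>
    ((hk.continuous_fderiv one_ne_zero).clm_apply
      continuous_const).continuousOn.integrableOn_compact B.isCompact_carrier
  have hwf : ∀ i, ContDiff ℝ 1 (fun x => (B.chart i).weight x * f x) := fun i =>
    ((B.chart i).contDiff_weight.of_le one_le_two).mul hf
  have e : ∀ x, fderiv ℝ f x v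
      = fderiv ℝ g x v + ∑ i, fderiv ℝ (fun x => (B.chart i).weight x * f x) x v := by
    intro x
    have h2 : f = fun x => g x + ∑ i, (B.chart i).weight x * f x := by
      funext y
      simp only [hg, hW, ← Finset.sum_mul]
      ring
    have h3 : HasFDerivAt (fun x => g x + ∑ i, (B.chart i).weight x * f x)
        (fderiv ℝ g x + ∑ i, fderiv ℝ (fun x => (B.chart i).weight x * f x) x) x :=
      (hgd.differentiable one_ne_zero x).hasFDerivAt.add (HasFDerivAt.fun_sum fun i _ =>
        ((hwf i).differentiable one_ne_zero x).hasFDerivAt)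
    conv_lhs => rw [h2]
    rw [h3.fderiv]
    simp
  simp_rw [e]
  rw [integral_add (hint hgd) (integrable_finsetSum _ fun i _ => hint (hwf i)), h1, zero_add,
    integral_finsetSum _ fun i _ => hint (hwf i)]
  refine Finset.sum_congr rfl fun i _ => ?_
  exact (B.chart i).setIntegral_fderiv_weight_mul hBm hf v

/-- The divergence theorem for the body. -/
theorem setIntegral_div {X : E3 → E3} (hX : ContDiff ℝ 1 X) :
    ∫ x in B.carrier, div X x = B.bdry fun x n => inner ℝ (X x) n := by
  have hXi : ∀ i, ContDiff ℝ 1 (fun x => X x i) := fun i => contDiff_euclidean.1 hX i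
  have e : ∀ x i, fderiv ℝ X x (EuclideanSpace.single i 1) i
      = fderiv ℝ (fun x => X x i) x (EuclideanSpace.single i 1) := by
    intro x i
    have h := (EuclideanSpace.proj (𝕜 := ℝ) i).hasFDerivAt.comp x
      (hX.differentiable one_ne_zero x).hasFDerivAt
    exact (congrArg (fun L : E3 →L[ℝ] ℝ => L (EuclideanSpace.single i 1)) h.fderiv).symm
  simp only [div, e]
  rw [integral_finsetSum]
  · simp_rw [setIntegral_fderiv (hXi _)]
    rw [← bdry_sum]
    · refine bdry_congr fun x n _ => ?_
      simp [PiLp.inner_apply, mul_comm]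
    · intro i _
      have := (hXi i).continuous
      fun_prop
  · intro i _
    exact (((hXi i).continuous_fderiv one_ne_zero).clm_apply
      continuous_const).continuousOn.integrableOn_compact B.isCompact_carrier

end RigidBody

/-! ### The divergence theorem in the fluid domain -/

lemma contDiff_coord {n : WithTop ℕ∞} (i : Fin 3) : ContDiff ℝ n (fun x : E3 => x i) :=
  (EuclideanSpace.proj (𝕜 := ℝ) i).contDiff

lemma div_eq_sum_inner {ι : Type*} [Fintype ι] (b : OrthonormalBasis ι ℝ E3) (X : E3 → E3)
    (x : E3) : div X x = ∑ i, inner ℝ (b i) (fderiv ℝ X x (b i)) := by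
  have h1 := LinearMap.trace_eq_sum_inner (fderiv ℝ X x : E3 →ₗ[ℝ] E3) b
  have h2 := LinearMap.trace_eq_sum_inner (fderiv ℝ X x : E3 →ₗ[ℝ] E3)
    (EuclideanSpace.basisFun (Fin 3) ℝ)
  rw [h1] at h2
  simp only [ContinuousLinearMap.coe_coe] at h2
  rw [h2]
  simp [div, EuclideanSpace.inner_single_left]

lemma div_congr {X Y : E3 → E3} {x : E3} (h : X =ᶠ[𝓝 x] Y) : div X x = div Y x := by
  simp only [div, h.fderiv_eq]

lemma continuous_div {X : E3 → E3} (hX : ContDiff ℝ 1 X) : Continuous (div X) := by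
  have h : ∀ i : Fin 3, Continuous fun x => fderiv ℝ X x (EuclideanSpace.single i 1) := fun i =>
    (hX.continuous_fderiv one_ne_zero).clm_apply continuous_const
  unfold div
  fun_prop

lemma hasCompactSupport_div {X : E3 → E3} (hX : HasCompactSupport X) :
    HasCompactSupport (div X) := by
  refine (hX.fderiv ℝ).mono' fun x hx => subset_tsupport _ ?_
  contrapose! hx
  simp only [Function.mem_support, not_not] at hx ⊢
  simp [div, hx]

/-- The divergence theorem in the region below a graph. -/
theorem integral_div_below_graph {ψ : ℝ × ℝ → ℝ} (hψ : ContDiff ℝ 1 ψ) {X : E3 → E3}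
    (hX : ContDiff ℝ 1 X) (hc : HasCompactSupport X) :
    ∫ x in {x : E3 | x 2 ≤ ψ (horiz x)}, div X x
      = ∫ u, inner ℝ (X (graphPoint ψ u)) (graphNormalVec ψ u) := by
  have hXi : ∀ i, ContDiff ℝ 1 (fun x => X x i) := fun i => contDiff_euclidean.1 hX i
  have hXc : ∀ i, HasCompactSupport (fun x => X x i) := fun i =>
    hc.comp_left (g := fun y : E3 => y i) rfl
  have e : ∀ x i, fderiv ℝ X x (EuclideanSpace.single i 1) i
      = fderiv ℝ (fun x => X x i) x (EuclideanSpace.single i 1) := by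
    intro x i
    have h := (EuclideanSpace.proj (𝕜 := ℝ) i).hasFDerivAt.comp x
      (hX.differentiable one_ne_zero x).hasFDerivAt
    exact (congrArg (fun L : E3 →L[ℝ] ℝ => L (EuclideanSpace.single i 1)) h.fderiv).symm
  simp only [div, e]
  rw [integral_finsetSum]
  · simp_rw [integral_below_graph hψ (hXi _) (hXc _)]
    rw [← integral_finsetSum]
    · congr 1
      funext u
      simp [PiLp.inner_apply, mul_comm]
    · intro i _
      apply Continuous.integrable_of_hasCompactSupport
      · exact ((hXi i).continuous.comp (continuous_graphPoint hψ)).mul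
          ((continuous_graphNormalVec hψ).inner continuous_const)
      · exact ((hXc i).comp_isClosedEmbedding (isClosedEmbedding_graphPoint hψ)).mul_right
  · intro i _
    exact (integrable_fderiv_apply volume (hXi i) (hXc i) _).integrableOn

lemma volume_graph {ψ : ℝ × ℝ → ℝ} (hψ : Continuous ψ) :
    volume {x : E3 | x 2 = ψ (horiz x)} = 0 := by
  have hmp : MeasurePreserving (fun q => pointL (shear ψ hψ q)) volume volume :=
    measurePreserving_pointL.comp (measurePreserving_shear ψ hψ)
  have hme : MeasurableEmbedding (fun q => pointL (shear ψ hψ q)) :=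
    ((shear ψ hψ).trans pointL.toHomeomorph).measurableEmbedding
  rw [← hmp.measure_preimage_emb hme]
  have hset : (fun q => pointL (shear ψ hψ q)) ⁻¹' {x : E3 | x 2 = ψ (horiz x)}
      = univ ×ˢ {0} := by
    ext q
    simp [shear]
  rw [hset, Measure.volume_eq_prod, Measure.prod_prod]
  simp

/-- A smooth cutoff function which is `1` near a compact set and supported in a given open
neighbourhood of it. -/
lemma exists_cutoff {K U : Set E3} (hK : IsCompact K) (hU : IsOpen U) (hKU : K ⊆ U) :
    ∃ θ : E3 → ℝ, ContDiff ℝ 2 θ ∧ HasCompactSupport θ ∧ tsupport θ ⊆ U ∧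
      ∀ᶠ x in 𝓝ˢ K, θ x = 1 := by
  obtain ⟨K', hK', h1, h2⟩ := exists_compact_between hK hU hKU
  obtain ⟨θ, h3, h4, -⟩ := exists_contMDiffMap_one_nhds_of_subset_interior
    (modelWithCornersSelf ℝ E3) (n := 2) hK.isClosed h1
  have h5 : tsupport θ ⊆ K' := closure_minimal
    (fun x hx => by by_contra h; exact hx (h4 x h)) hK'.isClosed
  exact ⟨θ, θ.contMDiff.contDiff, hK'.of_isClosed_subset (isClosed_tsupport _) h5, h5.trans h2, h3⟩

/-- A function that is regular on the support of a smooth cutoff becomes regular everywhere when it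
is multiplied by the cutoff. -/
lemma contDiff_cutoff_smul {F : Type*} [NormedAddCommGroup F] [NormedSpace ℝ F] {θ : E3 → ℝ}
    {X : E3 → F} {n : WithTop ℕ∞} (hθ : ContDiff ℝ n θ)
    (hX : ∀ x ∈ tsupport θ, ContDiffAt ℝ n X x) : ContDiff ℝ n (fun x => θ x • X x) := by
  rw [contDiff_iff_contDiffAt]
  intro x
  by_cases hx : x ∈ tsupport θ
  · exact hθ.contDiffAt.smul (hX x hx)
  · have : (fun x => θ x • X x) =ᶠ[𝓝 x] fun _ => 0 := by
      filter_upwards [notMem_tsupport_iff_eventuallyEq.1 hx] with y hy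
      simp [hy]
    exact contDiffAt_const.congr_of_eventuallyEq this

section Static

variable {P : Params} {B : RigidBody} {M : Motion} {I : Set ℝ} {t : ℝ}

lemma contDiff_place {n : WithTop ℕ∞} : ContDiff ℝ n (place M t) :=
  (M.Q t).contDiff.add contDiff_const

/-- The rigid displacement of the body, as a homeomorphism of space. -/
def placeHomeo (M : Motion) (t : ℝ) : E3 ≃ₜ E3 :=
  (M.Q t).toHomeomorph.trans (Homeomorph.addRight (M.c t))

lemma coe_placeHomeo : (placeHomeo M t : E3 → E3) = place M t := rfl

lemma measurePreserving_place : MeasurePreserving (place M t) volume volume :=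
  (measurePreserving_add_right (volume : Measure E3) (M.c t)).comp (M.Q t).measurePreserving

lemma setIntegral_bodyAt {F : Type*} [NormedAddCommGroup F] [NormedSpace ℝ F] (f : E3 → F) :
    ∫ x in bodyAt B M t, f x = ∫ l in B.carrier, f (place M t l) :=
  measurePreserving_place.setIntegral_image_emb
    (placeHomeo M t).measurableEmbedding f B.carrier

lemma isCompact_bodyAt : IsCompact (bodyAt B M t) :=
  B.isCompact_carrier.image (placeHomeo M t).continuous

/-- The integral of a scalar function of the boundary point and of the outward unit normal over the
surface of the moving body. -/
def bodyS (B : RigidBody) (M : Motion) (t : ℝ) (F : E3 → E3 → ℝ) : ℝ :=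
  B.bdry fun l n => F (place M t l) (M.Q t n)

/-- `n` is the outward unit normal of the moving body at the point `r` of its surface. -/
def IsBodyNormal (B : RigidBody) (M : Motion) (t : ℝ) (r n : E3) : Prop :=
  ∃ l m, B.IsOutwardNormal l m ∧ r = place M t l ∧ n = M.Q t m

lemma bodyS_congr {F G : E3 → E3 → ℝ} (h : ∀ r n, IsBodyNormal B M t r n → F r n = G r n) :
    bodyS B M t F = bodyS B M t G :=
  RigidBody.bdry_congr fun l n hl => h _ _ ⟨l, n, hl, rfl, rfl⟩

lemma IsBodyNormal.mem_frontier {r n : E3} (h : IsBodyNormal B M t r n) :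
    r ∈ frontier (bodyAt B M t) := by
  obtain ⟨l, m, h, rfl, rfl⟩ := h
  rw [bodyAt, ← coe_placeHomeo, ← (placeHomeo M t).image_frontier]
  exact mem_image_of_mem _ h.mem_frontier

/-- The divergence theorem for the moving body. -/
theorem setIntegral_bodyAt_div {X : E3 → E3} (hX : ContDiff ℝ 1 X) :
    ∫ x in bodyAt B M t, div X x = bodyS B M t fun r n => inner ℝ (X r) n := by
  rw [setIntegral_bodyAt]
  set Y : E3 → E3 := fun l => (M.Q t).symm (X (place M t l)) with hY
  have hYd : ContDiff ℝ 1 Y := (M.Q t).symm.contDiff.comp (hX.comp contDiff_place)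
  have e : ∀ l, div X (place M t l) = div Y l := by
    intro l
    have h1 : HasFDerivAt (place M t) (M.Q t : E3 →L[ℝ] E3) l :=
      (M.Q t : E3 →L[ℝ] E3).hasFDerivAt.add_const _
    have h2 : HasFDerivAt Y _ l := HasFDerivAt.comp (g := (M.Q t).symm) l
      ((M.Q t).symm : E3 →L[ℝ] E3).hasFDerivAt (HasFDerivAt.comp (g := X) l
        (hX.differentiable one_ne_zero _).hasFDerivAt h1)
    rw [div_eq_sum_inner ((EuclideanSpace.basisFun (Fin 3) ℝ).map (M.Q t)),
      div_eq_sum_inner (EuclideanSpace.basisFun (Fin 3) ℝ), h2.fderiv]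
    refine Finset.sum_congr rfl fun i _ => ?_
    rw [← (M.Q t).inner_map_map (EuclideanSpace.basisFun (Fin 3) ℝ i)]
    simp
  simp_rw [e]
  rw [RigidBody.setIntegral_div hYd, bodyS]
  congr 1
  funext l n
  rw [← (M.Q t).inner_map_map (Y l) n]
  simp [hY]

/-- The integral over the flat bottom at height `b`, absent if `b = ⊥`. -/
def bottomIntegral (b : WithBot ℝ) (f : E3 → ℝ) : ℝ :=
  WithBot.recBotCoe 0 (fun h => ∫ u, f (point u h)) b

@[simp] lemma bottomIntegral_bot (f : E3 → ℝ) : bottomIntegral ⊥ f = 0 := rfl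

@[simp] lemma bottomIntegral_coe (h : ℝ) (f : E3 → ℝ) :
    bottomIntegral (h : WithBot ℝ) f = ∫ u, f (point u h) := rfl

lemma bottomIntegral_congr {b : WithBot ℝ} {f g : E3 → ℝ}
    (h : ∀ x : E3, b = ((x 2 : ℝ) : WithBot ℝ) → f x = g x) :
    bottomIntegral b f = bottomIntegral b g := by
  induction b with
  | bot => rfl
  | coe a =>
    simp only [bottomIntegral_coe]
    congr 1
    funext u
    exact h _ (by simp)

variable (hS : IsSolution P B M I) (ht : t ∈ I)
include hS ht

lemma IsSolution.contDiff_η : ContDiff ℝ 2 (M.η t) := by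
  rw [contDiff_iff_contDiffAt]
  intro u
  exact (hS.contDiffAt_η t ht u).comp u (by fun_prop : ContDiffAt ℝ 2 (fun u => (t, u)) u)

lemma IsSolution.contDiff_one_η : ContDiff ℝ 1 (M.η t) := (hS.contDiff_η ht).of_le one_le_two

lemma IsSolution.contDiffAt_Φ_space {x : E3} (hx : x ∈ closedFluid B M t) :
    ContDiffAt ℝ 2 (M.Φ t) x :=
  (hS.contDiffAt_Φ t ht x hx).comp x (by fun_prop : ContDiffAt ℝ 2 (fun x => (t, x)) x)

lemma IsSolution.graphPoint_mem (u : ℝ × ℝ) : graphPoint (M.η t) u ∈ closedFluid B M t := by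
  refine ⟨⟨?_, ?_⟩, fun h => ?_⟩
  · simpa [graphPoint] using (hS.bottom_lt t ht u).le
  · simp [graphPoint]
  · have := (hS.submerged t ht _ (interior_subset h)).2
    simp [graphPoint] at this

lemma IsSolution.bottom_mem {x : E3} (hx : M.bottom = ((x 2 : ℝ) : WithBot ℝ)) :
    x ∈ closedFluid B M t := by
  refine ⟨⟨hx.le, ?_⟩, fun h => ?_⟩
  · have := hS.bottom_lt t ht (horiz x)
    rw [hx, WithBot.coe_lt_coe] at this
    exact this.le
  · have := (hS.submerged t ht _ (interior_subset h)).1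
    rw [hx] at this
    exact lt_irrefl _ this

lemma IsSolution.frontier_subset : frontier (bodyAt B M t) ⊆ closedFluid B M t := by
  intro x hx
  have h := hS.submerged t ht x (isCompact_bodyAt.isClosed.frontier_subset hx)
  exact ⟨⟨h.1.le, h.2.le⟩, hx.2⟩

lemma IsSolution.isClosed_closedFluid : IsClosed (closedFluid B M t) := by
  have hη := (hS.contDiff_η ht).continuous
  refine IsClosed.inter ?_ isOpen_interior.isClosed_compl
  refine IsClosed.inter ?_ (isClosed_le (by fun_prop) (hη.comp continuous_horiz))
  change IsClosed {x : E3 | M.bottom ≤ ((x 2 : ℝ) : WithBot ℝ)}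
  generalize M.bottom = b
  induction b with
  | bot => simp
  | coe a =>
    have : IsClosed {x : E3 | a ≤ x 2} := isClosed_le (by fun_prop) (by fun_prop)
    simpa using this

omit hS ht in
lemma fluid_subset_closedFluid : fluid B M t ⊆ closedFluid B M t :=
  fun _ hx => ⟨⟨hx.1.1.le, hx.1.2.le⟩, fun h => hx.2 (interior_subset h)⟩

lemma IsSolution.isOpen_fluid : IsOpen (fluid B M t) := by
  have hη := (hS.contDiff_η ht).continuous
  refine IsOpen.inter ?_ isCompact_bodyAt.isClosed.isOpen_compl
  refine IsOpen.inter ?_ (isOpen_lt (by fun_prop) (hη.comp continuous_horiz))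
  change IsOpen {x : E3 | M.bottom < ((x 2 : ℝ) : WithBot ℝ)}
  generalize M.bottom = b
  induction b with
  | bot => simp
  | coe a =>
    have : IsOpen {x : E3 | a < x 2} := isOpen_lt (by fun_prop) (by fun_prop)
    simpa using this

/-- The divergence theorem in the fluid domain, for a field on the whole space. Up to a null set the
region below the free surface is the disjoint union of the region below the bottom, the fluid and
the body, so that the two theorems for the region below a graph and for the body apply. -/
lemma IsSolution.setIntegral_fluid_div_of_contDiff {X : E3 → E3} (hX : ContDiff ℝ 1 X)
    (hc : HasCompactSupport X) :
    ∫ x in fluid B M t, div X x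
      = (∫ u, inner ℝ (X (graphPoint (M.η t) u)) (graphNormalVec (M.η t) u))
        - bottomIntegral M.bottom (fun x => X x 2)
        - bodyS B M t fun r n => inner ℝ (X r) n := by
  have hη := hS.contDiff_one_η ht
  have hint : Integrable (div X) :=
    (continuous_div hX).integrable_of_hasCompactSupport (hasCompactSupport_div hc)
  rw [← setIntegral_bodyAt_div hX, ← integral_div_below_graph hη hX hc]
  have hbm : MeasurableSet (bodyAt B M t) := isCompact_bodyAt.isClosed.measurableSet
  set A : Set E3 := {x | ((x 2 : ℝ) : WithBot ℝ) ≤ M.bottom} with hA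
  have hbot : ∫ x in A, div X x = bottomIntegral M.bottom (fun x => X x 2) ∧ MeasurableSet A := by
    rw [hA]
    generalize M.bottom = b
    induction b with
    | bot => simp
    | coe a =>
      have h := integral_div_below_graph (ψ := fun _ => a) contDiff_const hX hc
      constructor
      · simp only [WithBot.coe_le_coe, bottomIntegral_coe]
        rw [h]
        congr 1
        funext u
        simp [graphPoint, graphNormalVec, PiLp.inner_apply, Fin.sum_univ_three]
      · have : IsClosed {x : E3 | x 2 ≤ a} := isClosed_le (by fun_prop) (by fun_prop)
        simpa using this.measurableSet
  have hset : ({x : E3 | x 2 ≤ M.η t (horiz x)} : Set E3)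
      =ᵐ[volume] ((A ∪ fluid B M t) ∪ bodyAt B M t : Set E3) := by
    have h0 : ∀ᵐ x : E3, x 2 ≠ M.η t (horiz x) := by
      rw [ae_iff]
      simpa using volume_graph hη.continuous
    filter_upwards [h0] with x hx
    apply propext
    change x 2 ≤ M.η t (horiz x) ↔ x ∈ (A ∪ fluid B M t) ∪ bodyAt B M t
    constructor
    · intro h
      have h1 := lt_of_le_of_ne h hx
      by_cases hb : x ∈ bodyAt B M t
      · exact Or.inr hb
      · rcases le_or_gt ((x 2 : ℝ) : WithBot ℝ) M.bottom with h2 | h2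
        · exact Or.inl (Or.inl h2)
        · exact Or.inl (Or.inr ⟨⟨h2, h1⟩, hb⟩)
    · rintro ((h | h) | h)
      · exact (WithBot.coe_lt_coe.1 (lt_of_le_of_lt h (hS.bottom_lt t ht (horiz x)))).le
      · exact h.1.2.le
      · exact (hS.submerged t ht x h).2.le
  rw [setIntegral_congr_set hset, setIntegral_union _ hbm hint.integrableOn hint.integrableOn,
    setIntegral_union _ (hS.isOpen_fluid ht).measurableSet hint.integrableOn hint.integrableOn,
    hbot.1]
  · ring
  · rw [Set.disjoint_left]
    exact fun x h1 h2 => absurd h2.1.1 (not_lt.2 h1)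
  · rw [Set.disjoint_left]
    rintro x (h1 | h1) h2
    · exact absurd (hS.submerged t ht x h2).1 (not_lt.2 h1)
    · exact h1.2 h2

/-- The divergence theorem in the fluid domain, for a field that is regular only up to the boundary
of the fluid: a cutoff that is `1` on the relevant part of the closed fluid extends it. -/
theorem IsSolution.setIntegral_fluid_div {X : E3 → E3} {K : Set E3} (hK : IsCompact K)
    (hX : ∀ x ∈ closedFluid B M t, ContDiffAt ℝ 1 X x)
    (hXK : ∀ x ∈ closedFluid B M t, x ∉ K → X x = 0) :
    ∫ x in fluid B M t, div X x
      = (∫ u, inner ℝ (X (graphPoint (M.η t) u)) (graphNormalVec (M.η t) u))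
        - bottomIntegral M.bottom (fun x => X x 2)
        - bodyS B M t fun r n => inner ℝ (X r) n := by
  have hU : IsOpen {x | ContDiffAt ℝ 1 X x} := by
    rw [isOpen_iff_mem_nhds]
    exact fun x hx => ContDiffAt.eventually hx (by simp)
  obtain ⟨θ, h1, h2, h3, h4⟩ := exists_cutoff (hK.inter_right (hS.isClosed_closedFluid ht)) hU
    (fun x hx => hX x hx.2)
  have heq : ∀ x ∈ closedFluid B M t, θ x • X x = X x := by
    intro x hx
    by_cases hxK : x ∈ K
    · rw [h4.self_of_nhdsSet x ⟨hxK, hx⟩, one_smul]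
    · rw [hXK x hx hxK, smul_zero]
  have := hS.setIntegral_fluid_div_of_contDiff ht (contDiff_cutoff_smul (h1.of_le one_le_two)
    fun x hx => h3 hx) (X := fun x => θ x • X x) h2.smul_right
  have e1 : ∫ x in fluid B M t, div (fun x => θ x • X x) x = ∫ x in fluid B M t, div X x := by
    refine setIntegral_congr_fun (hS.isOpen_fluid ht).measurableSet fun x hx => div_congr ?_
    filter_upwards [(hS.isOpen_fluid ht).mem_nhds hx] with y hy
    exact heq y (fluid_subset_closedFluid hy)
  rw [e1] at this
  rw [this]
  congr 1
  · congr 1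
    · congr 1
      funext u
      rw [heq _ (hS.graphPoint_mem ht u)]
    · exact bottomIntegral_congr fun x hx => by rw [heq x (hS.bottom_mem ht hx)]
  · exact bodyS_congr fun r n h => by rw [heq r (hS.frontier_subset ht h.mem_frontier)]

end Static

/-! ### The vector product and rigid velocity fields -/

/-- The vector product as a continuous bilinear map. -/
def crossB : E3 →L[ℝ] E3 →L[ℝ] E3 :=
  LinearMap.toContinuousLinearMap ((LinearMap.toContinuousLinearMap : (E3 →ₗ[ℝ] E3) ≃ₗ[ℝ] _) ∘ₗ
    LinearMap.mk₂ ℝ cross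
      (fun a b c => by simp [cross]) (fun r a b => by simp [cross])
      (fun a b c => by simp [cross]) (fun r a b => by simp [cross]))

lemma crossB_apply (a b : E3) : crossB a b = cross a b := rfl

lemma inner_eq_sum (a b : E3) : inner ℝ a b = a 0 * b 0 + a 1 * b 1 + a 2 * b 2 := by
  simp [PiLp.inner_apply, Fin.sum_univ_three, mul_comm]

lemma cross_apply_zero (a b : E3) : cross a b 0 = a 1 * b 2 - a 2 * b 1 := by
  simp [cross, crossProduct]

lemma cross_apply_one (a b : E3) : cross a b 1 = a 2 * b 0 - a 0 * b 2 := by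
  simp [cross, crossProduct]

lemma cross_apply_two (a b : E3) : cross a b 2 = a 0 * b 1 - a 1 * b 0 := by
  simp [cross, crossProduct]

lemma inner_cross_rotate (a b c : E3) : inner ℝ a (cross b c) = inner ℝ b (cross c a) := by
  simp only [inner_eq_sum, cross_apply_zero, cross_apply_one, cross_apply_two]
  ring

lemma inner_cross_self (a b : E3) : inner ℝ a (cross b a) = 0 := by
  simp only [inner_eq_sum, cross_apply_zero, cross_apply_one, cross_apply_two]
  ring

lemma cross_self_eq_zero (a : E3) : cross a a = 0 := by
  ext i; fin_cases i <;> simp [cross, crossProduct, mul_comm]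

lemma norm_cross_le (a b : E3) : ‖cross a b‖ ≤ ‖a‖ * ‖b‖ := by
  rw [← Real.sqrt_sq (by positivity : 0 ≤ ‖a‖ * ‖b‖), ← Real.sqrt_sq (norm_nonneg (cross a b))]
  apply Real.sqrt_le_sqrt
  rw [mul_pow, ← real_inner_self_eq_norm_sq, ← real_inner_self_eq_norm_sq,
    ← real_inner_self_eq_norm_sq]
  simp only [inner_eq_sum, cross_apply_zero, cross_apply_one, cross_apply_two]
  nlinarith [sq_nonneg (a 0 * b 0 + a 1 * b 1 + a 2 * b 2)]

/-- The velocity field `a + b × x` of a rigid motion. Testing with `b = 0` gives the linear, with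
`a = 0` the angular momentum. -/
def killing (a b x : E3) : E3 := a + cross b x

lemma hasFDerivAt_killing (a b x : E3) : HasFDerivAt (killing a b) (crossB b) x :=
  (crossB b).hasFDerivAt.const_add a

lemma contDiff_killing (a b : E3) {n : WithTop ℕ∞} : ContDiff ℝ n (killing a b) :=
  contDiff_const.add (crossB b).contDiff

@[fun_prop] lemma continuous_killing (a b : E3) : Continuous (killing a b) :=
  (contDiff_killing a b (n := 0)).continuous

lemma norm_killing_le (a b x : E3) : ‖killing a b x‖ ≤ (‖a‖ + ‖b‖) * (1 + ‖x‖) := by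
  calc ‖killing a b x‖ ≤ ‖a‖ + ‖b‖ * ‖x‖ :=
        (norm_add_le _ _).trans (by gcongr; exact norm_cross_le _ _)
    _ ≤ _ := by nlinarith [norm_nonneg a, norm_nonneg b, norm_nonneg x]

/-! ### Divergences -/

section Div

variable {X Y : E3 → E3} {f : E3 → ℝ} {x : E3}

lemma div_smul (hf : DifferentiableAt ℝ f x) (hX : DifferentiableAt ℝ X x) :
    div (fun y => f y • X y) x = f x * div X x + fderiv ℝ f x (X x) := by
  have h := hf.hasFDerivAt.fun_smul hX.hasFDerivAt
  have e : X x = ∑ i, X x i • EuclideanSpace.single i (1 : ℝ) := by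
    have := (EuclideanSpace.basisFun (Fin 3) ℝ).sum_repr (X x)
    simpa using this.symm
  have e2 : fderiv ℝ f x (X x) = ∑ i, X x i * fderiv ℝ f x (EuclideanSpace.single i 1) := by
    conv_lhs => rw [e]
    simp
  rw [e2, div, div, Finset.mul_sum, ← Finset.sum_add_distrib]
  refine Finset.sum_congr rfl fun i _ => ?_
  rw [h.fderiv]
  simp [mul_comm]

lemma div_add (hX : DifferentiableAt ℝ X x) (hY : DifferentiableAt ℝ Y x) :
    div (fun y => X y + Y y) x = div X x + div Y x := by
  simp only [div, ← Finset.sum_add_distrib]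
  refine Finset.sum_congr rfl fun i _ => ?_
  rw [(hX.hasFDerivAt.fun_add hY.hasFDerivAt).fderiv]
  simp

lemma div_sub (hX : DifferentiableAt ℝ X x) (hY : DifferentiableAt ℝ Y x) :
    div (fun y => X y - Y y) x = div X x - div Y x := by
  simp only [div, ← Finset.sum_sub_distrib]
  refine Finset.sum_congr rfl fun i _ => ?_
  rw [(hX.hasFDerivAt.fun_sub hY.hasFDerivAt).fderiv]
  simp

lemma div_killing (a b x : E3) : div (killing a b) x = 0 := by
  simp [div, (hasFDerivAt_killing a b x).fderiv, crossB_apply, Fin.sum_univ_three,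
    cross_apply_zero, cross_apply_one, cross_apply_two]

lemma div_const (a x : E3) : div (fun _ => a) x = 0 := by
  simp [div]

lemma div_id (x : E3) : div (fun y => y) x = 3 := by
  simp [div]

lemma differentiable_killing (a b : E3) : Differentiable ℝ (killing a b) :=
  (contDiff_killing a b (n := 1)).differentiable one_ne_zero

lemma div_smul_killing (a b : E3) (hf : DifferentiableAt ℝ f x) :
    div (fun y => f y • killing a b y) x = fderiv ℝ f x (killing a b x) := by
  rw [div_smul hf (differentiable_killing a b x), div_killing, mul_zero, zero_add]

end Div

section Gradient

variable {f : E3 → ℝ} {x : E3}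

lemma contDiffAt_gradient {n : WithTop ℕ∞} (hf : ContDiffAt ℝ (n + 1) f x) :
    ContDiffAt ℝ n (gradient f) x :=
  (InnerProductSpace.toDual ℝ E3).symm.contDiff.contDiffAt.comp x (hf.fderiv_right le_rfl)

lemma contDiffAt_one_gradient (hf : ContDiffAt ℝ 2 f x) : ContDiffAt ℝ 1 (gradient f) x :=
  contDiffAt_gradient (by simpa [one_add_one_eq_two] using hf)

lemma fderiv_eq_inner (f : E3 → ℝ) (x w : E3) : fderiv ℝ f x w = inner ℝ (gradient f x) w :=
  (inner_gradient_left ..).symm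

lemma inner_fderiv_gradient (hf : ContDiffAt ℝ 2 f x) (u w : E3) :
    inner ℝ (fderiv ℝ (gradient f) x u) w = fderiv ℝ (fderiv ℝ f) x u w := by
  have h1 : DifferentiableAt ℝ (fderiv ℝ f) x :=
    (hf.fderiv_right (m := 1) (by simp [one_add_one_eq_two])).differentiableAt one_ne_zero
  have h2 : DifferentiableAt ℝ (gradient f) x :=
    (contDiffAt_one_gradient hf).differentiableAt one_ne_zero
  have h3 : HasFDerivAt (fun y => inner ℝ (gradient f y) w) _ x :=
    h2.hasFDerivAt.inner ℝ (hasFDerivAt_const w x)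
  have h4 : HasFDerivAt (fun y => fderiv ℝ f y w) _ x :=
    h1.hasFDerivAt.clm_apply (hasFDerivAt_const w x)
  simp only [fderiv_eq_inner] at h4
  have h5 := congrArg (fun L : E3 →L[ℝ] ℝ => L u) (h3.unique h4)
  simpa using h5

/-- The Hessian is symmetric. -/
lemma inner_fderiv_gradient_comm (hf : ContDiffAt ℝ 2 f x) (u w : E3) :
    inner ℝ (fderiv ℝ (gradient f) x u) w = inner ℝ (fderiv ℝ (gradient f) x w) u := by
  rw [inner_fderiv_gradient hf, inner_fderiv_gradient hf]
  exact (hf.isSymmSndFDerivAt (by simp)).eq u w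

lemma div_gradient (hf : ContDiffAt ℝ 2 f x) : div (gradient f) x = Laplacian.laplacian f x := by
  rw [InnerProductSpace.laplacian_eq_iteratedFDeriv_orthonormalBasis f
    (EuclideanSpace.basisFun (Fin 3) ℝ), div_eq_sum_inner (EuclideanSpace.basisFun (Fin 3) ℝ)]
  refine Finset.sum_congr rfl fun i _ => ?_
  rw [iteratedFDeriv_two_apply, real_inner_comm, inner_fderiv_gradient hf]
  rfl

lemma hasFDerivAt_gradient (hf : ContDiffAt ℝ 2 f x) :
    HasFDerivAt (gradient f) (fderiv ℝ (gradient f) x) x :=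
  ((contDiffAt_one_gradient hf).differentiableAt one_ne_zero).hasFDerivAt

/-- The momentum flux `(∂Φ/∂ξ) ∇Φ - (|∇Φ|² / 2) ξ` in the direction of a rigid velocity field. -/
def stress (a b : E3) (f : E3 → ℝ) (x : E3) : E3 :=
  inner ℝ (gradient f x) (killing a b x) • gradient f x
    - (‖gradient f x‖ ^ 2 / 2) • killing a b x

lemma contDiffAt_stress (a b : E3) (hf : ContDiffAt ℝ 2 f x) : ContDiffAt ℝ 1 (stress a b f) x := by
  have h := contDiffAt_one_gradient hf
  have hk := (contDiff_killing a b (n := 1)).contDiffAt (x := x)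
  exact ((h.inner ℝ hk).smul h).sub ((h.norm_sq ℝ |>.div_const 2).smul hk)

lemma fderiv_norm_sq_half {X : E3 → E3} {x : E3} (hX : DifferentiableAt ℝ X x) (w : E3) :
    fderiv ℝ (fun y => ‖X y‖ ^ 2 / 2) x w = inner ℝ (fderiv ℝ X x w) (X x) := by
  have h : HasFDerivAt (fun y => ‖X y‖ ^ 2 / 2) _ x :=
    (hX.hasFDerivAt.norm_sq).mul_const (2⁻¹ : ℝ)
  rw [h.fderiv]
  simp [real_inner_comm]

/-- The momentum flux of a harmonic potential is divergence free: a rigid velocity field has a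
skew-symmetric derivative. -/
lemma div_stress (a b : E3) (hf : ContDiffAt ℝ 2 f x) (hl : Laplacian.laplacian f x = 0) :
    div (stress a b f) x = 0 := by
  have hg := hasFDerivAt_gradient hf
  have hk := hasFDerivAt_killing a b x
  have hi : HasFDerivAt (fun y => inner ℝ (gradient f y) (killing a b y)) _ x := hg.inner ℝ hk
  have hn : DifferentiableAt ℝ (fun y => ‖gradient f y‖ ^ 2 / 2) x :=
    (hg.norm_sq.mul_const (2⁻¹ : ℝ)).differentiableAt
  unfold stress
  rw [div_sub (hi.differentiableAt.fun_smul hg.differentiableAt)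
    (hn.fun_smul hk.differentiableAt), div_smul_killing _ _ hn,
    div_smul hi.differentiableAt hg.differentiableAt, div_gradient hf, hl, hi.fderiv,
    fderiv_norm_sq_half hg.differentiableAt]
  simp only [ContinuousLinearMap.comp_apply, ContinuousLinearMap.prod_apply, fderivInnerCLM_apply,
    crossB_apply, inner_cross_self]
  rw [inner_fderiv_gradient_comm hf]
  ring

/-- The field behind the two expressions of the linear momentum by integrals over the surface of the
body. -/
lemma div_virial_linear (a : E3) (hf : ContDiffAt ℝ 2 f x) :
    div (fun y => inner ℝ y (gradient f y) • a - inner ℝ (gradient f y) a • y) x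
      = -2 * fderiv ℝ f x a := by
  have hg := hasFDerivAt_gradient hf
  have h1 : HasFDerivAt (fun y => inner ℝ y (gradient f y)) _ x := (hasFDerivAt_id x).inner ℝ hg
  have h2 : HasFDerivAt (fun y => inner ℝ (gradient f y) a) _ x :=
    hg.inner ℝ (hasFDerivAt_const a x)
  rw [div_sub (h1.differentiableAt.fun_smul (differentiableAt_const a))
    (h2.differentiableAt.fun_smul differentiableAt_fun_id), div_smul h1.differentiableAt
    (differentiableAt_const a), div_smul h2.differentiableAt differentiableAt_fun_id, div_const,
    div_id,
    h1.fderiv, h2.fderiv, fderiv_eq_inner]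
  simp only [ContinuousLinearMap.comp_apply, ContinuousLinearMap.prod_apply, fderivInnerCLM_apply,
    zero_apply, ContinuousLinearMap.id_apply, inner_zero_right, id]
  rw [inner_fderiv_gradient_comm hf x a, real_inner_comm x, real_inner_comm a (gradient f x)]
  ring

/-- The field behind the two expressions of the angular momentum by integrals over the surface of
the body. -/
lemma div_virial_angular (b : E3) (hf : ContDiffAt ℝ 2 f x) :
    div (fun y => ‖y‖ ^ 2 • cross (gradient f y) b) x = 2 * fderiv ℝ f x (cross b x) := by
  have hg := hasFDerivAt_gradient hf
  have h1 : HasFDerivAt (fun y : E3 => ‖y‖ ^ 2) _ x := (hasFDerivAt_id x).norm_sq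
  have h2 : HasFDerivAt (fun y => cross (gradient f y) b) _ x :=
    HasFDerivAt.comp (g := crossB.flip b) x (crossB.flip b).hasFDerivAt hg
  have h3 : div (fun y => cross (gradient f y) b) x = 0 := by
    have hs : ∀ i j : Fin 3, fderiv ℝ (gradient f) x (EuclideanSpace.single i 1) j
        = fderiv ℝ (gradient f) x (EuclideanSpace.single j 1) i := by
      intro i j
      have := inner_fderiv_gradient_comm hf (EuclideanSpace.single i 1) (EuclideanSpace.single j 1)
      simpa [EuclideanSpace.inner_single_right] using this
    simp only [div, h2.fderiv, Fin.sum_univ_three, ContinuousLinearMap.comp_apply,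
      ContinuousLinearMap.flip_apply, crossB_apply, cross_apply_zero, cross_apply_one,
      cross_apply_two]
    rw [hs 0 1, hs 0 2, hs 1 2]
    ring
  rw [div_smul h1.differentiableAt h2.differentiableAt, h3, h1.fderiv, fderiv_eq_inner,
    inner_cross_rotate (gradient f x), inner_cross_rotate b]
  simp

end Gradient

/-! ### Integrals over the surface of the moving body -/

/-- Differentiation under an integral over a compact set. -/
lemma hasDerivAt_setIntegral {X : Type*} [TopologicalSpace X] [MeasurableSpace X]
    [OpensMeasurableSpace X] [T2Space X] {μ : Measure X} [IsFiniteMeasureOnCompacts μ] {K : Set X}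
    (hK : IsCompact K) {F F' : ℝ → X → ℝ} {t : ℝ} {J : Set ℝ} (hJ : J ∈ 𝓝 t)
    (hF : ∀ s ∈ J, ContinuousOn (F s) K)
    (hd : ∀ s ∈ J, ∀ x ∈ K, HasDerivAt (fun s => F s x) (F' s x) s)
    (hF' : ContinuousOn (fun q : ℝ × X => F' q.1 q.2) (J ×ˢ K)) :
    HasDerivAt (fun s => ∫ x in K, F s x ∂μ) (∫ x in K, F' t x ∂μ) t := by
  obtain ⟨ε, hε, hεJ⟩ := Metric.nhds_basis_closedBall.mem_iff.1 hJ
  have htJ : t ∈ J := mem_of_mem_nhds hJ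
  obtain ⟨C, hC⟩ := ((isCompact_closedBall t ε).prod hK).exists_bound_of_continuousOn
    (hF'.mono (prod_mono hεJ Subset.rfl))
  have hm := hK.isClosed.measurableSet
  have hs : ∀ s ∈ J, IntegrableOn (F s) K μ := fun s hs => (hF s hs).integrableOn_compact hK
  refine (hasDerivAt_integral_of_dominated_loc_of_deriv_le (bound := fun _ => C)
    (Metric.closedBall_mem_nhds t hε) ?_ (hs t htJ) ?_ ?_ ?_ ?_).2
  · filter_upwards [hJ] with s h using (hs s h).aestronglyMeasurable
  · have : ContinuousOn (F' t) K := by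
      have := hF'.comp (f := fun x => (t, x)) (s := K) (by fun_prop) fun x hx => ⟨htJ, hx⟩
      exact this
    exact (this.integrableOn_compact hK).aestronglyMeasurable
  · exact (ae_restrict_iff' hm).2 (Eventually.of_forall fun x hx s h => hC (s, x) ⟨h, hx⟩)
  · exact integrableOn_const hK.measure_lt_top.ne
  · exact (ae_restrict_iff' hm).2 (Eventually.of_forall fun x hx s h => hd s (hεJ h) x hx)

section Joint

variable {E : Type*} [NormedAddCommGroup E] [NormedSpace ℝ E] {Ψ : ℝ × E → ℝ} {s : ℝ} {x : E}

lemma fderiv_slice (h : DifferentiableAt ℝ Ψ (s, x)) (w : E) :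
    fderiv ℝ (fun x => Ψ (s, x)) x w = fderiv ℝ Ψ (s, x) (0, w) := by
  have h1 : HasFDerivAt (fun x => Ψ (s, x)) _ x :=
    HasFDerivAt.comp (g := Ψ) x h.hasFDerivAt (hasFDerivAt_prodMk_right s x)
  rw [h1.fderiv]
  simp

lemma deriv_slice (h : DifferentiableAt ℝ Ψ (s, x)) :
    deriv (fun s => Ψ (s, x)) s = fderiv ℝ Ψ (s, x) (1, 0) := by
  have h1 : HasFDerivAt (fun s => Ψ (s, x)) _ s :=
    HasFDerivAt.comp (g := Ψ) s h.hasFDerivAt (hasFDerivAt_prodMk_left s x)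
  rw [← fderiv_apply_one_eq_deriv, h1.fderiv]
  simp

end Joint

section Moving

variable {P : Params} {B : RigidBody} {M : Motion} {I : Set ℝ} {t : ℝ}
variable (hS : IsSolution P B M I)
include hS

/-- The velocity of the body particle with reference position `l`. -/
lemma IsSolution.hasDerivAt_place (ht : t ∈ I) (l : E3) :
    HasDerivAt (fun s => place M s l) (M.V t + cross (M.Ω t) (M.Q t l)) t := by
  rw [add_comm]
  exact (hS.hasDerivAt_Q t ht l).add (hS.hasDerivAt_c t ht)

lemma IsSolution.continuousAt_Q (ht : t ∈ I) (l : E3) :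
    ContinuousAt (fun q : ℝ × E3 => M.Q q.1 q.2) (t, l) := by
  have h1 : Tendsto (fun q : ℝ × E3 => M.Q q.1 l) (𝓝 (t, l)) (𝓝 (M.Q t l)) :=
    ((hS.hasDerivAt_Q t ht l).continuousAt.tendsto).comp continuous_fst.continuousAt
  have h2 : Tendsto (fun q : ℝ × E3 => M.Q q.1 (q.2 - l)) (𝓝 (t, l)) (𝓝 0) := by
    rw [tendsto_zero_iff_norm_tendsto_zero]
    simp only [LinearIsometryEquiv.norm_map]
    have : ContinuousAt (fun q : ℝ × E3 => ‖q.2 - l‖) (t, l) := by fun_prop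
    simpa using this.tendsto
  have h3 := h1.add h2
  rw [add_zero] at h3
  refine h3.congr fun q => ?_
  rw [← map_add, add_sub_cancel]

lemma IsSolution.continuousAt_place (ht : t ∈ I) (l : E3) :
    ContinuousAt (fun q : ℝ × E3 => place M q.1 q.2) (t, l) :=
  (hS.continuousAt_Q ht l).add
    ((hS.hasDerivAt_c t ht).continuousAt.comp (f := Prod.fst) (x := (t, l)) continuousAt_fst)

/-- The velocity field of the body. -/
def bodyVel (M : Motion) (t : ℝ) (r : E3) : E3 := M.V t + cross (M.Ω t) (r - M.c t)

omit hS in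
lemma bodyVel_eq_killing (t : ℝ) :
    bodyVel M t = killing (M.V t - cross (M.Ω t) (M.c t)) (M.Ω t) := by
  funext r
  simp only [bodyVel, killing, ← crossB_apply, map_sub]
  abel

/-- Transport theorem for the flux of `Ψ ξ`, with `ξ` a rigid velocity field, through the surface of
the moving body. The flux is an integral over the body, where both `ξ` and the velocity of the body
are divergence free. -/
theorem IsSolution.hasDerivAt_bodyS (hI : IsOpen I) (ht : t ∈ I) {Ψ : ℝ × E3 → ℝ} {J : Set ℝ}
    (hJ : J ∈ 𝓝 t) (hΨ : ∀ s ∈ J, ∀ x, ContDiffAt ℝ 2 Ψ (s, x)) (a b : E3) :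
    HasDerivAt (fun s => bodyS B M s fun r n => Ψ (s, r) * inner ℝ (killing a b r) n)
      (bodyS B M t fun r n => deriv (fun s => Ψ (s, r)) t * inner ℝ (killing a b r) n
        + inner ℝ (gradient (fun x => Ψ (t, x)) r) (killing a b r) * inner ℝ (bodyVel M t r) n)
      t := by
  set J' := J ∩ I with hJ'
  have hJI : J' ∈ 𝓝 t := inter_mem hJ (hI.mem_nhds ht)
  have htJ : t ∈ J' := mem_of_mem_nhds hJI
  have hd : ∀ s ∈ J', ∀ x, DifferentiableAt ℝ Ψ (s, x) := fun s hs x =>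
    (hΨ s hs.1 x).differentiableAt two_ne_zero
  have hslice : ∀ s ∈ J', ContDiff ℝ 2 (fun x => Ψ (s, x)) := by
    intro s hs
    rw [contDiff_iff_contDiffAt]
    exact fun x => (hΨ s hs.1 x).comp x (by fun_prop : ContDiffAt ℝ 2 (fun x => (s, x)) x)
  have hfd : ∀ s ∈ J', ∀ x, ContDiffAt ℝ 1 (fderiv ℝ Ψ) (s, x) := fun s hs x =>
    (hΨ s hs.1 x).fderiv_right (by simp [one_add_one_eq_two])
  -- `G` is `∂Ψ/∂ξ`, the divergence of `Ψ ξ`; `G0` is `∂Ψ/∂t`.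
  set G : ℝ × E3 → ℝ := fun q => fderiv ℝ Ψ q (0, killing a b q.2) with hG
  have hGd : ∀ s ∈ J', ∀ x, ContDiffAt ℝ 1 G (s, x) := by
    intro s hs x
    have := (contDiff_killing a b (n := 1)).comp (contDiff_snd (𝕜 := ℝ) (E := ℝ) (F := E3))
    exact (hfd s hs x).clm_apply (contDiffAt_const.prodMk this.contDiffAt)
  set G0 : ℝ × E3 → ℝ := fun q => fderiv ℝ Ψ q (1, 0) with hG0
  have hG0d : ∀ s ∈ J', ∀ x, ContDiffAt ℝ 1 G0 (s, x) := fun s hs x =>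
    (hfd s hs x).clm_apply contDiffAt_const
  -- The flux as an integral over the body in its reference position.
  have hflux : ∀ s ∈ J', (bodyS B M s fun r n => Ψ (s, r) * inner ℝ (killing a b r) n)
      = ∫ l in B.carrier, G (s, place M s l) := by
    intro s hs
    have h1 : ContDiff ℝ 1 (fun x => Ψ (s, x) • killing a b x) :=
      ((hslice s hs).of_le one_le_two).smul (contDiff_killing a b)
    have h2 := setIntegral_bodyAt_div (B := B) (M := M) (t := s) h1
    simp only [real_inner_smul_left] at h2
    rw [← h2, setIntegral_bodyAt]
    congr 1
    funext l
    rw [div_smul_killing _ _ ((hslice s hs).differentiable two_ne_zero _),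
      fderiv_slice (hd s hs _)]
  have hderiv : HasDerivAt (fun s => ∫ l in B.carrier, G (s, place M s l))
      (∫ l in B.carrier, fderiv ℝ G (t, place M t l)
        (1, M.V t + cross (M.Ω t) (M.Q t l))) t := by
    refine hasDerivAt_setIntegral (F := fun s l => G (s, place M s l))
      (F' := fun s l => fderiv ℝ G (s, place M s l) (1, M.V s + cross (M.Ω s) (M.Q s l)))
      B.isCompact_carrier hJI ?_ ?_ ?_
    · intro s hs
      refine Continuous.continuousOn ?_
      rw [continuous_iff_continuousAt]
      intro l
      have h1 : ContinuousAt (fun l => (s, place M s l)) l :=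
        continuousAt_const.prodMk (contDiff_place (n := 0)).continuous.continuousAt
      exact ContinuousAt.comp (g := G) (hGd s hs _).continuousAt h1
    · intro s hs l _
      exact HasFDerivAt.comp_hasDerivAt (l := G) s
        ((hGd s hs _).differentiableAt one_ne_zero).hasFDerivAt
        ((hasDerivAt_id s).prodMk (hS.hasDerivAt_place hs.2 l))
    · rintro ⟨s, l⟩ ⟨hs, _⟩
      refine ContinuousAt.continuousWithinAt ?_
      have h1 : ContinuousAt (fun q : ℝ × E3 => (q.1, place M q.1 q.2)) (s, l) :=
        continuousAt_fst.prodMk (hS.continuousAt_place hs.2 l)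
      have h2 : ContinuousAt (fderiv ℝ G) (s, place M s l) :=
        ((hGd s hs _).fderiv_right (m := 0) (by simp)).continuousAt
      have h3 : ContinuousAt (fun q : ℝ × E3 => M.V q.1) (s, l) :=
        ContinuousAt.comp (g := M.V) (f := Prod.fst)
          (hS.continuousOn_V.continuousAt (hI.mem_nhds hs.2)) continuousAt_fst
      have h4 : ContinuousAt (fun q : ℝ × E3 => M.Ω q.1) (s, l) :=
        ContinuousAt.comp (g := M.Ω) (f := Prod.fst)
          (hS.continuousOn_Ω.continuousAt (hI.mem_nhds hs.2)) continuousAt_fst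
      have h5 : ContinuousAt (fun q : ℝ × E3 => crossB (M.Ω q.1) (M.Q q.1 q.2)) (s, l) :=
        (crossB.continuous.continuousAt.comp h4).clm_apply (hS.continuousAt_Q hs.2 l)
      exact (ContinuousAt.comp (g := fderiv ℝ G) (f := fun q : ℝ × E3 => (q.1, place M q.1 q.2))
        h2 h1).clm_apply (continuousAt_const.prodMk (h3.add h5))
  refine (hderiv.congr_of_eventuallyEq ?_).congr_deriv ?_
  · filter_upwards [hJI] with s hs using hflux s hs
  -- The derivative is again a flux, namely that of `Y`.
  set Y : E3 → E3 := fun x => G0 (t, x) • killing a b x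
    + G (t, x) • killing (M.V t - cross (M.Ω t) (M.c t)) (M.Ω t) x with hY
  have h0 : ContDiff ℝ 1 (fun x => G0 (t, x)) := by
    rw [contDiff_iff_contDiffAt]
    exact fun x => (hG0d t htJ x).comp x (by fun_prop : ContDiffAt ℝ 1 (fun x => (t, x)) x)
  have h1 : ContDiff ℝ 1 (fun x => G (t, x)) := by
    rw [contDiff_iff_contDiffAt]
    exact fun x => (hGd t htJ x).comp x (by fun_prop : ContDiffAt ℝ 1 (fun x => (t, x)) x)
  have hYd : ContDiff ℝ 1 Y := (h0.smul (contDiff_killing _ _)).add (h1.smul (contDiff_killing _ _))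
  have h2 := setIntegral_bodyAt_div (B := B) (M := M) (t := t) hYd
  rw [setIntegral_bodyAt] at h2
  have e1 : ∀ l, fderiv ℝ G (t, place M t l) (1, M.V t + cross (M.Ω t) (M.Q t l))
      = div Y (place M t l) := by
    intro l
    set x := place M t l with hx
    have e2 : M.V t + cross (M.Ω t) (M.Q t l)
        = killing (M.V t - cross (M.Ω t) (M.c t)) (M.Ω t) x := by
      rw [← bodyVel_eq_killing, bodyVel, hx, place, add_sub_cancel_right]
    have h01 := h0.differentiable one_ne_zero x
    have h11 := h1.differentiable one_ne_zero x
    rw [hY, div_add (h01.fun_smul (differentiable_killing _ _ x))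
      (h11.fun_smul (differentiable_killing _ _ x)),
      div_smul_killing _ _ h01, div_smul_killing _ _ h11,
      fderiv_slice ((hG0d t htJ x).differentiableAt one_ne_zero),
      fderiv_slice ((hGd t htJ x).differentiableAt one_ne_zero), e2]
    set w := killing (M.V t - cross (M.Ω t) (M.c t)) (M.Ω t) x
    have e3 : ((1 : ℝ), w) = (1, 0) + (0, w) := by simp
    rw [e3, map_add]
    congr 1
    have hff := ((hfd t htJ x).differentiableAt one_ne_zero).hasFDerivAt
    have e4 : HasFDerivAt G0 _ (t, x) := hff.clm_apply (hasFDerivAt_const _ _)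
    have hk : HasFDerivAt (fun q : ℝ × E3 => ((0 : ℝ), killing a b q.2)) _ (t, x) :=
      (hasFDerivAt_const _ _).prodMk (HasFDerivAt.comp (g := killing a b) (t, x)
        (hasFDerivAt_killing a b x) hasFDerivAt_snd)
    have e5 : HasFDerivAt G _ (t, x) := hff.clm_apply hk
    rw [e4.fderiv, e5.fderiv]
    -- The time derivative commutes with the derivative along `ξ`.
    have := ((hΨ t htJ.1 x).isSymmSndFDerivAt (by simp)).eq (1, 0) (0, killing a b x)
    have e6 : fderiv ℝ Ψ (t, x) (0, 0) = 0 := map_zero _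
    simpa [e6] using this
  simp_rw [e1]
  rw [h2]
  refine bodyS_congr fun r n _ => ?_
  rw [hY, inner_add_left, real_inner_smul_left, real_inner_smul_left, ← bodyVel_eq_killing,
    deriv_slice (hd t htJ r), ← fderiv_eq_inner, fderiv_slice (hd t htJ r)]

/-- Near the surface of the body the potential agrees with a function which is regular in the whole
space. -/
lemma IsSolution.exists_extension (hI : IsOpen I) (ht : t ∈ I) :
    ∃ (Ψ : ℝ × E3 → ℝ) (J : Set ℝ), J ∈ 𝓝 t ∧ J ⊆ I ∧ (∀ s ∈ J, ∀ x, ContDiffAt ℝ 2 Ψ (s, x)) ∧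
      ∀ s ∈ J, ∀ x ∈ frontier (bodyAt B M s), (fun q => M.Φ q.1 q.2) =ᶠ[𝓝 (s, x)] Ψ := by
  set K := frontier (bodyAt B M t)
  have hK : IsCompact K := isCompact_bodyAt.of_isClosed_subset isClosed_frontier
    isCompact_bodyAt.isClosed.frontier_subset
  have hO : IsOpen {q : ℝ × E3 | ContDiffAt ℝ 2 (fun q : ℝ × E3 => M.Φ q.1 q.2) q} := by
    rw [isOpen_iff_mem_nhds]
    exact fun x hx => ContDiffAt.eventually hx (by simp)
  -- At times near `t` the potential is regular in a fixed neighbourhood `v` of the surface of the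
  -- body at time `t`, and the surface stays where the cutoff is `1`.
  obtain ⟨u, v, hu, hv, htu, hKv, huv⟩ := generalized_tube_lemma (isCompact_singleton (x := t)) hK
    hO (by
      rintro ⟨s, x⟩ ⟨rfl, hx⟩
      exact hS.contDiffAt_Φ s ht x (hS.frontier_subset ht hx))
  obtain ⟨θ, h1, h2, h3, h4⟩ := exists_cutoff hK hv hKv
  obtain ⟨N, hN, hKN, hN1⟩ := eventually_nhdsSet_iff_exists.1 h4
  have h5 : ∀ᶠ s in 𝓝 t, ∀ l ∈ frontier B.carrier, place M s l ∈ N := by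
    refine IsCompact.eventually_forall_of_forall_eventually
      (B.isCompact_carrier.of_isClosed_subset isClosed_frontier
        B.isCompact_carrier.isClosed.frontier_subset) fun l hl => ?_
    refine (hS.continuousAt_place ht l).eventually (hN.mem_nhds (hKN ?_))
    change place M t l ∈ frontier (place M t '' B.carrier)
    rw [← coe_placeHomeo, ← (placeHomeo M t).image_frontier]
    exact mem_image_of_mem _ hl
  refine ⟨fun q => θ q.2 * M.Φ q.1 q.2, _, inter_mem (inter_mem h5 (hI.mem_nhds ht))
    (hu.mem_nhds (htu rfl)), fun s hs => hs.1.2, ?_, ?_⟩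
  · rintro s ⟨-, hs⟩ x
    by_cases hx : x ∈ tsupport θ
    · exact (h1.contDiffAt.comp (s, x) contDiffAt_snd).mul (huv (mk_mem_prod hs (h3 hx)))
    · have : (fun q : ℝ × E3 => θ q.2 * M.Φ q.1 q.2) =ᶠ[𝓝 (s, x)] fun _ => 0 := by
        have h6 := (continuous_snd (X := ℝ) (Y := E3)).continuousAt (x := (s, x))
        filter_upwards [h6.eventually (notMem_tsupport_iff_eventuallyEq.1 hx)] with q hq
        simp only [Pi.zero_apply] at hq
        simp [hq]
      exact contDiffAt_const.congr_of_eventuallyEq this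
  · rintro s ⟨⟨hs, -⟩, -⟩ x hx
    have hxN : x ∈ N := by
      rw [bodyAt, ← coe_placeHomeo, ← (placeHomeo M s).image_frontier] at hx
      obtain ⟨l, hl, rfl⟩ := hx
      exact hs l hl
    have h6 := (continuous_snd (X := ℝ) (Y := E3)).continuousAt (x := (s, x))
    filter_upwards [h6.eventually (hN.mem_nhds hxN)] with q hq
    rw [hN1 q.2 hq, one_mul]

/-- The flux of `Φ ξ` through the surface of the body. -/
def bodyFlux (B : RigidBody) (M : Motion) (a b : E3) (t : ℝ) : ℝ :=
  bodyS B M t fun r n => M.Φ t r * inner ℝ (killing a b r) n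

/-- Rate of change of the flux of `Φ ξ` through the surface of the body. By the condition of no flow
through that surface, the normal velocity of the body is that of the fluid. -/
theorem IsSolution.hasDerivAt_bodyFlux (hI : IsOpen I) (ht : t ∈ I) (a b : E3) :
    HasDerivAt (bodyFlux B M a b)
      (bodyS B M t fun r n => potRate M t r * inner ℝ (killing a b r) n
        + inner ℝ (vel M t r) (killing a b r) * inner ℝ (vel M t r) n) t := by
  obtain ⟨Ψ, J, hJ, hJI, hΨ, heq⟩ := hS.exists_extension hI ht
  have h := hS.hasDerivAt_bodyS hI ht hJ hΨ a b
  refine (h.congr_of_eventuallyEq ?_).congr_deriv ?_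
  · filter_upwards [hJ] with s hs
    refine bodyS_congr fun r n hn => ?_
    exact congrArg (· * _) (heq s hs r hn.mem_frontier).self_of_nhds
  · refine bodyS_congr fun r n hn => ?_
    have h1 := heq t (mem_of_mem_nhds hJ) r hn.mem_frontier
    have h2 : (fun s => Ψ (s, r)) =ᶠ[𝓝 t] fun s => M.Φ s r := by
      have h3 : ContinuousAt (fun s : ℝ => (s, r)) t := by fun_prop
      filter_upwards [h3.eventually h1] with s hs using hs.symm
    have h3 : (fun x => Ψ (t, x)) =ᶠ[𝓝 r] M.Φ t := by
      have h3 : ContinuousAt (fun x : E3 => (t, x)) r := by fun_prop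
      filter_upwards [h3.eventually h1] with s hs using hs.symm
    rw [h2.deriv_eq, h3.gradient_eq]
    congr 2
    obtain ⟨l, m, hl, rfl, rfl⟩ := hn
    exact (hS.body_condition t ht l m hl).symm

/-- The surface integral in the linear momentum is the flux of the potential: both are integrals
over the body of multiples of `∂f/∂a`, where `f` is an extension of the potential to the body. -/
lemma IsSolution.inner_linear_surface (hI : IsOpen I) (ht : t ∈ I) (a : E3) :
    inner ℝ (bodySurfaceIntegral B M t (fun r n => cross r (cross n (vel M t r)))) a
      = -2 * bodyFlux B M a 0 t := by
  obtain ⟨Ψ, J, hJ, hJI, hΨ, heq⟩ := hS.exists_extension hI ht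
  have htJ := mem_of_mem_nhds hJ
  set f : E3 → ℝ := fun x => Ψ (t, x)
  have hf : ContDiff ℝ 2 f := by
    rw [contDiff_iff_contDiffAt]
    exact fun x => (hΨ t htJ x).comp x (by fun_prop : ContDiffAt ℝ 2 (fun x => (t, x)) x)
  have heqf : ∀ x ∈ frontier (bodyAt B M t), M.Φ t =ᶠ[𝓝 x] f := by
    intro x hx
    have h3 : ContinuousAt (fun x : E3 => (t, x)) x := by fun_prop
    exact h3.eventually (heq t htJ x hx)
  have hg : ContDiff ℝ 1 (gradient f) :=
    contDiff_iff_contDiffAt.2 fun x => contDiffAt_one_gradient hf.contDiffAt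
  have h1 : bodySurfaceIntegral B M t (fun r n => cross r (cross n (vel M t r)))
      = bodySurfaceIntegral B M t (fun r n => crossB r (crossB n (gradient f r))) := by
    refine RigidBody.boundaryIntegral_congr fun l n hl => ?_
    have hm : IsBodyNormal B M t (place M t l) (M.Q t n) := ⟨l, n, hl, rfl, rfl⟩
    simp only [vel]
    rw [(heqf _ hm.mem_frontier).gradient_eq]
    rfl
  have hc1 : Continuous (place M t) := (contDiff_place (n := 0)).continuous
  have hgc := hg.continuous
  rw [h1, bodySurfaceIntegral, RigidBody.inner_boundaryIntegral]
  · have h2 := setIntegral_bodyAt_div (B := B) (M := M) (t := t)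
      (X := fun y => inner ℝ y (gradient f y) • a - inner ℝ (gradient f y) a • y)
      (((contDiff_id.inner ℝ hg).smul contDiff_const).sub ((hg.inner ℝ contDiff_const).smul
        contDiff_id))
    have h3 := setIntegral_bodyAt_div (B := B) (M := M) (t := t)
      (X := fun y => f y • killing a 0 y) ((hf.of_le one_le_two).smul (contDiff_killing _ _))
    have e3 : ∀ x, div (fun y => f y • killing a 0 y) x = fderiv ℝ f x a := by
      intro x
      rw [div_smul_killing _ _ (hf.differentiable two_ne_zero x)]
      simp [killing, cross]
    simp_rw [div_virial_linear a hf.contDiffAt] at h2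
    simp_rw [e3] at h3
    rw [integral_const_mul, h3] at h2
    have e4 : bodyFlux B M a 0 t = bodyS B M t fun r n => inner ℝ (f r • killing a 0 r) n :=
      bodyS_congr fun r n hn => by
        rw [(heqf _ hn.mem_frontier).self_of_nhds, real_inner_smul_left]
    rw [e4, h2]
    refine RigidBody.bdry_congr fun l n _ => ?_
    simp only [inner_eq_sum, crossB_apply, cross_apply_zero, cross_apply_one, cross_apply_two,
      PiLp.sub_apply, PiLp.smul_apply, smul_eq_mul]
    ring
  · have := crossB.continuous
    have := (M.Q t).continuous
    fun_prop

/-- The surface integral in the angular momentum is the angular flux of the potential: both are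
integrals over the body of multiples of `∂f/∂(b × x)`, where `f` is an extension of the potential to
the body. -/
lemma IsSolution.inner_angular_surface (hI : IsOpen I) (ht : t ∈ I) (b : E3) :
    inner ℝ (bodySurfaceIntegral B M t (fun r n => ‖r‖ ^ 2 • cross n (vel M t r))) b
      = 2 * bodyFlux B M 0 b t := by
  obtain ⟨Ψ, J, hJ, hJI, hΨ, heq⟩ := hS.exists_extension hI ht
  have htJ := mem_of_mem_nhds hJ
  set f : E3 → ℝ := fun x => Ψ (t, x)
  have hf : ContDiff ℝ 2 f := by
    rw [contDiff_iff_contDiffAt]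
    exact fun x => (hΨ t htJ x).comp x (by fun_prop : ContDiffAt ℝ 2 (fun x => (t, x)) x)
  have heqf : ∀ x ∈ frontier (bodyAt B M t), M.Φ t =ᶠ[𝓝 x] f := by
    intro x hx
    have h3 : ContinuousAt (fun x : E3 => (t, x)) x := by fun_prop
    exact h3.eventually (heq t htJ x hx)
  have hg : ContDiff ℝ 1 (gradient f) :=
    contDiff_iff_contDiffAt.2 fun x => contDiffAt_one_gradient hf.contDiffAt
  have h1 : bodySurfaceIntegral B M t (fun r n => ‖r‖ ^ 2 • cross n (vel M t r))
      = bodySurfaceIntegral B M t (fun r n => ‖r‖ ^ 2 • crossB n (gradient f r)) := by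
    refine RigidBody.boundaryIntegral_congr fun l n hl => ?_
    have hm : IsBodyNormal B M t (place M t l) (M.Q t n) := ⟨l, n, hl, rfl, rfl⟩
    simp only [vel]
    rw [(heqf _ hm.mem_frontier).gradient_eq]
    rfl
  have hc1 : Continuous (place M t) := (contDiff_place (n := 0)).continuous
  have hgc := hg.continuous
  rw [h1, bodySurfaceIntegral, RigidBody.inner_boundaryIntegral]
  · have h2 := setIntegral_bodyAt_div (B := B) (M := M) (t := t)
      (X := fun y => ‖y‖ ^ 2 • cross (gradient f y) b)
      ((contDiff_norm_sq ℝ).smul ((crossB.flip b).contDiff.comp hg))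
    have h3 := setIntegral_bodyAt_div (B := B) (M := M) (t := t)
      (X := fun y => f y • killing 0 b y) ((hf.of_le one_le_two).smul (contDiff_killing _ _))
    have e3 : ∀ x, div (fun y => f y • killing 0 b y) x = fderiv ℝ f x (cross b x) := by
      intro x
      rw [div_smul_killing _ _ (hf.differentiable two_ne_zero x)]
      simp [killing]
    simp_rw [div_virial_angular b hf.contDiffAt] at h2
    simp_rw [e3] at h3
    rw [integral_const_mul, h3] at h2
    have e4 : bodyFlux B M 0 b t = bodyS B M t fun r n => inner ℝ (f r • killing 0 b r) n :=
      bodyS_congr fun r n hn => by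
        rw [(heqf _ hn.mem_frontier).self_of_nhds, real_inner_smul_left]
    rw [e4, h2]
    refine RigidBody.bdry_congr fun l n _ => ?_
    simp only [inner_eq_sum, crossB_apply, cross_apply_zero, cross_apply_one, cross_apply_two,
      PiLp.smul_apply, smul_eq_mul]
    ring
  · have := crossB.continuous
    have := (M.Q t).continuous
    fun_prop

end Moving

/-! ### Integrals over the free surface -/

section Surface

lemma inner_graphNormalVec (ψ : ℝ × ℝ → ℝ) (u : ℝ × ℝ) (v : E3) :
    inner ℝ v (graphNormalVec ψ u) = v 2 - fderiv ℝ ψ u (horiz v) := by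
  have : horiz v = v 0 • ((1 : ℝ), (0 : ℝ)) + v 1 • ((0 : ℝ), (1 : ℝ)) := by simp [horiz]
  rw [this, map_add, map_smul, map_smul, inner_eq_sum]
  simp [graphNormalVec]
  ring

lemma killing_two (a b x : E3) : killing a b x 2 = a 2 + (b 0 * x 1 - b 1 * x 0) := by
  simp [killing, cross_apply_two]

lemma horiz_killing (a b x : E3) : horiz (killing a b x)
    = (a 0 + (b 1 * x 2 - b 2 * x 1), a 1 + (b 2 * x 0 - b 0 * x 2)) := by
  simp [horiz, killing, cross_apply_zero, cross_apply_one]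

lemma contDiff_horiz {n : WithTop ℕ∞} : ContDiff ℝ n horiz :=
  (contDiff_coord 0).prodMk (contDiff_coord 1)

lemma fderiv_coord (ℓ : ℝ × ℝ →L[ℝ] ℝ) (p q : ℝ) :
    ℓ (p, q) = p * ℓ (1, 0) + q * ℓ (0, 1) := by
  have : (p, q) = p • ((1 : ℝ), (0 : ℝ)) + q • ((0 : ℝ), (1 : ℝ)) := by simp
  rw [this, map_add, map_smul, map_smul]
  simp

/-- Integration by parts along the horizontal part of a rigid velocity field on a graph. Its
divergence in the horizontal plane is `∂ψ/∂v` with `v = (b 1, -b 0)`, because the field depends on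
the elevation. -/
lemma integral_fderiv_horiz_killing {ψ g : ℝ × ℝ → ℝ} (hψ : ContDiff ℝ 1 ψ) (hg : ContDiff ℝ 1 g)
    (hc : HasCompactSupport g) (a b : E3) :
    ∫ u, fderiv ℝ g u (horiz (killing a b (graphPoint ψ u)))
      = -∫ u, g u * fderiv ℝ ψ u (b 1, -b 0) := by
  set w1 : ℝ × ℝ → ℝ := fun u => a 0 + (b 1 * ψ u - b 2 * u.2) with hw1
  set w2 : ℝ × ℝ → ℝ := fun u => a 1 + (b 2 * u.1 - b 0 * ψ u) with hw2
  have h1 : ContDiff ℝ 1 w1 := by fun_prop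
  have h2 : ContDiff ℝ 1 w2 := by fun_prop
  have z1 := integral_fderiv_apply_eq_zero volume (hg.mul h1) hc.mul_right (1, 0)
  have z2 := integral_fderiv_apply_eq_zero volume (hg.mul h2) hc.mul_right (0, 1)
  have i1 := integrable_fderiv_apply volume (hg.mul h1) hc.mul_right (1, 0)
  have i2 := integrable_fderiv_apply volume (hg.mul h2) hc.mul_right (0, 1)
  have i3 : Integrable fun u => g u * fderiv ℝ ψ u (b 1, -b 0) :=
    (hg.continuous.mul ((hψ.continuous_fderiv one_ne_zero).clm_apply
      continuous_const)).integrable_of_hasCompactSupport hc.mul_right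
  have e : ∀ u, fderiv ℝ g u (horiz (killing a b (graphPoint ψ u)))
      = fderiv ℝ (fun u => g u * w1 u) u (1, 0) + fderiv ℝ (fun u => g u * w2 u) u (0, 1)
        - g u * fderiv ℝ ψ u (b 1, -b 0) := by
    intro u
    have hg' := (hg.differentiable one_ne_zero u).hasFDerivAt
    have hψ' := (hψ.differentiable one_ne_zero u).hasFDerivAt
    have d1 : HasFDerivAt w1 (b 1 • fderiv ℝ ψ u - b 2 • ContinuousLinearMap.snd ℝ ℝ ℝ) u :=
      ((hψ'.const_mul (b 1)).sub (hasFDerivAt_snd.const_mul (b 2))).const_add _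
    have d2 : HasFDerivAt w2 (b 2 • ContinuousLinearMap.fst ℝ ℝ ℝ - b 0 • fderiv ℝ ψ u) u :=
      ((hasFDerivAt_fst.const_mul (b 2)).sub (hψ'.const_mul (b 0))).const_add _
    rw [(hg'.fun_mul d1).fderiv, (hg'.fun_mul d2).fderiv, horiz_killing, fderiv_coord,
      fderiv_coord (fderiv ℝ ψ u)]
    simp [graphPoint, hw1, hw2]
    ring
  simp_rw [e]
  have i12 := i1.add i2
  have s1 : ∫ u, (fderiv ℝ (fun u => g u * w1 u) u (1, 0)
      + fderiv ℝ (fun u => g u * w2 u) u (0, 1)) = 0 := by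
    rw [integral_add i1 i2]
    change (∫ u, fderiv ℝ (fun u => g u * w1 u) u (1, 0)) + _ = _
    rw [show (∫ u, fderiv ℝ (fun u => g u * w1 u) u (1, 0)) = 0 from z1,
      show (∫ u, fderiv ℝ (fun u => g u * w2 u) u (0, 1)) = 0 from z2, add_zero]
  have s2 := integral_sub i12 i3
  simp only [Pi.add_apply] at s2
  rw [s2, s1, zero_sub]

lemma hasCompactSupport_fderiv_comp {χ : ℝ × ℝ → ℝ} (hc : HasCompactSupport χ)
    (v : ℝ × ℝ → ℝ × ℝ) : HasCompactSupport (fun u => fderiv ℝ χ u (v u)) := by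
  refine (hc.fderiv ℝ).mono' fun x hx => subset_tsupport _ ?_
  contrapose! hx
  simp only [Function.mem_support, not_not] at hx ⊢
  simp [hx]

lemma continuous_horiz_killing {ψ : ℝ × ℝ → ℝ} (hψ : ContDiff ℝ 1 ψ) (a b : E3) :
    Continuous fun u => horiz (killing a b (graphPoint ψ u)) :=
  continuous_horiz.comp ((continuous_killing a b).comp (continuous_graphPoint hψ))

/-- Integration by parts for the term of the rate of change of the flux which contains the
derivatives of the velocity `r = ∂η/∂t` of the graph. -/
lemma integral_transport_by_parts {ψ χ φ r α : ℝ × ℝ → ℝ} (hψ : ContDiff ℝ 1 ψ)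
    (hχ : ContDiff ℝ 1 χ) (hc : HasCompactSupport χ) (hφ : ContDiff ℝ 1 φ) (hr : ContDiff ℝ 1 r)
    (hα : Continuous α) (a b : E3) :
    ∫ u, χ u * (α u - φ u * (r u * fderiv ℝ ψ u (b 1, -b 0)
        + fderiv ℝ r u (horiz (killing a b (graphPoint ψ u)))))
      = (∫ u, χ u * (α u + fderiv ℝ φ u (horiz (killing a b (graphPoint ψ u))) * r u))
        + ∫ u, fderiv ℝ χ u (horiz (killing a b (graphPoint ψ u))) * (φ u * r u) := by
  have hparts := integral_fderiv_horiz_killing hψ (g := fun u => χ u * (φ u * r u))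
    (hχ.mul (hφ.mul hr)) hc.mul_right a b
  have hwc := continuous_horiz_killing hψ a b
  have hprod : ∀ u v, fderiv ℝ (fun u => χ u * (φ u * r u)) u v
      = fderiv ℝ χ u v * (φ u * r u)
        + χ u * (fderiv ℝ φ u v * r u + φ u * fderiv ℝ r u v) := by
    intro u v
    have h1 := (hχ.differentiable one_ne_zero u).hasFDerivAt
    have h2 := (hφ.differentiable one_ne_zero u).hasFDerivAt
    have h3 := (hr.differentiable one_ne_zero u).hasFDerivAt
    rw [(h1.fun_mul (h2.fun_mul h3)).fderiv]
    simp
    ring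
  simp_rw [hprod] at hparts
  have hdχ := (hχ.continuous_fderiv one_ne_zero).clm_apply hwc
  have hdφ := (hφ.continuous_fderiv one_ne_zero).clm_apply hwc
  have hdr := (hr.continuous_fderiv one_ne_zero).clm_apply hwc
  have hdψ := (hψ.continuous_fderiv one_ne_zero).clm_apply
    (continuous_const (y := ((b 1, -b 0) : ℝ × ℝ)))
  have j1 := ((hdχ.mul (hφ.continuous.mul hr.continuous)).integrable_of_hasCompactSupport
    (μ := volume) (hasCompactSupport_fderiv_comp hc _).mul_right)
  have j2 := ((hχ.continuous.mul ((hdφ.mul hr.continuous).add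
    (hφ.continuous.mul hdr))).integrable_of_hasCompactSupport (μ := volume) hc.mul_right)
  have j3 := (((hχ.continuous.mul (hφ.continuous.mul hr.continuous)).mul
    hdψ).integrable_of_hasCompactSupport (μ := volume) hc.mul_right.mul_right)
  have j4 := ((hχ.continuous.mul (hα.add
    (hdφ.mul hr.continuous))).integrable_of_hasCompactSupport (μ := volume) hc.mul_right)
  have hfin : ∀ u, χ u * (α u - φ u * (r u * fderiv ℝ ψ u (b 1, -b 0)
        + fderiv ℝ r u (horiz (killing a b (graphPoint ψ u)))))
      = (χ u * (α u + fderiv ℝ φ u (horiz (killing a b (graphPoint ψ u))) * r u)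
        - χ u * (fderiv ℝ φ u (horiz (killing a b (graphPoint ψ u))) * r u
          + φ u * fderiv ℝ r u (horiz (killing a b (graphPoint ψ u)))))
        - χ u * (φ u * r u) * fderiv ℝ ψ u (b 1, -b 0) := by
    intro u
    ring
  simp_rw [hfin]
  have k1 := integral_add j1 j2
  have k2 := integral_sub j4 j2
  have k3 := integral_sub (j4.sub j2) j3
  simp only [Pi.add_apply, Pi.sub_apply, Pi.mul_apply] at k1 k2 k3
  linarith

/-- The horizontal part of the hydrostatic force on the free surface is, up to the cutoff, an
integral of a horizontal derivative. -/
lemma integral_hydrostatic {ψ χ : ℝ × ℝ → ℝ} (hψ : ContDiff ℝ 1 ψ) (hχ : ContDiff ℝ 1 χ)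
    (hc : HasCompactSupport χ) (z₀ : ℝ) (a b : E3) :
    ∫ u, χ u * ((z₀ - ψ u) * inner ℝ (killing a b (graphPoint ψ u)) (graphNormalVec ψ u))
      = (∫ u, χ u * ((z₀ - ψ u) * killing a b (point u 0) 2))
        + ((1 / 6) * (∫ u, fderiv ℝ χ u (b 1, -b 0) * (ψ u - z₀) ^ 3)
          - (1 / 2) * ∫ u, fderiv ℝ χ u (horiz (killing a b (graphPoint ψ u)))
              * (ψ u - z₀) ^ 2) := by
  have hwc := continuous_horiz_killing hψ a b
  have hζ : ContDiff ℝ 1 fun u => ψ u - z₀ := hψ.sub contDiff_const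
  have hζc := hζ.continuous
  -- The horizontal part of the force density is the derivative of `(ψ - z₀)² / 2` along the field;
  -- the divergence of the field contributes a derivative of `(ψ - z₀)³ / 6`.
  have p1 := integral_fderiv_horiz_killing hψ (g := fun u => χ u * (ψ u - z₀) ^ 2)
    (hχ.mul (hζ.pow 2)) hc.mul_right a b
  have p2 := integral_fderiv_apply_eq_zero volume (f := fun u => χ u * (ψ u - z₀) ^ 3)
    (hχ.mul (hζ.pow 3)) hc.mul_right (b 1, -b 0)
  have d1 : ∀ u v, fderiv ℝ (fun u => χ u * (ψ u - z₀) ^ 2) u v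
      = fderiv ℝ χ u v * (ψ u - z₀) ^ 2 + 2 * (χ u * ((ψ u - z₀) * fderiv ℝ ψ u v)) := by
    intro u v
    have h1 := (hχ.differentiable one_ne_zero u).hasFDerivAt
    have h2 : HasFDerivAt (fun u => (ψ u - z₀) ^ 2) _ u :=
      ((hψ.differentiable one_ne_zero u).hasFDerivAt.sub_const z₀).pow 2
    rw [(h1.fun_mul h2).fderiv]
    simp
    ring
  have d2 : ∀ u v, fderiv ℝ (fun u => χ u * (ψ u - z₀) ^ 3) u v
      = fderiv ℝ χ u v * (ψ u - z₀) ^ 3 + 3 * (χ u * (ψ u - z₀) ^ 2 * fderiv ℝ ψ u v) := by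
    intro u v
    have h1 := (hχ.differentiable one_ne_zero u).hasFDerivAt
    have h2 : HasFDerivAt (fun u => (ψ u - z₀) ^ 3) _ u :=
      ((hψ.differentiable one_ne_zero u).hasFDerivAt.sub_const z₀).pow 3
    rw [(h1.fun_mul h2).fderiv]
    simp
    ring
  simp_rw [d1] at p1
  simp_rw [d2] at p2
  have hdχ := (hχ.continuous_fderiv one_ne_zero).clm_apply hwc
  have hdχ' := (hχ.continuous_fderiv one_ne_zero).clm_apply
    (continuous_const (y := ((b 1, -b 0) : ℝ × ℝ)))
  have hdψ := (hψ.continuous_fderiv one_ne_zero).clm_apply hwc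
  have hdψ' := (hψ.continuous_fderiv one_ne_zero).clm_apply
    (continuous_const (y := ((b 1, -b 0) : ℝ × ℝ)))
  have j1 := ((hdχ.mul (hζc.pow 2)).integrable_of_hasCompactSupport
    (μ := volume) (hasCompactSupport_fderiv_comp hc _).mul_right)
  have j2 := ((hχ.continuous.mul (hζc.mul hdψ)).integrable_of_hasCompactSupport
    (μ := volume) hc.mul_right)
  have j3 := ((hdχ'.mul (hζc.pow 3)).integrable_of_hasCompactSupport
    (μ := volume) (hasCompactSupport_fderiv_comp hc _).mul_right)
  have j4 := (((hχ.continuous.mul (hζc.pow 2)).mul hdψ').integrable_of_hasCompactSupport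
    (μ := volume) hc.mul_right.mul_right)
  have hβ : Continuous fun u : ℝ × ℝ => killing a b (point u 0) 2 := by
    simp only [killing_two, point_one, point_zero]
    fun_prop
  have j5 := ((hχ.continuous.mul (((continuous_const (y := z₀)).sub hψ.continuous).mul
    hβ)).integrable_of_hasCompactSupport (μ := volume) hc.mul_right)
  have k1 := integral_add j1 (j2.const_mul 2)
  have k2 := integral_add j3 (j4.const_mul 3)
  have k3 := integral_add j5 j2
  rw [integral_const_mul] at k1 k2
  simp only [Pi.sub_apply, Pi.mul_apply, Pi.pow_apply] at k1 k2 k3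
  have e : ∀ u, χ u * ((z₀ - ψ u) * inner ℝ (killing a b (graphPoint ψ u)) (graphNormalVec ψ u))
      = χ u * ((z₀ - ψ u) * killing a b (point u 0) 2)
        + χ u * ((ψ u - z₀) * fderiv ℝ ψ u (horiz (killing a b (graphPoint ψ u)))) := by
    intro u
    rw [inner_graphNormalVec]
    simp only [killing_two, graphPoint, point_one, point_zero]
    ring
  simp_rw [e]
  linarith

lemma hasDerivAt_slice {E F : Type*} [NormedAddCommGroup E] [NormedSpace ℝ E]
    [NormedAddCommGroup F] [NormedSpace ℝ F] {Ψ : ℝ × E → F} {s : ℝ} {x : E}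
    (h : DifferentiableAt ℝ Ψ (s, x)) :
    HasDerivAt (fun s => Ψ (s, x)) (fderiv ℝ Ψ (s, x) (1, 0)) s :=
  HasFDerivAt.comp_hasDerivAt (l := Ψ) s h.hasFDerivAt
    ((hasDerivAt_id s).prodMk (hasDerivAt_const s x))

lemma inner_kvec (v : E3) : inner ℝ v kvec = v 2 := by
  simp [inner_eq_sum, kvec]

variable {P : Params} {B : RigidBody} {M : Motion} {I : Set ℝ} {t : ℝ}
variable (hS : IsSolution P B M I)
include hS

lemma IsSolution.continuous_vel_comp {Y : Type*} [TopologicalSpace Y] (ht : t ∈ I) {p : Y → E3}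
    (hp : Continuous p) (hm : ∀ y, p y ∈ closedFluid B M t) :
    Continuous fun y => vel M t (p y) := by
  rw [continuous_iff_continuousAt]
  intro y
  exact ContinuousAt.comp (g := vel M t)
    (contDiffAt_one_gradient (hS.contDiffAt_Φ_space ht (hm y))).continuousAt hp.continuousAt

lemma IsSolution.continuous_Φ_comp {Y : Type*} [TopologicalSpace Y] (ht : t ∈ I) {p : Y → E3}
    (hp : Continuous p) (hm : ∀ y, p y ∈ closedFluid B M t) : Continuous fun y => M.Φ t (p y) := by
  rw [continuous_iff_continuousAt]
  intro y
  exact ContinuousAt.comp (g := M.Φ t)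
    (hS.contDiffAt_Φ_space ht (hm y)).continuousAt hp.continuousAt

lemma IsSolution.continuous_potRate_comp {Y : Type*} [TopologicalSpace Y] (ht : t ∈ I) {p : Y → E3}
    (hp : Continuous p) (hm : ∀ y, p y ∈ closedFluid B M t) :
    Continuous fun y => potRate M t (p y) := by
  have e : ∀ y, potRate M t (p y) = fderiv ℝ (fun q : ℝ × E3 => M.Φ q.1 q.2) (t, p y) (1, 0) :=
    fun y => deriv_slice (Ψ := fun q : ℝ × E3 => M.Φ q.1 q.2)
      ((hS.contDiffAt_Φ t ht _ (hm y)).differentiableAt two_ne_zero)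
  simp_rw [e]
  rw [continuous_iff_continuousAt]
  intro y
  have h1 := ((hS.contDiffAt_Φ t ht _ (hm y)).fderiv_right (m := 1)
    (by simp [one_add_one_eq_two])).continuousAt
  have h2 : ContinuousAt (fun y => (t, p y)) y := by fun_prop
  exact (ContinuousAt.comp (g := fderiv ℝ (fun q : ℝ × E3 => M.Φ q.1 q.2)) (f := fun y => (t, p y))
    h1 h2).clm_apply
    continuousAt_const

omit hS in
/-- The flux of `Φ ξ` through the free surface, with a cutoff. -/
def surfaceFlux (M : Motion) (χ : ℝ × ℝ → ℝ) (a b : E3) (t : ℝ) : ℝ :=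
  ∫ u, χ u * (M.Φ t (graphPoint (M.η t) u)
    * inner ℝ (killing a b (graphPoint (M.η t) u)) (graphNormalVec (M.η t) u))

/-- Regularity and rate of change of the flux density of `Φ ξ` through the free surface, in the
fixed horizontal coordinates `u`; here `r = ∂η/∂t`. The slope of the surface in the direction of `ξ`
is written as a derivative of `η` in time and space jointly, so that it may be differentiated in
time; the symmetry of the second derivative turns the result into a derivative of `r`. -/
lemma IsSolution.exists_hasDerivAt_fluxDensity (ht : t ∈ I) (a b : E3) :
    (∀ u, ContDiffAt ℝ 1 (fun q : ℝ × (ℝ × ℝ) => M.Φ q.1 (graphPoint (M.η q.1) q.2)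
      * (killing a b (graphPoint (M.η q.1) q.2) 2
        - fderiv ℝ (fun q : ℝ × (ℝ × ℝ) => M.η q.1 q.2) q
            (0, horiz (killing a b (graphPoint (M.η q.1) q.2))))) (t, u)) ∧
    (∀ u, inner ℝ (killing a b (graphPoint (M.η t) u)) (graphNormalVec (M.η t) u)
      = killing a b (graphPoint (M.η t) u) 2
        - fderiv ℝ (fun q : ℝ × (ℝ × ℝ) => M.η q.1 q.2) (t, u)
            (0, horiz (killing a b (graphPoint (M.η t) u)))) ∧
    ContDiff ℝ 1 (fun u => M.Φ t (graphPoint (M.η t) u)) ∧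
    ∃ r : ℝ × ℝ → ℝ, ContDiff ℝ 1 r ∧
      (∀ u, inner ℝ (vel M t (graphPoint (M.η t) u)) (graphNormalVec (M.η t) u) = r u) ∧
      (∀ u, HasDerivAt (fun s => M.η s u) (r u) t) ∧
      ∀ u, HasDerivAt (fun s => M.Φ s (graphPoint (M.η s) u)
        * (killing a b (graphPoint (M.η s) u) 2
          - fderiv ℝ (fun q : ℝ × (ℝ × ℝ) => M.η q.1 q.2) (s, u)
              (0, horiz (killing a b (graphPoint (M.η s) u)))))
        ((potRate M t (graphPoint (M.η t) u) + r u * vel M t (graphPoint (M.η t) u) 2)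
            * inner ℝ (killing a b (graphPoint (M.η t) u)) (graphNormalVec (M.η t) u)
          - M.Φ t (graphPoint (M.η t) u) * (r u * fderiv ℝ (M.η t) u (b 1, -b 0)
            + fderiv ℝ r u (horiz (killing a b (graphPoint (M.η t) u))))) t := by
  -- `e` is `η` as a function of time and horizontal position jointly.
  generalize he : (fun q : ℝ × (ℝ × ℝ) => M.η q.1 q.2) = e
  have hee : ∀ s u, M.η s u = e (s, u) := fun s u => by rw [← he]
  have hed : ∀ u, ContDiffAt ℝ 2 e (t, u) := by
    rw [← he]
    exact hS.contDiffAt_η t ht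
  have hedd : ∀ u, DifferentiableAt ℝ e (t, u) := fun u =>
    (hed u).differentiableAt two_ne_zero
  have hde : ∀ u, ContDiffAt ℝ 1 (fderiv ℝ e) (t, u) := fun u =>
    (hed u).fderiv_right (by simp [one_add_one_eq_two])
  have hpd : ∀ u, ContDiffAt ℝ 2 (fun q : ℝ × (ℝ × ℝ) => graphPoint (M.η q.1) q.2) (t, u) := by
    intro u
    refine (contDiff_point (n := 2)).contDiffAt.comp (t, u)
      (contDiffAt_snd.prodMk (hS.contDiffAt_η t ht u))
  have hφd : ∀ u, ContDiffAt ℝ 2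
      (fun q : ℝ × (ℝ × ℝ) => M.Φ q.1 (graphPoint (M.η q.1) q.2)) (t, u) := fun u =>
    ContDiffAt.comp (g := fun q : ℝ × E3 => M.Φ q.1 q.2) (t, u)
      (hS.contDiffAt_Φ t ht _ (hS.graphPoint_mem ht u)) (contDiffAt_fst.prodMk (hpd u))
  have hkp : ∀ u, ContDiffAt ℝ 1
      (fun q : ℝ × (ℝ × ℝ) => killing a b (graphPoint (M.η q.1) q.2)) (t, u) := fun u =>
    (contDiff_killing a b).contDiffAt.comp (t, u) ((hpd u).of_le one_le_two)
  have hνeq : ∀ u, inner ℝ (killing a b (graphPoint (M.η t) u)) (graphNormalVec (M.η t) u)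
      = killing a b (graphPoint (M.η t) u) 2
        - fderiv ℝ e (t, u) (0, horiz (killing a b (graphPoint (M.η t) u))) := by
    intro u
    rw [inner_graphNormalVec, ← fderiv_slice (hedd u), ← he]
  have hslice : ∀ u, ContDiffAt ℝ 1 (fun u : ℝ × ℝ => (t, u)) u := fun u => by fun_prop
  refine ⟨fun u => ?_, hνeq, ?_, fun u => fderiv ℝ e (t, u) (1, 0), ?_, ?_, ?_, fun u => ?_⟩
  · exact ((hφd u).of_le one_le_two).mul
      (((contDiff_coord 2).contDiffAt.comp (t, u) (hkp u)).sub ((hde u).clm_apply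
        (contDiffAt_const.prodMk (contDiff_horiz.contDiffAt.comp (t, u) (hkp u)))))
  · rw [contDiff_iff_contDiffAt]
    exact fun u => ((hφd u).of_le one_le_two).comp u (hslice u)
  · rw [contDiff_iff_contDiffAt]
    exact fun u => ((hde u).comp u (hslice u)).clm_apply contDiffAt_const
  · intro u
    change _ = fderiv ℝ e (t, u) (1, 0)
    rw [← hS.kinematic t ht u, ← deriv_slice (hedd u), ← he]
  · intro u
    simp_rw [hee]
    exact hasDerivAt_slice (hedd u)
  generalize hrdef : (fun u => fderiv ℝ e (t, u) (1, 0)) = r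
  have hr : ∀ u, fderiv ℝ e (t, u) (1, 0) = r u := fun u => congrFun hrdef u
  have t1 : HasDerivAt (fun s => M.η s u) (r u) t := by
    simp_rw [hee, ← hr]
    exact hasDerivAt_slice (hedd u)
  have t2 : HasDerivAt (fun s => graphPoint (M.η s) u) (r u • kvec) t := by
    have h1 : HasDerivAt (fun s => graphPoint (M.η s) u) _ t :=
      HasFDerivAt.comp_hasDerivAt (l := pointL) t
        (pointL : ((ℝ × ℝ) × ℝ) →L[ℝ] E3).hasFDerivAt ((hasDerivAt_const t u).prodMk t1)
    refine h1.congr_deriv ?_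
    ext i; fin_cases i <;> simp [kvec, point]
  have t3 : HasDerivAt (fun s => M.Φ s (graphPoint (M.η s) u))
      (potRate M t (graphPoint (M.η t) u) + r u * vel M t (graphPoint (M.η t) u) 2) t := by
    have h0 := (hS.contDiffAt_Φ t ht _ (hS.graphPoint_mem ht u)).differentiableAt two_ne_zero
    have h1 : HasDerivAt (fun s => M.Φ s (graphPoint (M.η s) u)) _ t :=
      HasFDerivAt.comp_hasDerivAt (l := fun q : ℝ × E3 => M.Φ q.1 q.2) t h0.hasFDerivAt
        ((hasDerivAt_id t).prodMk t2)
    refine h1.congr_deriv ?_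
    have h2 : ((1 : ℝ), r u • kvec) = (1, 0) + (0, r u • kvec) := by simp
    rw [h2, map_add, ← deriv_slice h0, ← fderiv_slice h0, fderiv_eq_inner, real_inner_smul_right,
      inner_kvec]
    rfl
  have t4 : HasDerivAt (fun s => killing a b (graphPoint (M.η s) u)) (r u • cross b kvec) t := by
    have h1 := HasFDerivAt.comp_hasDerivAt (l := killing a b) t
      (hasFDerivAt_killing a b (graphPoint (M.η t) u)) t2
    refine h1.congr_deriv ?_
    rw [map_smul, crossB_apply]
  have hcoord : ∀ i : Fin 3, HasDerivAt (fun s => killing a b (graphPoint (M.η s) u) i)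
      (r u * cross b kvec i) t := fun i =>
    HasFDerivAt.comp_hasDerivAt (l := EuclideanSpace.proj (𝕜 := ℝ) i) t
      (EuclideanSpace.proj (𝕜 := ℝ) i).hasFDerivAt t4
  have t5 : HasDerivAt (fun s => killing a b (graphPoint (M.η s) u) 2) 0 t := by
    refine (hcoord 2).congr_deriv ?_
    simp [cross_apply_two, kvec]
  have t6 : HasDerivAt (fun s => ((0 : ℝ), horiz (killing a b (graphPoint (M.η s) u))))
      (0, r u • (b 1, -b 0)) t := by
    refine ((hasDerivAt_const t (0 : ℝ)).prodMk ((hcoord 0).prodMk (hcoord 1))).congr_deriv ?_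
    simp [cross_apply_zero, cross_apply_one, kvec]
  have t7 := hasDerivAt_slice ((hde u).differentiableAt one_ne_zero)
  refine (t3.fun_mul (t5.fun_sub (t7.clm_apply t6))).congr_deriv ?_
  have s1 : fderiv ℝ (fderiv ℝ e) (t, u) (1, 0)
      (0, horiz (killing a b (graphPoint (M.η t) u)))
      = fderiv ℝ r u (horiz (killing a b (graphPoint (M.η t) u))) := by
    have h1 : HasFDerivAt (fun u => fderiv ℝ e (t, u) (1, 0)) _ u :=
      (HasFDerivAt.comp (g := fderiv ℝ e) u ((hde u).differentiableAt one_ne_zero).hasFDerivAt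
        (hasFDerivAt_prodMk_right t u)).clm_apply (hasFDerivAt_const _ _)
    rw [← hrdef, h1.fderiv, ((hed u).isSymmSndFDerivAt (by simp)).eq]
    simp
  have s2 : fderiv ℝ e (t, u) (0, r u • (b 1, -b 0))
      = r u * fderiv ℝ (M.η t) u (b 1, -b 0) := by
    rw [← fderiv_slice (hedd u), map_smul, smul_eq_mul, ← he]
  rw [s1, s2, hνeq u]
  ring

/-- Transport theorem for the flux of `Φ ξ` through the free surface. The first integral has the
form of the rate of change for the surface of a body; the second one is due to the cutoff. -/
theorem IsSolution.hasDerivAt_surfaceFlux (hI : IsOpen I) (ht : t ∈ I) {χ : ℝ × ℝ → ℝ}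
    (hχ : ContDiff ℝ 1 χ) (hc : HasCompactSupport χ) (a b : E3) :
    HasDerivAt (surfaceFlux M χ a b)
      ((∫ u, χ u * (potRate M t (graphPoint (M.η t) u)
          * inner ℝ (killing a b (graphPoint (M.η t) u)) (graphNormalVec (M.η t) u)
        + inner ℝ (vel M t (graphPoint (M.η t) u)) (killing a b (graphPoint (M.η t) u))
          * inner ℝ (vel M t (graphPoint (M.η t) u)) (graphNormalVec (M.η t) u)))
        + ∫ u, fderiv ℝ χ u (horiz (killing a b (graphPoint (M.η t) u)))
          * (M.Φ t (graphPoint (M.η t) u)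
            * inner ℝ (vel M t (graphPoint (M.η t) u)) (graphNormalVec (M.η t) u))) t := by
  have hIn := hI.mem_nhds ht
  have hη := hS.contDiff_one_η ht
  obtain ⟨-, hνeq, hφt, r, hrd, hreq, -, hder⟩ := hS.exists_hasDerivAt_fluxDensity ht a b
  set H : ℝ × (ℝ × ℝ) → ℝ := fun q => M.Φ q.1 (graphPoint (M.η q.1) q.2)
      * (killing a b (graphPoint (M.η q.1) q.2) 2
        - fderiv ℝ (fun q : ℝ × (ℝ × ℝ) => M.η q.1 q.2) q
            (0, horiz (killing a b (graphPoint (M.η q.1) q.2)))) with hH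
  have hHd : ∀ s ∈ I, ∀ u, ContDiffAt ℝ 1 H (s, u) := fun s hs =>
    (hS.exists_hasDerivAt_fluxDensity hs a b).1
  have hflux : ∀ s ∈ I, surfaceFlux M χ a b s = ∫ u in tsupport χ, χ u * H (s, u) := by
    intro s hs
    rw [setIntegral_eq_integral_of_forall_compl_eq_zero
      (fun u hu => by rw [image_eq_zero_of_notMem_tsupport hu, zero_mul]), surfaceFlux]
    congr 1
    funext u
    rw [(hS.exists_hasDerivAt_fluxDensity hs a b).2.1 u]
  have hderiv : HasDerivAt (fun s => ∫ u in tsupport χ, χ u * H (s, u))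
      (∫ u in tsupport χ, χ u * fderiv ℝ H (t, u) (1, 0)) t := by
    refine hasDerivAt_setIntegral (F := fun s u => χ u * H (s, u))
      (F' := fun s u => χ u * fderiv ℝ H (s, u) (1, 0)) hc hIn ?_ ?_ ?_
    · intro s hs u _
      have h1 : ContinuousAt (fun u : ℝ × ℝ => (s, u)) u := by fun_prop
      exact (hχ.continuous.continuousAt.mul
        (ContinuousAt.comp (g := H) (hHd s hs u).continuousAt h1)).continuousWithinAt
    · intro s hs u _
      exact (hasDerivAt_slice ((hHd s hs u).differentiableAt one_ne_zero)).const_mul (χ u)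
    · rintro ⟨s, u⟩ ⟨hs, _⟩
      have h2 : ContinuousAt (fderiv ℝ H) (s, u) :=
        ((hHd s hs u).fderiv_right (m := 0) (by simp)).continuousAt
      exact ((hχ.continuous.comp continuous_snd).continuousAt.mul
        (h2.clm_apply continuousAt_const)).continuousWithinAt
  refine (hderiv.congr_of_eventuallyEq ?_).congr_deriv ?_
  · filter_upwards [hIn] with s hs using hflux s hs
  rw [setIntegral_eq_integral_of_forall_compl_eq_zero
    (fun u hu => by rw [image_eq_zero_of_notMem_tsupport hu, zero_mul])]
  have hgp := continuous_graphPoint hη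
  have hvc := hS.continuous_vel_comp ht hgp (hS.graphPoint_mem ht)
  have hpc := hS.continuous_potRate_comp ht hgp (hS.graphPoint_mem ht)
  have hkc := (continuous_killing a b).comp hgp
  have hα := (hpc.add (hrd.continuous.mul ((contDiff_coord (n := 0) 2).continuous.comp hvc))).mul
    (hkc.inner (𝕜 := ℝ) (continuous_graphNormalVec hη))
  have hgrad : ∀ u, fderiv ℝ (fun u => M.Φ t (graphPoint (M.η t) u)) u
        (horiz (killing a b (graphPoint (M.η t) u)))
      = inner ℝ (vel M t (graphPoint (M.η t) u)) (killing a b (graphPoint (M.η t) u))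
        - vel M t (graphPoint (M.η t) u) 2
          * inner ℝ (killing a b (graphPoint (M.η t) u)) (graphNormalVec (M.η t) u) := by
    intro u
    have h1 : HasFDerivAt (fun u => M.Φ t (graphPoint (M.η t) u)) _ u :=
      HasFDerivAt.comp (g := M.Φ t) u
        ((hS.contDiffAt_Φ_space ht (hS.graphPoint_mem ht u)).differentiableAt
          two_ne_zero).hasFDerivAt
        (HasFDerivAt.comp (g := pointL) u (pointL : ((ℝ × ℝ) × ℝ) →L[ℝ] E3).hasFDerivAt
          ((hasFDerivAt_id u).prodMk (hη.differentiable one_ne_zero u).hasFDerivAt))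
    rw [h1.fderiv, inner_graphNormalVec, ← inner_kvec (vel M t (graphPoint (M.η t) u)),
      mul_comm, ← real_inner_smul_right, ← inner_sub_right]
    simp only [ContinuousLinearMap.comp_apply]
    rw [fderiv_eq_inner, vel]
    congr 1
    ext i
    fin_cases i <;> simp [kvec, horiz]
  have key := integral_transport_by_parts hη hχ hc hφt hrd hα a b
  refine Eq.trans ?_ (key.trans ?_)
  · congr 1
    funext u
    rw [(hasDerivAt_slice ((hHd t ht u).differentiableAt one_ne_zero)).unique (hder u)]
    rfl
  · simp_rw [hgrad, hreq]
    congr 2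
    funext u
    simp only [Function.comp_apply, Pi.add_apply, Pi.mul_apply]
    ring

end Surface

/-! ### Balance of momentum with a cutoff -/

section Balance

variable {P : Params} {B : RigidBody} {M : Motion} {I : Set ℝ} {t : ℝ}

lemma bodyS_add {F G : E3 → E3 → ℝ} (hF : Continuous fun p : E3 × E3 => F p.1 p.2)
    (hG : Continuous fun p : E3 × E3 => G p.1 p.2) :
    bodyS B M t (fun r n => F r n + G r n) = bodyS B M t F + bodyS B M t G := by
  have h1 : Continuous (place M t) := (contDiff_place (n := 0)).continuous
  have h2 := (M.Q t).continuous
  have h3 : Continuous fun p : E3 × E3 => (place M t p.1, M.Q t p.2) := by fun_prop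
  exact RigidBody.bdry_add (F := fun l n => F (place M t l) (M.Q t n))
    (G := fun l n => G (place M t l) (M.Q t n)) (hF.comp h3) (hG.comp h3)

lemma bodyS_const_mul (r : ℝ) (F : E3 → E3 → ℝ) :
    bodyS B M t (fun x n => r * F x n) = r * bodyS B M t F :=
  RigidBody.bdry_const_mul r _

lemma inner_bodySurfaceIntegral {F : E3 → E3 → E3} {G : E3 → E3 → E3}
    (hG : Continuous fun p : E3 × E3 => G p.1 p.2)
    (h : ∀ r n, IsBodyNormal B M t r n → F r n = G r n) (a : E3) :
    inner ℝ (bodySurfaceIntegral B M t F) a = bodyS B M t fun r n => inner ℝ (G r n) a := by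
  have h1 : Continuous (place M t) := (contDiff_place (n := 0)).continuous
  have h2 := (M.Q t).continuous
  have h3 : Continuous fun p : E3 × E3 => (place M t p.1, M.Q t p.2) := by fun_prop
  have e : bodySurfaceIntegral B M t F = bodySurfaceIntegral B M t G :=
    RigidBody.boundaryIntegral_congr fun l n hl => h _ _ ⟨l, n, hl, rfl, rfl⟩
  rw [e, bodySurfaceIntegral, RigidBody.inner_boundaryIntegral
    (F := fun l n => G (place M t l) (M.Q t n)) (hG.comp h3)]
  rfl

lemma continuous_inner_killing (a b : E3) :
    Continuous fun p : E3 × E3 => inner ℝ (killing a b p.1) p.2 :=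
  ((continuous_killing a b).comp continuous_fst).inner continuous_snd

/-- The buoyancy: the hydrostatic pressure acts at the centroid of the displaced fluid. -/
lemma bodyS_hydrostatic (c₀ c₁ : ℝ) (a b : E3) :
    bodyS B M t (fun r n => (c₀ - c₁ * r 2) * inner ℝ (killing a b r) n)
      = -(c₁ * B.vol * killing a b (M.c t) 2) := by
  have h0 : ContDiff ℝ 1 (fun r : E3 => c₀ - c₁ * r 2) :=
    contDiff_const.sub (contDiff_const.mul (contDiff_coord 2))
  have h := setIntegral_bodyAt_div (B := B) (M := M) (t := t)
    (X := fun r : E3 => (c₀ - c₁ * r 2) • killing a b r) (h0.smul (contDiff_killing a b (n := 1)))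
  simp only [real_inner_smul_left] at h
  rw [← h, setIntegral_bodyAt]
  have e : ∀ l, div (fun r : E3 => (c₀ - c₁ * r 2) • killing a b r) (place M t l)
      = -c₁ * (killing a b (M.c t) 2 + inner ℝ (M.Q t l) (cross kvec b)) := by
    intro l
    rw [div_smul_killing _ _ (h0.differentiable one_ne_zero _)]
    have h1 : HasFDerivAt (fun r : E3 => c₀ - c₁ * r 2) _ (place M t l) :=
      ((EuclideanSpace.proj (𝕜 := ℝ) (2 : Fin 3)).hasFDerivAt.const_mul c₁).const_sub c₀
    rw [h1.fderiv]
    simp [killing_two, place, inner_eq_sum, cross_apply_zero, cross_apply_one, cross_apply_two,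
      kvec]
    left
    ring
  simp_rw [e]
  have hQ : Integrable (fun l => M.Q t l) (volume.restrict B.carrier) :=
    (M.Q t).continuous.continuousOn.integrableOn_compact B.isCompact_carrier
  have hid : Integrable (fun l : E3 => l) (volume.restrict B.carrier) :=
    continuous_id.continuousOn.integrableOn_compact B.isCompact_carrier
  have z : ∫ l in B.carrier, inner ℝ (M.Q t l) (cross kvec b) = 0 := by
    simp_rw [real_inner_comm (cross kvec b)]
    rw [integral_inner hQ, show (∫ l in B.carrier, M.Q t l) = 0 from ?_, inner_zero_right]
    have := (M.Q t : E3 →L[ℝ] E3).integral_comp_comm hid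
    rw [B.centroid_eq_zero, map_zero] at this
    exact this
  have hconst : Integrable (fun _ : E3 => killing a b (M.c t) 2) (volume.restrict B.carrier) :=
    continuous_const.continuousOn.integrableOn_compact B.isCompact_carrier
  rw [integral_const_mul, integral_add hconst (hQ.inner_const _), z, setIntegral_const]
  simp [RigidBody.vol, Measure.real]
  ring

variable (hS : IsSolution P B M I)
include hS

/-- Near the surface of the body the potential agrees with a function regular in the whole space,
and its rate of change agrees on the surface with a continuous function. -/
lemma IsSolution.exists_extension_at (hI : IsOpen I) (ht : t ∈ I) :
    ∃ f q : E3 → ℝ, ContDiff ℝ 2 f ∧ Continuous q ∧ ∀ x ∈ frontier (bodyAt B M t),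
      vel M t x = gradient f x ∧ potRate M t x = q x := by
  obtain ⟨Ψ, J, hJ, hJI, hΨ, heq⟩ := hS.exists_extension hI ht
  have htJ := mem_of_mem_nhds hJ
  have hsl : ∀ x, ContDiffAt ℝ 2 (fun x : E3 => (t, x)) x := fun x => by fun_prop
  refine ⟨fun x => Ψ (t, x), fun x => fderiv ℝ Ψ (t, x) (1, 0), ?_, ?_, fun x hx => ⟨?_, ?_⟩⟩
  · rw [contDiff_iff_contDiffAt]
    exact fun x => (hΨ t htJ x).comp x (hsl x)
  · rw [continuous_iff_continuousAt]
    intro x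
    have h1 := ((hΨ t htJ x).fderiv_right (m := 1) (by simp [one_add_one_eq_two])).continuousAt
    exact (ContinuousAt.comp (g := fderiv ℝ Ψ) h1 (hsl x).continuousAt).clm_apply
      continuousAt_const
  · have h3 : (fun x => Ψ (t, x)) =ᶠ[𝓝 x] M.Φ t := by
      filter_upwards [(hsl x).continuousAt.eventually (heq t htJ x hx)] with s hs using hs.symm
    rw [h3.gradient_eq, vel]
  · change _ = fderiv ℝ Ψ (t, x) (1, 0)
    rw [← deriv_slice ((hΨ t htJ x).differentiableAt two_ne_zero), potRate]
    have h2 : (fun s => M.Φ s x) =ᶠ[𝓝 t] fun s => Ψ (s, x) := by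
      have h3 : ContinuousAt (fun s : ℝ => (s, x)) t := by fun_prop
      exact h3.eventually (heq t htJ x hx)
    rw [h2.deriv_eq]

/-- Newton's and Euler's laws, tested with a rigid velocity field. -/
lemma IsSolution.hasDerivAt_bodyMomentum (hI : IsOpen I) (ht : t ∈ I) (a b : E3) :
    HasDerivAt (fun s => inner ℝ (bodyLinear P B M s) a + inner ℝ (bodyAngular P B M s) b)
      (-bodyS B M t (fun r n => pressure P M t r * inner ℝ (killing a b r) n)
        - P.ρb * P.g * B.vol * killing a b (M.c t) 2) t := by
  obtain ⟨f, q, hf, hq, hfq⟩ := hS.exists_extension_at hI ht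
  have hg : Continuous (gradient f) :=
    (contDiff_iff_contDiffAt.2 fun x => contDiffAt_one_gradient hf.contDiffAt).continuous
  set p : E3 → ℝ := fun x => P.patm + P.ρf * P.g * (P.η₀ - x 2)
    - P.ρf * (q x + ‖gradient f x‖ ^ 2 / 2) with hp
  have hpc : Continuous p := by
    have := (contDiff_coord (n := 0) 2).continuous
    fun_prop
  have hpe : ∀ x ∈ frontier (bodyAt B M t), pressure P M t x = p x := fun x hx => by
    rw [pressure, (hfq x hx).1, (hfq x hx).2]
  have hpc' : Continuous fun x : E3 × E3 => p x.1 := hpc.comp continuous_fst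
  have c1 : Continuous fun x : E3 × E3 => p x.1 • x.2 := hpc'.smul continuous_snd
  have c2 : Continuous fun x : E3 × E3 => crossB (x.1 - M.c t) (p x.1 • x.2) := by
    have := crossB.continuous
    fun_prop
  have h1 : ∀ v, inner ℝ (bodySurfaceIntegral B M t (fun r n => pressure P M t r • n)) v
      = bodyS B M t fun r n => inner ℝ (p r • n) v := fun v =>
    inner_bodySurfaceIntegral (F := fun r n => pressure P M t r • n) (G := fun r n => p r • n) c1
      (fun r n hn => by simp only [hpe r hn.mem_frontier]) v
  have h2 : inner ℝ (bodySurfaceIntegral B M t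
        (fun r n => cross (r - M.c t) (pressure P M t r • n))) b
      = bodyS B M t fun r n => inner ℝ (crossB (r - M.c t) (p r • n)) b :=
    inner_bodySurfaceIntegral (F := fun r n => cross (r - M.c t) (pressure P M t r • n))
      (G := fun r n => crossB (r - M.c t) (p r • n)) c2
      (fun r n hn => by simp only [hpe r hn.mem_frontier]; rfl) b
  have h3 : bodyS B M t (fun r n => pressure P M t r * inner ℝ (killing a b r) n)
      = inner ℝ (bodySurfaceIntegral B M t (fun r n => pressure P M t r • n))
          (killing a b (M.c t))
        + inner ℝ (bodySurfaceIntegral B M t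
            (fun r n => cross (r - M.c t) (pressure P M t r • n))) b := by
    rw [h1, h2, ← bodyS_add (c1.inner continuous_const) (c2.inner continuous_const)]
    refine bodyS_congr fun r n hn => ?_
    rw [hpe r hn.mem_frontier]
    simp only [killing, inner_eq_sum, crossB_apply, cross_apply_zero, cross_apply_one,
      cross_apply_two, PiLp.sub_apply, PiLp.add_apply, PiLp.smul_apply, smul_eq_mul]
    ring
  have d1 := hS.newton t ht
  have d2 : HasDerivAt (fun s => crossB (M.c s) (bodyLinear P B M s)) _ t :=
    (crossB.hasFDerivAt.comp_hasDerivAt t (hS.hasDerivAt_c t ht)).clm_apply d1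
  have d3 : HasDerivAt (bodyAngular P B M) _ t := d2.add (hS.euler t ht)
  refine ((d1.inner ℝ (hasDerivAt_const t a)).add
    (d3.inner ℝ (hasDerivAt_const t b))).congr_deriv ?_
  rw [h3]
  have e1 : crossB (M.V t) (bodyLinear P B M t) = 0 := by
    rw [bodyLinear, map_smul, crossB_apply, cross_self_eq_zero, smul_zero]
  rw [e1]
  simp only [crossB_apply, Function.comp_apply]
  generalize bodySurfaceIntegral B M t (fun r n => pressure P M t r • n) = F1
  generalize bodySurfaceIntegral B M t
    (fun r n => cross (r - M.c t) (pressure P M t r • n)) = F2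
  simp only [killing, inner_eq_sum, cross_apply_zero, cross_apply_one,
      cross_apply_two, PiLp.sub_apply, PiLp.add_apply, PiLp.smul_apply, smul_eq_mul, PiLp.neg_apply,
      PiLp.zero_apply]
  simp [kvec]
  ring

/-- The rate of change of the flux through the surface of the body, by Bernoulli's equation. -/
lemma IsSolution.bodyS_bernoulli (hI : IsOpen I) (ht : t ∈ I) (a b : E3) :
    P.ρf * bodyS B M t (fun r n => potRate M t r * inner ℝ (killing a b r) n
        + inner ℝ (vel M t r) (killing a b r) * inner ℝ (vel M t r) n)
      = P.ρf * bodyS B M t (fun r n => inner ℝ (stress a b (M.Φ t) r) n)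
        - P.ρf * P.g * B.vol * killing a b (M.c t) 2
        - bodyS B M t (fun r n => pressure P M t r * inner ℝ (killing a b r) n) := by
  obtain ⟨f, q, hf, hq, hfq⟩ := hS.exists_extension_at hI ht
  have hg : Continuous (gradient f) :=
    (contDiff_iff_contDiffAt.2 fun x => contDiffAt_one_gradient hf.contDiffAt).continuous
  have hst : Continuous (stress a b f) :=
    (contDiff_iff_contDiffAt.2 fun x => contDiffAt_stress a b hf.contDiffAt).continuous
  set p : E3 → ℝ := fun x => P.patm + P.ρf * P.g * (P.η₀ - x 2)
    - P.ρf * (q x + ‖gradient f x‖ ^ 2 / 2) with hp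
  have hz := (contDiff_coord (n := 0) 2).continuous
  have hpc : Continuous p := by fun_prop
  have c1 : Continuous fun x : E3 × E3 => P.ρf * inner ℝ (stress a b f x.1) x.2 :=
    continuous_const.mul ((hst.comp continuous_fst).inner continuous_snd)
  have c2 : Continuous fun x : E3 × E3 =>
      (P.patm + P.ρf * P.g * P.η₀ - P.ρf * P.g * x.1 2) * inner ℝ (killing a b x.1) x.2 :=
    (continuous_const.sub (continuous_const.mul (hz.comp continuous_fst))).mul
      (continuous_inner_killing a b)
  have c3 : Continuous fun x : E3 × E3 => (-1) * (p x.1 * inner ℝ (killing a b x.1) x.2) :=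
    continuous_const.mul ((hpc.comp continuous_fst).mul (continuous_inner_killing a b))
  have e1 : bodyS B M t (fun r n => inner ℝ (stress a b (M.Φ t) r) n)
      = bodyS B M t (fun r n => inner ℝ (stress a b f r) n) := bodyS_congr fun r n hn => by
    have := (hfq r hn.mem_frontier).1
    rw [vel] at this
    rw [stress, stress, this]
  have e2 : bodyS B M t (fun r n => pressure P M t r * inner ℝ (killing a b r) n)
      = bodyS B M t (fun r n => p r * inner ℝ (killing a b r) n) := bodyS_congr fun r n hn => by
    rw [pressure, (hfq r hn.mem_frontier).1, (hfq r hn.mem_frontier).2]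
  rw [e1, e2, ← bodyS_const_mul, ← bodyS_const_mul]
  have e3 : bodyS B M t (fun r n => P.ρf * (potRate M t r * inner ℝ (killing a b r) n
        + inner ℝ (vel M t r) (killing a b r) * inner ℝ (vel M t r) n))
      = bodyS B M t (fun r n => P.ρf * inner ℝ (stress a b f r) n
        + ((P.patm + P.ρf * P.g * P.η₀ - P.ρf * P.g * r 2) * inner ℝ (killing a b r) n
          + (-1) * (p r * inner ℝ (killing a b r) n))) := bodyS_congr fun r n hn => by
    rw [(hfq r hn.mem_frontier).1, (hfq r hn.mem_frontier).2, stress, inner_sub_left,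
      real_inner_smul_left, real_inner_smul_left, hp]
    ring
  rw [e3, bodyS_add c1 (c2.add c3), bodyS_add c2 c3, bodyS_hydrostatic, bodyS_const_mul (-1)]
  ring

/-- Balance of the momentum flux between the free surface, the bottom and the body: the stress is
divergence free, and on the bottom its vertical component is a pressure. -/
lemma IsSolution.stress_balance (ht : t ∈ I) {χ : ℝ × ℝ → ℝ} {κ : E3 → ℝ} (hκ : ContDiff ℝ 1 κ)
    (hκχ : ∀ u, κ (graphPoint (M.η t) u) = χ u)
    (hκ1 : ∀ x ∈ frontier (bodyAt B M t), κ x = 1) {K : Set E3} (hK : IsCompact K)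
    (hκK : ∀ x ∈ closedFluid B M t, x ∉ K → κ x = 0) (a b : E3) :
    (∫ u, χ u * inner ℝ (stress a b (M.Φ t) (graphPoint (M.η t) u)) (graphNormalVec (M.η t) u))
        - bodyS B M t (fun r n => inner ℝ (stress a b (M.Φ t) r) n)
      = (∫ x in fluid B M t, fderiv ℝ κ x (stress a b (M.Φ t) x))
        - bottomIntegral M.bottom (fun x => κ x * (‖vel M t x‖ ^ 2 / 2 * killing a b x 2)) := by
  have hX : ∀ x ∈ closedFluid B M t, ContDiffAt ℝ 1 (fun x => κ x • stress a b (M.Φ t) x) x :=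
    fun x hx => hκ.contDiffAt.smul (contDiffAt_stress a b (hS.contDiffAt_Φ_space ht hx))
  have h := hS.setIntegral_fluid_div ht hK hX fun x hx hxK => by rw [hκK x hx hxK, zero_smul]
  have e1 : ∫ x in fluid B M t, div (fun x => κ x • stress a b (M.Φ t) x) x
      = ∫ x in fluid B M t, fderiv ℝ κ x (stress a b (M.Φ t) x) := by
    refine setIntegral_congr_fun (hS.isOpen_fluid ht).measurableSet fun x hx => ?_
    have h1 := hS.contDiffAt_Φ_space ht (fluid_subset_closedFluid hx)
    rw [div_smul (hκ.differentiable one_ne_zero x)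
      ((contDiffAt_stress a b h1).differentiableAt one_ne_zero),
      div_stress a b h1 (hS.laplace t ht x hx), mul_zero, zero_add]
  -- On the bottom `∂Φ/∂z = 0`, which leaves the second term of the stress.
  have e2 : bottomIntegral M.bottom (fun x => (κ x • stress a b (M.Φ t) x) 2)
      = -bottomIntegral M.bottom (fun x => κ x * (‖vel M t x‖ ^ 2 / 2 * killing a b x 2)) := by
    have e3 : bottomIntegral M.bottom (fun x => (κ x • stress a b (M.Φ t) x) 2)
        = bottomIntegral M.bottom
            (fun x => -(κ x * (‖vel M t x‖ ^ 2 / 2 * killing a b x 2))) := by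
      refine bottomIntegral_congr fun x hx => ?_
      have h1 := hS.bottom_condition t ht x hx
      rw [inner_kvec] at h1
      simp only [stress]
      have h2 : gradient (M.Φ t) x 2 = 0 := h1
      have h3 : ‖gradient (M.Φ t) x‖ = ‖vel M t x‖ := rfl
      simp [h2, h3]
    rw [e3]
    generalize M.bottom = h
    induction h with
    | bot => simp
    | coe h => simp [integral_neg]
  have e3 : bodyS B M t (fun r n => inner ℝ (κ r • stress a b (M.Φ t) r) n)
      = bodyS B M t (fun r n => inner ℝ (stress a b (M.Φ t) r) n) := bodyS_congr fun r n hn => by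
    rw [hκ1 r hn.mem_frontier, one_smul]
  rw [e1, e2, e3] at h
  simp only [hκχ, real_inner_smul_left] at h
  linarith

/-- The momentum of the system in the direction of a rigid velocity field, with a cutoff on the free
surface and the potential transferred to the surface of the body. -/
def cutMomentum (P : Params) (B : RigidBody) (M : Motion) (χ : ℝ × ℝ → ℝ) (a b : E3) (t : ℝ) : ℝ :=
  P.ρf * (surfaceFlux M χ a b t - bodyFlux B M a b t)
    + (inner ℝ (bodyLinear P B M t) a + inner ℝ (bodyAngular P B M t) b)

/-- The displaced mass and its first moments, with a cutoff. -/
def elevationMoment (P : Params) (M : Motion) (χ : ℝ × ℝ → ℝ) (a b : E3) (t : ℝ) : ℝ :=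
  ∫ u, χ u * ((P.η₀ - M.η t u) * killing a b (point u 0) 2)

/-- The terms in the balance of momentum which contain derivatives of the cutoff. -/
def momentumError (P : Params) (B : RigidBody) (M : Motion) (χ : ℝ × ℝ → ℝ) (κ : E3 → ℝ)
    (a b : E3) (t : ℝ) : ℝ :=
  P.g * ((1 / 6) * (∫ u, fderiv ℝ χ u (b 1, -b 0) * (M.η t u - P.η₀) ^ 3)
      - (1 / 2) * ∫ u, fderiv ℝ χ u (horiz (killing a b (graphPoint (M.η t) u)))
          * (M.η t u - P.η₀) ^ 2)
    + (∫ u, fderiv ℝ χ u (horiz (killing a b (graphPoint (M.η t) u)))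
        * (M.Φ t (graphPoint (M.η t) u)
          * inner ℝ (vel M t (graphPoint (M.η t) u)) (graphNormalVec (M.η t) u)))
    + ∫ x in fluid B M t, fderiv ℝ κ x (stress a b (M.Φ t) x)

/-- The balance of momentum with a cutoff. The pressure on the body cancels between Newton's law and
the flux through its surface; the stress is then the same on the free surface and on the body, up to
the pressure on the bottom and the terms due to the cutoff. What is left is hydrostatic. -/
theorem IsSolution.hasDerivAt_cutMomentum (hI : IsOpen I) (ht : t ∈ I) {χ : ℝ × ℝ → ℝ}
    (hχ : ContDiff ℝ 1 χ) (hc : HasCompactSupport χ) {κ : E3 → ℝ} (hκ : ContDiff ℝ 1 κ)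
    (hκχ : ∀ u, κ (graphPoint (M.η t) u) = χ u)
    (hκ1 : ∀ x ∈ frontier (bodyAt B M t), κ x = 1) {K : Set E3} (hK : IsCompact K)
    (hκK : ∀ x ∈ closedFluid B M t, x ∉ K → κ x = 0) (a b : E3) :
    HasDerivAt (cutMomentum P B M χ a b)
      (P.ρf * (P.g * elevationMoment P M χ a b t + momentumError P B M χ κ a b t
          - bottomIntegral M.bottom (fun x => κ x * (‖vel M t x‖ ^ 2 / 2 * killing a b x 2)))
        + (P.ρf - P.ρb) * P.g * B.vol * killing a b (M.c t) 2) t := by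
  have hη := hS.contDiff_one_η ht
  have hgp := continuous_graphPoint hη
  have hvc := hS.continuous_vel_comp ht hgp (hS.graphPoint_mem ht)
  have hkc := (continuous_killing a b).comp hgp
  have hNc := continuous_graphNormalVec hη
  refine ((((hS.hasDerivAt_surfaceFlux hI ht hχ hc a b).sub
    (hS.hasDerivAt_bodyFlux hI ht a b)).const_mul P.ρf).add
    (hS.hasDerivAt_bodyMomentum hI ht a b)).congr_deriv ?_
  have hb := hS.bodyS_bernoulli hI ht a b
  have hs := hS.stress_balance ht hκ hκχ hκ1 hK hκK a b
  have hh := integral_hydrostatic hη hχ hc P.η₀ a b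
  have hpt : ∀ u, χ u * (potRate M t (graphPoint (M.η t) u)
          * inner ℝ (killing a b (graphPoint (M.η t) u)) (graphNormalVec (M.η t) u)
        + inner ℝ (vel M t (graphPoint (M.η t) u)) (killing a b (graphPoint (M.η t) u))
          * inner ℝ (vel M t (graphPoint (M.η t) u)) (graphNormalVec (M.η t) u))
      = P.g * (χ u * ((P.η₀ - M.η t u)
          * inner ℝ (killing a b (graphPoint (M.η t) u)) (graphNormalVec (M.η t) u)))
        + χ u * inner ℝ (stress a b (M.Φ t) (graphPoint (M.η t) u)) (graphNormalVec (M.η t) u) := by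
    intro u
    have h1 := hS.dynamic t ht u
    have h2 : potRate M t (graphPoint (M.η t) u)
        = P.g * (P.η₀ - M.η t u) - ‖vel M t (graphPoint (M.η t) u)‖ ^ 2 / 2 := by
      rw [pressure] at h1
      have h3 : graphPoint (M.η t) u 2 = M.η t u := by simp [graphPoint]
      rw [h3] at h1
      have h4 : P.ρf * (potRate M t (graphPoint (M.η t) u)
        - (P.g * (P.η₀ - M.η t u) - ‖vel M t (graphPoint (M.η t) u)‖ ^ 2 / 2)) = 0 := by linarith
      have h5 := (mul_eq_zero.1 h4).resolve_left P.ρf_pos.ne'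
      linarith
    rw [h2, stress, inner_sub_left, real_inner_smul_left, real_inner_smul_left]
    simp only [vel]
    ring
  simp_rw [hpt]
  have j1 : Integrable fun u => P.g * (χ u * ((P.η₀ - M.η t u)
          * inner ℝ (killing a b (graphPoint (M.η t) u)) (graphNormalVec (M.η t) u))) :=
    (continuous_const.mul (hχ.continuous.mul ((continuous_const.sub hη.continuous).mul
      (hkc.inner (𝕜 := ℝ) hNc)))).integrable_of_hasCompactSupport hc.mul_right.mul_left
  have hstc : Continuous fun u => stress a b (M.Φ t) (graphPoint (M.η t) u) := by
    rw [continuous_iff_continuousAt]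
    intro u
    exact ContinuousAt.comp (g := stress a b (M.Φ t))
      (contDiffAt_stress a b (hS.contDiffAt_Φ_space ht (hS.graphPoint_mem ht u))).continuousAt
      hgp.continuousAt
  have j2 : Integrable fun u => χ u
      * inner ℝ (stress a b (M.Φ t) (graphPoint (M.η t) u)) (graphNormalVec (M.η t) u) :=
    (hχ.continuous.mul (hstc.inner (𝕜 := ℝ) hNc)).integrable_of_hasCompactSupport hc.mul_right
  rw [integral_add j1 j2, integral_const_mul, hh, mul_sub, mul_add, hb]
  simp only [momentumError, elevationMoment]
  linear_combination P.ρf * hs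

/-- The rate of change of the displaced mass and of its moments, with a cutoff: for a harmonic
potential `Φ` and an affine function `β` of the horizontal coordinates, with gradient `w`, the field
`β ∇Φ - Φ w` is divergence free. -/
theorem IsSolution.hasDerivAt_elevationMoment (hI : IsOpen I) (ht : t ∈ I) {χ : ℝ × ℝ → ℝ}
    (hχ : ContDiff ℝ 1 χ) (hc : HasCompactSupport χ) {κ : E3 → ℝ} (hκ : ContDiff ℝ 1 κ)
    (hκχ : ∀ u, κ (graphPoint (M.η t) u) = χ u)
    (hκ1 : ∀ x ∈ frontier (bodyAt B M t), κ x = 1) {K : Set E3} (hK : IsCompact K)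
    (hκK : ∀ x ∈ closedFluid B M t, x ∉ K → κ x = 0) (a b : E3) :
    HasDerivAt (elevationMoment P M χ a b)
      (-((∫ x in fluid B M t, (killing a b x 2 * fderiv ℝ κ x (vel M t x)
            - M.Φ t x * fderiv ℝ κ x (cross kvec b)))
          + (surfaceFlux M χ (cross kvec b) 0 t - bodyFlux B M (cross kvec b) 0 t)
          + ∫ x in bodyAt B M t, inner ℝ (cross kvec b) (bodyVel M t x))) t := by
  have hη := hS.contDiff_one_η ht
  have hIn := hI.mem_nhds ht
  have hβc : Continuous fun u : ℝ × ℝ => killing a b (point u 0) 2 := by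
    simp only [killing_two, point_one, point_zero]
    fun_prop
  set w := cross kvec b with hw
  have hw2 : w 2 = 0 := by simp [hw, cross_apply_two, kvec]
  have hder : HasDerivAt (elevationMoment P M χ a b)
      (∫ u in tsupport χ, χ u * (-deriv (fun s => M.η s u) t * killing a b (point u 0) 2)) t := by
    have e : elevationMoment P M χ a b = fun s => ∫ u in tsupport χ,
        χ u * ((P.η₀ - M.η s u) * killing a b (point u 0) 2) := by
      funext s
      rw [setIntegral_eq_integral_of_forall_compl_eq_zero
        (fun u hu => by rw [image_eq_zero_of_notMem_tsupport hu, zero_mul]), elevationMoment]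
    rw [e]
    refine hasDerivAt_setIntegral
      (F := fun s u => χ u * ((P.η₀ - M.η s u) * killing a b (point u 0) 2))
      (F' := fun s u => χ u * (-deriv (fun s => M.η s u) s * killing a b (point u 0) 2)) hc hIn
      ?_ ?_ ?_
    · intro s hs
      have := (hS.contDiff_η hs).continuous
      exact (hχ.continuous.mul ((continuous_const.sub this).mul hβc)).continuousOn
    · intro s hs u _
      have h1 := hasDerivAt_slice ((hS.contDiffAt_η s hs u).differentiableAt two_ne_zero)
      exact ((h1.differentiableAt.hasDerivAt.const_sub P.η₀).mul_const _).const_mul _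
    · rintro ⟨s, u⟩ ⟨hs, _⟩
      have h2 : ContinuousAt (fun q : ℝ × (ℝ × ℝ) => deriv (fun s => M.η s q.2) q.1) (s, u) := by
        have h3 := ((hS.contDiffAt_η s hs u).fderiv_right (m := 1)
          (by simp [one_add_one_eq_two])).continuousAt
        refine (h3.clm_apply (continuousAt_const (y := ((1 : ℝ), (0 : ℝ × ℝ))))).congr ?_
        filter_upwards [(hI.prod isOpen_univ).mem_nhds ⟨hs, mem_univ u⟩] with q hq
        exact (deriv_slice (Ψ := fun q : ℝ × (ℝ × ℝ) => M.η q.1 q.2)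
          ((hS.contDiffAt_η q.1 hq.1 q.2).differentiableAt two_ne_zero)).symm
      exact ((hχ.continuous.comp continuous_snd).continuousAt.mul
        (h2.neg.mul (hβc.comp continuous_snd).continuousAt)).continuousWithinAt
  refine hder.congr_deriv ?_
  rw [setIntegral_eq_integral_of_forall_compl_eq_zero
    (fun u hu => by rw [image_eq_zero_of_notMem_tsupport hu, zero_mul])]
  have hβd : ∀ x, HasFDerivAt (fun x : E3 => killing a b x 2)
      ((EuclideanSpace.proj (𝕜 := ℝ) (2 : Fin 3)).comp (crossB b)) x := fun x =>
    (EuclideanSpace.proj (𝕜 := ℝ) (2 : Fin 3)).hasFDerivAt.comp x (hasFDerivAt_killing a b x)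
  have hβ : ContDiff ℝ 1 (fun x : E3 => killing a b x 2) :=
    (contDiff_coord 2).comp (contDiff_killing a b)
  have hX : ∀ x ∈ closedFluid B M t, ContDiffAt ℝ 1 (fun x => (κ x * killing a b x 2) • vel M t x
      - (κ x * M.Φ t x) • killing w 0 x) x := by
    intro x hx
    have h1 := hS.contDiffAt_Φ_space ht hx
    exact ((hκ.mul hβ).contDiffAt.smul (contDiffAt_one_gradient h1)).sub
      ((hκ.contDiffAt.mul (h1.of_le one_le_two)).smul (contDiff_killing w 0).contDiffAt)
  have h := hS.setIntegral_fluid_div ht hK hX fun x hx hxK => by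
    rw [hκK x hx hxK, zero_mul, zero_mul, zero_smul, zero_smul, sub_zero]
  have e1 : ∫ x in fluid B M t, div (fun x => (κ x * killing a b x 2) • vel M t x
        - (κ x * M.Φ t x) • killing w 0 x) x
      = ∫ x in fluid B M t, (killing a b x 2 * fderiv ℝ κ x (vel M t x)
        - M.Φ t x * fderiv ℝ κ x w) := by
    refine setIntegral_congr_fun (hS.isOpen_fluid ht).measurableSet fun x hx => ?_
    have h1 := hS.contDiffAt_Φ_space ht (fluid_subset_closedFluid hx)
    have hκ' := (hκ.differentiable one_ne_zero x).hasFDerivAt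
    have hΦ' := (h1.differentiableAt two_ne_zero).hasFDerivAt
    have hv : DifferentiableAt ℝ (vel M t) x :=
      (contDiffAt_one_gradient h1).differentiableAt one_ne_zero
    have hkβ := hκ'.fun_mul (hβd x)
    have hkΦ := hκ'.fun_mul hΦ'
    have hlap : div (vel M t) x = 0 := by
      rw [show vel M t = gradient (M.Φ t) from rfl, div_gradient h1, hS.laplace t ht x hx]
    have hk0 : killing w 0 x = w := by simp [killing, cross]
    simp only
    rw [div_sub (hkβ.differentiableAt.fun_smul hv)
      (hkΦ.differentiableAt.fun_smul (differentiable_killing w 0 x)),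
      div_smul hkβ.differentiableAt hv, div_smul_killing _ _ hkΦ.differentiableAt, hlap,
      hkβ.fderiv, hkΦ.fderiv, hk0]
    simp only [add_apply, smul_apply,
      ContinuousLinearMap.comp_apply, smul_eq_mul, crossB_apply]
    rw [fderiv_eq_inner (M.Φ t), inner_eq_sum, cross_apply_two]
    simp [hw, cross_apply_zero, cross_apply_one, cross_apply_two, kvec, vel]
    ring
  have hk2 : ∀ x, killing w 0 x 2 = 0 := fun x => by simp [killing_two, hw2]
  have e2 : bottomIntegral M.bottom (fun x => ((κ x * killing a b x 2) • vel M t x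
      - (κ x * M.Φ t x) • killing w 0 x) 2) = 0 := by
    have e3 : bottomIntegral M.bottom (fun x => ((κ x * killing a b x 2) • vel M t x
        - (κ x * M.Φ t x) • killing w 0 x) 2) = bottomIntegral M.bottom (fun _ => 0) := by
      refine bottomIntegral_congr fun x hx => ?_
      have h1 := hS.bottom_condition t ht x hx
      rw [inner_kvec] at h1
      simp [h1, hk2]
    rw [e3]
    generalize M.bottom = h
    induction h with
    | bot => simp
    | coe h => simp
  obtain ⟨f, q, hf, hq, hfq⟩ := hS.exists_extension_at hI ht
  obtain ⟨Ψ, J, hJ, hJI, hΨ, heq⟩ := hS.exists_extension hI ht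
  have htJ := mem_of_mem_nhds hJ
  have hΨc : Continuous fun x => Ψ (t, x) := by
    rw [continuous_iff_continuousAt]
    exact fun x => ContinuousAt.comp (g := Ψ) (hΨ t htJ x).continuousAt (by fun_prop)
  have hbv : ContDiff ℝ 1 (bodyVel M t) := by
    rw [bodyVel_eq_killing]
    exact contDiff_killing _ _
  have c1 : Continuous fun p : E3 × E3 => killing a b p.1 2 * inner ℝ (bodyVel M t p.1) p.2 :=
    (hβ.continuous.comp continuous_fst).mul
      ((hbv.continuous.comp continuous_fst).inner continuous_snd)
  have c2 : Continuous fun p : E3 × E3 => (-1) * (Ψ (t, p.1) * inner ℝ (killing w 0 p.1) p.2) :=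
    continuous_const.mul ((hΨc.comp continuous_fst).mul (continuous_inner_killing w 0))
  have e3 : bodyS B M t (fun r n => inner ℝ ((κ r * killing a b r 2) • vel M t r
        - (κ r * M.Φ t r) • killing w 0 r) n)
      = (∫ x in bodyAt B M t, inner ℝ w (bodyVel M t x)) - bodyFlux B M w 0 t := by
    have h1 : bodyS B M t (fun r n => inner ℝ ((κ r * killing a b r 2) • vel M t r
          - (κ r * M.Φ t r) • killing w 0 r) n)
        = bodyS B M t (fun r n => killing a b r 2 * inner ℝ (bodyVel M t r) n
          + (-1) * (Ψ (t, r) * inner ℝ (killing w 0 r) n)) := bodyS_congr fun r n hn => by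
      have h3 : inner ℝ (vel M t r) n = inner ℝ (bodyVel M t r) n := by
        obtain ⟨l, m, hl, rfl, rfl⟩ := hn
        exact hS.body_condition t ht l m hl
      have h4 : M.Φ t r = Ψ (t, r) := (heq t htJ r hn.mem_frontier).self_of_nhds
      rw [hκ1 r hn.mem_frontier, inner_sub_left, real_inner_smul_left, real_inner_smul_left, h3, h4]
      ring
    have h2 : bodyFlux B M w 0 t = bodyS B M t (fun r n => Ψ (t, r) * inner ℝ (killing w 0 r) n) :=
      bodyS_congr fun r n hn => by
        have h4 : M.Φ t r = Ψ (t, r) := (heq t htJ r hn.mem_frontier).self_of_nhds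
        rw [h4]
    have h3 := setIntegral_bodyAt_div (B := B) (M := M) (t := t)
      (X := fun x => killing a b x 2 • bodyVel M t x) (hβ.smul hbv)
    simp only [real_inner_smul_left] at h3
    rw [h1, bodyS_add c1 c2, bodyS_const_mul, h2, ← h3]
    have h4 : ∀ x, div (fun x => killing a b x 2 • bodyVel M t x) x
        = inner ℝ w (bodyVel M t x) := by
      intro x
      rw [bodyVel_eq_killing, div_smul_killing _ _ (hβd x).differentiableAt, (hβd x).fderiv]
      simp only [ContinuousLinearMap.comp_apply, crossB_apply,
        inner_eq_sum]
      simp [hw, cross_apply_zero, cross_apply_one, cross_apply_two, kvec]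
      ring
    simp_rw [h4]
    ring
  rw [e1, e2, e3] at h
  have hgp := continuous_graphPoint hη
  have hvc := hS.continuous_vel_comp ht hgp (hS.graphPoint_mem ht)
  have hΦc := hS.continuous_Φ_comp ht hgp (hS.graphPoint_mem ht)
  have hNc := continuous_graphNormalVec hη
  have j1 : Integrable fun u => χ u * (killing a b (point u 0) 2
      * inner ℝ (vel M t (graphPoint (M.η t) u)) (graphNormalVec (M.η t) u)) :=
    (hχ.continuous.mul (hβc.mul (hvc.inner (𝕜 := ℝ) hNc))).integrable_of_hasCompactSupport
      hc.mul_right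
  have j2 : Integrable fun u => χ u * (M.Φ t (graphPoint (M.η t) u)
      * inner ℝ (killing w 0 (graphPoint (M.η t) u)) (graphNormalVec (M.η t) u)) :=
    (hχ.continuous.mul (hΦc.mul (((continuous_killing w 0).comp hgp).inner (𝕜 := ℝ)
      hNc))).integrable_of_hasCompactSupport hc.mul_right
  have e4 : (∫ u, inner ℝ ((κ (graphPoint (M.η t) u) * killing a b (graphPoint (M.η t) u) 2)
        • vel M t (graphPoint (M.η t) u) - (κ (graphPoint (M.η t) u)
          * M.Φ t (graphPoint (M.η t) u)) • killing w 0 (graphPoint (M.η t) u))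
        (graphNormalVec (M.η t) u))
      = (∫ u, χ u * (killing a b (point u 0) 2
          * inner ℝ (vel M t (graphPoint (M.η t) u)) (graphNormalVec (M.η t) u)))
        - surfaceFlux M χ w 0 t := by
    rw [surfaceFlux, ← integral_sub j1 j2]
    congr 1
    funext u
    rw [inner_sub_left, real_inner_smul_left, real_inner_smul_left, hκχ]
    simp only [killing_two, graphPoint, point_one, point_zero]
    ring
  rw [e4] at h
  have e5 : ∀ u, χ u * (-deriv (fun s => M.η s u) t * killing a b (point u 0) 2)
      = -(χ u * (killing a b (point u 0) 2
          * inner ℝ (vel M t (graphPoint (M.η t) u)) (graphNormalVec (M.η t) u))) := by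
    intro u
    rw [hS.kinematic t ht u]
    ring
  simp_rw [e5]
  rw [integral_neg]
  linarith

end Balance

/-! ### Cutoff functions and averaging over discs -/

section Cutoffs

lemma isCompact_disc (R : ℝ) : IsCompact (disc R) := by
  refine Metric.isCompact_of_isClosed_isBounded ?_ ?_
  · exact isClosed_le (by fun_prop) continuous_const
  · refine (Metric.isBounded_closedBall (x := (0 : ℝ × ℝ)) (r := |R|)).subset fun u hu => ?_
    have h : u.1 ^ 2 + u.2 ^ 2 ≤ R ^ 2 := hu
    rw [mem_closedBall_zero_iff, Prod.norm_def, sup_le_iff, Real.norm_eq_abs, Real.norm_eq_abs]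
    exact ⟨sq_le_sq.1 (by nlinarith [sq_nonneg u.2]), sq_le_sq.1 (by nlinarith [sq_nonneg u.1])⟩

/-- A smooth function of the horizontal coordinates which is `1` on the unit disc and `0` outside
the disc of radius `√2`. -/
def bump (u : ℝ × ℝ) : ℝ := Real.smoothTransition (2 - (u.1 ^ 2 + u.2 ^ 2))

/-- A smooth function on space which is `1` on the unit ball and above it, and `0` far below and at
large horizontal distance. -/
def bump3 (x : E3) : ℝ := bump (horiz x) * Real.smoothTransition (2 + x 2)

/-- The horizontal cutoff of radius `R`. -/
def cut (R : ℝ) (u : ℝ × ℝ) : ℝ := bump (R⁻¹ • u)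

/-- The cutoff of radius `R` in space; near the free surface it depends on the horizontal
coordinates only. -/
def cut3 (R : ℝ) (x : E3) : ℝ := bump3 (R⁻¹ • x)

lemma contDiff_bump : ContDiff ℝ 1 bump := by
  have : ContDiff ℝ 1 fun u : ℝ × ℝ => 2 - (u.1 ^ 2 + u.2 ^ 2) := by fun_prop
  exact Real.smoothTransition.contDiff.comp this

lemma contDiff_bump3 : ContDiff ℝ 1 bump3 :=
  (contDiff_bump.comp contDiff_horiz).mul
    (Real.smoothTransition.contDiff.comp (contDiff_const.add (contDiff_coord 2)))

lemma contDiff_cut (R : ℝ) : ContDiff ℝ 1 (cut R) := contDiff_bump.comp (contDiff_const_smul _)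

lemma contDiff_cut3 (R : ℝ) : ContDiff ℝ 1 (cut3 R) := contDiff_bump3.comp (contDiff_const_smul _)

lemma cut_eq {R : ℝ} (hR : 0 < R) (u : ℝ × ℝ) :
    cut R u = Real.smoothTransition (2 - (u.1 ^ 2 + u.2 ^ 2) / R ^ 2) := by
  simp only [cut, bump, Prod.smul_fst, Prod.smul_snd, smul_eq_mul]
  congr 2
  field_simp

lemma cut3_eq (R : ℝ) (x : E3) :
    cut3 R x = cut R (horiz x) * Real.smoothTransition (2 + x 2 / R) := by
  simp only [cut3, bump3, cut, horiz, PiLp.smul_apply, smul_eq_mul, Prod.smul_mk, div_eq_inv_mul]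

lemma cut_nonneg (R : ℝ) (u : ℝ × ℝ) : 0 ≤ cut R u := Real.smoothTransition.nonneg _

lemma cut_le_one (R : ℝ) (u : ℝ × ℝ) : cut R u ≤ 1 := Real.smoothTransition.le_one _

lemma cut_eq_one {R : ℝ} (hR : 0 < R) {u : ℝ × ℝ} (hu : u.1 ^ 2 + u.2 ^ 2 ≤ R ^ 2) :
    cut R u = 1 := by
  rw [cut_eq hR]
  refine Real.smoothTransition.one_of_one_le ?_
  have : (u.1 ^ 2 + u.2 ^ 2) / R ^ 2 ≤ 1 := (div_le_one (by positivity)).2 hu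
  linarith

lemma cut_eq_zero {R : ℝ} (hR : 0 < R) {u : ℝ × ℝ} (hu : 2 * R ^ 2 ≤ u.1 ^ 2 + u.2 ^ 2) :
    cut R u = 0 := by
  rw [cut_eq hR]
  refine Real.smoothTransition.zero_of_nonpos ?_
  have : 2 ≤ (u.1 ^ 2 + u.2 ^ 2) / R ^ 2 := (le_div_iff₀ (by positivity)).2 hu
  linarith

lemma hasCompactSupport_cut {R : ℝ} (hR : 0 < R) : HasCompactSupport (cut R) := by
  refine HasCompactSupport.intro (isCompact_disc (2 * R)) fun u hu => cut_eq_zero hR ?_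
  have : (2 * R) ^ 2 < u.1 ^ 2 + u.2 ^ 2 := not_le.1 hu
  nlinarith [sq_nonneg R]

lemma fderiv_cut_eq_zero_of_lt {R : ℝ} (hR : 0 < R) {u : ℝ × ℝ} (hu : u.1 ^ 2 + u.2 ^ 2 < R ^ 2) :
    fderiv ℝ (cut R) u = 0 := by
  have h : cut R =ᶠ[𝓝 u] fun _ => 1 := by
    have hc : ContinuousAt (fun u : ℝ × ℝ => u.1 ^ 2 + u.2 ^ 2) u := by fun_prop
    filter_upwards [hc.eventually (gt_mem_nhds hu)] with v hv using cut_eq_one hR hv.le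
  rw [h.fderiv_eq, fderiv_const_apply]

lemma fderiv_cut_eq_zero_of_gt {R : ℝ} (hR : 0 < R) {u : ℝ × ℝ}
    (hu : 2 * R ^ 2 < u.1 ^ 2 + u.2 ^ 2) : fderiv ℝ (cut R) u = 0 := by
  have h : cut R =ᶠ[𝓝 u] fun _ => 0 := by
    have hc : ContinuousAt (fun u : ℝ × ℝ => u.1 ^ 2 + u.2 ^ 2) u := by fun_prop
    filter_upwards [hc.eventually (lt_mem_nhds hu)] with v hv using cut_eq_zero hR hv.le
  rw [h.fderiv_eq, fderiv_const_apply]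

lemma norm_sq_eq_sum (x : E3) : ‖x‖ ^ 2 = x 0 ^ 2 + x 1 ^ 2 + x 2 ^ 2 := by
  rw [EuclideanSpace.real_norm_sq_eq, Fin.sum_univ_three]

lemma cut3_eq_one {R : ℝ} (hR : 0 < R) {x : E3} (hx : ‖x‖ ≤ R) : cut3 R x = 1 := by
  have h1 : x 0 ^ 2 + x 1 ^ 2 + x 2 ^ 2 ≤ R ^ 2 := by
    rw [← norm_sq_eq_sum]
    exact pow_le_pow_left₀ (norm_nonneg x) hx 2
  rw [cut3_eq, cut_eq_one hR, Real.smoothTransition.one_of_one_le, one_mul]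
  · have h2 : |x 2| ≤ R := 
      abs_le_of_sq_le_sq (by nlinarith [sq_nonneg (x 0), sq_nonneg (x 1)]) hR.le
    have : -1 ≤ x 2 / R := by
      rw [le_div_iff₀ hR]
      linarith [(abs_le.1 h2).1]
    linarith
  · simp only [horiz]
    nlinarith [sq_nonneg (x 2)]

lemma cut3_eq_cut {R : ℝ} (hR : 0 < R) {u : ℝ × ℝ} {z : ℝ} (hz : -R ≤ z) :
    cut3 R (point u z) = cut R u := by
  rw [cut3_eq, Real.smoothTransition.one_of_one_le, mul_one, horiz_point]
  have : -1 ≤ z / R := by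
    rw [le_div_iff₀ hR]
    linarith
  rw [point_two]
  linarith

lemma cut3_eq_zero_of_horiz {R : ℝ} (hR : 0 < R) {x : E3} (hx : 2 * R ^ 2 ≤ x 0 ^ 2 + x 1 ^ 2) :
    cut3 R x = 0 := by
  rw [cut3_eq, cut_eq_zero hR hx, zero_mul]

lemma cut3_eq_zero_of_below {R : ℝ} (hR : 0 < R) {x : E3} (hx : x 2 ≤ -(2 * R)) : cut3 R x = 0 := by
  rw [cut3_eq, Real.smoothTransition.zero_of_nonpos, mul_zero]
  have : x 2 / R ≤ -2 := by
    rw [div_le_iff₀ hR]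
    linarith
  linarith

lemma fderiv_cut3_eq_zero {R : ℝ} (hR : 0 < R) {x : E3}
    (hx : ‖x‖ < R ∨ 2 * R ^ 2 < x 0 ^ 2 + x 1 ^ 2 ∨ x 2 < -(2 * R)) : fderiv ℝ (cut3 R) x = 0 := by
  have hco : ∀ i, ContinuousAt (fun x : E3 => x i) x := fun i =>
    (contDiff_coord (n := 0) i).continuous.continuousAt
  have : (cut3 R =ᶠ[𝓝 x] fun _ => 1) ∨ (cut3 R =ᶠ[𝓝 x] fun _ => 0) := by
    rcases hx with hx | hx | hx
    · left
      filter_upwards [continuous_norm.continuousAt.eventually (gt_mem_nhds hx)] with y hy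
        using cut3_eq_one hR hy.le
    · right
      filter_upwards [(((hco 0).pow 2).add ((hco 1).pow 2)).eventually (lt_mem_nhds hx)] with y hy
        using cut3_eq_zero_of_horiz hR hy.le
    · right
      filter_upwards [(hco 2).eventually (gt_mem_nhds hx)] with y hy
        using cut3_eq_zero_of_below hR hy.le
  rcases this with h | h <;> rw [h.fderiv_eq, fderiv_const_apply]

lemma norm_fderiv_comp_inv_smul {V : Type*} [NormedAddCommGroup V] [NormedSpace ℝ V] {f : V → ℝ}
    (hf : ContDiff ℝ 1 f) {C R : ℝ} (hR : 0 < R) (h : ∀ x, ‖fderiv ℝ f x‖ ≤ C) (x : V) :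
    ‖fderiv ℝ (fun y => f (R⁻¹ • y)) x‖ ≤ C / R := by
  have h1 : HasFDerivAt (fun y => f (R⁻¹ • y))
      ((fderiv ℝ f (R⁻¹ • x)).comp (R⁻¹ • ContinuousLinearMap.id ℝ V)) x :=
    ((hf.differentiable one_ne_zero (R⁻¹ • x)).hasFDerivAt).comp x
      ((hasFDerivAt_id x).const_smul R⁻¹)
  rw [h1.fderiv, ContinuousLinearMap.comp_smul, ContinuousLinearMap.comp_id, norm_smul, norm_inv,
    Real.norm_of_nonneg hR.le, div_eq_inv_mul]
  exact mul_le_mul_of_nonneg_left (h _) (inv_nonneg.2 hR.le)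

/-- The derivatives of the cutoffs of radius `R` are of order `1 / R`. -/
lemma exists_norm_fderiv_cut_le :
    ∃ C : ℝ, 0 ≤ C ∧ ∀ R, 0 < R → (∀ u, ‖fderiv ℝ (cut R) u‖ ≤ C / R) ∧
      ∀ x, ‖fderiv ℝ (cut3 R) x‖ ≤ C / R := by
  have hbump : HasCompactSupport bump := by
    have := hasCompactSupport_cut one_pos
    rwa [show cut 1 = bump from funext fun u => by simp [cut]] at this
  obtain ⟨C₁, h₁⟩ := (contDiff_bump.continuous_fderiv one_ne_zero).bounded_above_of_compact_support
    (hbump.fderiv (𝕜 := ℝ))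
  have hτ : ContDiff ℝ 1 fun s : ℝ => Real.smoothTransition (2 + s) :=
    Real.smoothTransition.contDiff.comp (contDiff_const.add contDiff_id)
  have hτs : HasCompactSupport (fderiv ℝ fun s : ℝ => Real.smoothTransition (2 + s)) := by
    refine HasCompactSupport.intro (isCompact_Icc (a := -2) (b := -1)) fun s hs => ?_
    have : ((fun s : ℝ => Real.smoothTransition (2 + s)) =ᶠ[𝓝 s] fun _ => 0) ∨
        ((fun s : ℝ => Real.smoothTransition (2 + s)) =ᶠ[𝓝 s] fun _ => 1) := by
      rcases lt_or_ge s (-2) with h | h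
      · left
        filter_upwards [gt_mem_nhds h] with r hr
        exact Real.smoothTransition.zero_of_nonpos (by linarith)
      · right
        have h' : -1 < s := by
          by_contra h2
          exact hs ⟨h, not_lt.1 h2⟩
        filter_upwards [lt_mem_nhds h'] with r hr
        exact Real.smoothTransition.one_of_one_le (by linarith)
    rcases this with h | h <;> rw [h.fderiv_eq, fderiv_const_apply]
  obtain ⟨C₂, h₂⟩ := (hτ.continuous_fderiv one_ne_zero).bounded_above_of_compact_support hτs
  have hhor : ∃ C, ∀ x v : E3, ‖fderiv ℝ bump3 x v‖ ≤ C * ‖v‖ := by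
    have hlin : ∃ L : E3 →L[ℝ] (ℝ × ℝ), ∀ x, L x = horiz x :=
      ⟨(EuclideanSpace.proj (𝕜 := ℝ) (0 : Fin 3)).prod (EuclideanSpace.proj (𝕜 := ℝ) (1 : Fin 3)),
        fun x => rfl⟩
    obtain ⟨L, hL⟩ := hlin
    refine ⟨C₁ * ‖L‖ + C₂, fun x v => ?_⟩
    have d1 : HasFDerivAt (fun x : E3 => bump (horiz x)) ((fderiv ℝ bump (horiz x)).comp L) x := by
      have h := (contDiff_bump.differentiable one_ne_zero (L x)).hasFDerivAt.comp x L.hasFDerivAt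
      simpa only [Function.comp_def, hL] using h
    have d2 : HasFDerivAt (fun x : E3 => Real.smoothTransition (2 + x 2))
        ((fderiv ℝ (fun s : ℝ => Real.smoothTransition (2 + s)) (x 2)).comp
          (EuclideanSpace.proj (𝕜 := ℝ) (2 : Fin 3))) x :=
      HasFDerivAt.comp (g := fun s : ℝ => Real.smoothTransition (2 + s)) x
        (hτ.differentiable one_ne_zero (x 2)).hasFDerivAt
        (EuclideanSpace.proj (𝕜 := ℝ) (2 : Fin 3)).hasFDerivAt
    have d3 : HasFDerivAt bump3 _ x := d1.fun_mul d2
    rw [d3.fderiv]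
    have e : (bump (horiz x) • (fderiv ℝ (fun s : ℝ => Real.smoothTransition (2 + s)) (x 2)).comp
          (EuclideanSpace.proj (𝕜 := ℝ) (2 : Fin 3))
        + Real.smoothTransition (2 + x 2) • (fderiv ℝ bump (horiz x)).comp L) v
        = bump (horiz x) * fderiv ℝ (fun s : ℝ => Real.smoothTransition (2 + s)) (x 2) (v 2)
          + Real.smoothTransition (2 + x 2) * fderiv ℝ bump (horiz x) (L v) := rfl
    rw [e]
    have b1 : ‖fderiv ℝ (fun s : ℝ => Real.smoothTransition (2 + s)) (x 2) (v 2)‖ ≤ C₂ * ‖v‖ :=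
      ((fderiv ℝ (fun s : ℝ => Real.smoothTransition (2 + s)) (x 2)).le_opNorm _).trans
        (mul_le_mul (h₂ _) (PiLp.norm_apply_le v 2) (norm_nonneg _)
          ((norm_nonneg _).trans (h₂ 0)))
    have b2 : ‖fderiv ℝ bump (horiz x) (L v)‖ ≤ C₁ * (‖L‖ * ‖v‖) :=
      ((fderiv ℝ bump (horiz x)).le_opNorm _).trans
        (mul_le_mul (h₁ _) (L.le_opNorm v) (norm_nonneg _) ((norm_nonneg _).trans (h₁ 0)))
    have a1 : ∀ y, ‖Real.smoothTransition y‖ ≤ 1 := fun y => by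
      rw [Real.norm_of_nonneg (Real.smoothTransition.nonneg y)]
      exact Real.smoothTransition.le_one y
    calc _ ≤ 1 * (C₂ * ‖v‖) + 1 * (C₁ * (‖L‖ * ‖v‖)) := by
          refine (norm_add_le _ _).trans (add_le_add ?_ ?_) <;> rw [norm_mul]
          · exact mul_le_mul (a1 _) b1 (norm_nonneg _) zero_le_one
          · exact mul_le_mul (a1 _) b2 (norm_nonneg _) zero_le_one
      _ = _ := by ring
  obtain ⟨C₃, h₃⟩ := hhor
  refine ⟨max C₁ (max C₃ 0), le_max_of_le_right (le_max_right _ _),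
    fun R hR => ⟨fun u => ?_, fun x => ?_⟩⟩
  · exact norm_fderiv_comp_inv_smul contDiff_bump hR (fun u => (h₁ u).trans (le_max_left _ _)) u
  · exact norm_fderiv_comp_inv_smul contDiff_bump3 hR (fun y =>
      ContinuousLinearMap.opNorm_le_bound _ (le_max_of_le_right (le_max_right _ _)) fun v =>
        (h₃ y v).trans (mul_le_mul_of_nonneg_right
          (le_max_of_le_right (le_max_left _ _)) (norm_nonneg v))) x

/-- The smooth transition as an integral of its derivative over a part of the unit interval, valid
for arguments outside of that interval as well. -/
lemma setIntegral_deriv_smoothTransition (y : ℝ) :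
    ∫ s in Icc 0 1 ∩ Iic y, deriv Real.smoothTransition s = Real.smoothTransition y := by
  have hT : ContDiff ℝ 1 Real.smoothTransition := Real.smoothTransition.contDiff
  have hint : ∀ b, 0 ≤ b → ∫ s in Icc 0 b, deriv Real.smoothTransition s
      = Real.smoothTransition b := by
    intro b hb
    rw [integral_Icc_eq_integral_Ioc, ← intervalIntegral.integral_of_le hb,
      intervalIntegral.integral_deriv_eq_sub
        (fun s _ => hT.differentiable one_ne_zero s)
        ((hT.continuous_deriv le_rfl).intervalIntegrable _ _), Real.smoothTransition.zero, sub_zero]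
  rcases lt_or_ge y 0 with h | h
  · have : Icc (0 : ℝ) 1 ∩ Iic y = ∅ := by
      ext s
      simp only [mem_inter_iff, mem_Icc, mem_Iic, mem_empty_iff_false, iff_false]
      rintro ⟨⟨h1, _⟩, h2⟩
      linarith
    rw [this, setIntegral_empty, Real.smoothTransition.zero_of_nonpos h.le]
  · have : Icc (0 : ℝ) 1 ∩ Iic y = Icc 0 (min 1 y) := by
      ext s
      simp only [mem_inter_iff, mem_Icc, mem_Iic, le_min_iff]
      tauto
    rw [this, hint _ (le_min zero_le_one h)]
    rcases le_total 1 y with h1 | h1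
    · rw [min_eq_left h1, Real.smoothTransition.one, Real.smoothTransition.one_of_one_le h1]
    · rw [min_eq_right h1]

/-- An integral with the smooth cutoff is an average of integrals over discs. -/
lemma integral_cut_eq {f : ℝ × ℝ → ℝ} (hf : Continuous f) {R : ℝ} (hR : 0 < R) :
    IntegrableOn (fun s => deriv Real.smoothTransition s
        * ∫ u in disc (Real.sqrt (2 - s) * R), f u) (Icc 0 1) ∧
      ∫ u, cut R u * f u
        = ∫ s in Icc (0 : ℝ) 1, deriv Real.smoothTransition s
            * ∫ u in disc (Real.sqrt (2 - s) * R), f u := by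
  -- With `T` the smooth transition, `cut R u = T (2 - |u|² / R²)` is the integral of `T'` over the
  -- section of `S` at `u`, and the section of `S` at `s` is the disc of radius `√(2 - s) R ≥ R`.
  set S : Set ((ℝ × ℝ) × ℝ) := {p | p.2 ∈ Icc (0 : ℝ) 1 ∩ Iic (2 - (p.1.1 ^ 2 + p.1.2 ^ 2) / R ^ 2)}
    with hSdef
  have hT : ContDiff ℝ 1 Real.smoothTransition := Real.smoothTransition.contDiff
  have hd := hT.continuous_deriv le_rfl
  have hclosed : IsClosed S :=
    (isClosed_Icc.preimage continuous_snd).inter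
      (isClosed_le continuous_snd (by fun_prop))
  have hmem : ∀ u : ℝ × ℝ, ∀ s ∈ Icc (0 : ℝ) 1,
      s ≤ 2 - (u.1 ^ 2 + u.2 ^ 2) / R ^ 2 ↔ u ∈ disc (Real.sqrt (2 - s) * R) := by
    intro u s hs
    have h2 : 0 ≤ 2 - s := by linarith [hs.2]
    change _ ↔ u.1 ^ 2 + u.2 ^ 2 ≤ _
    rw [mul_pow, Real.sq_sqrt h2, ← div_le_iff₀ (by positivity)]
    constructor <;> intro h <;> linarith
  have hScomp : IsCompact S := by
    refine ((isCompact_disc (Real.sqrt 2 * R)).prod (isCompact_Icc (a := (0 : ℝ))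
      (b := 1))).of_isClosed_subset hclosed ?_
    rintro ⟨u, s⟩ ⟨hs, hu⟩
    refine ⟨?_, hs⟩
    have h1 := (hmem u s hs).1 hu
    have h3 : u.1 ^ 2 + u.2 ^ 2 ≤ (Real.sqrt (2 - s) * R) ^ 2 := h1
    change u.1 ^ 2 + u.2 ^ 2 ≤ _
    rw [mul_pow, Real.sq_sqrt (by linarith [hs.2])] at h3
    rw [mul_pow, Real.sq_sqrt zero_le_two]
    nlinarith [hs.1, sq_nonneg R]
  have hint : Integrable (S.indicator fun p : (ℝ × ℝ) × ℝ =>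
      deriv Real.smoothTransition p.2 * f p.1) (volume.prod volume) :=
    (((hd.comp continuous_snd).mul (hf.comp continuous_fst)).continuousOn.integrableOn_compact
      hScomp).integrable_indicator hclosed.measurableSet
  have h := integral_integral_swap (f := fun (u : ℝ × ℝ) (s : ℝ) =>
    S.indicator (fun p : (ℝ × ℝ) × ℝ => deriv Real.smoothTransition p.2 * f p.1) (u, s)) hint
  have e1 : ∀ u, (∫ s, S.indicator (fun p : (ℝ × ℝ) × ℝ =>
      deriv Real.smoothTransition p.2 * f p.1) (u, s)) = cut R u * f u := by
    intro u
    have : (fun s => S.indicator (fun p : (ℝ × ℝ) × ℝ =>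
        deriv Real.smoothTransition p.2 * f p.1) (u, s))
        = (Icc (0 : ℝ) 1 ∩ Iic (2 - (u.1 ^ 2 + u.2 ^ 2) / R ^ 2)).indicator
          (fun s => deriv Real.smoothTransition s * f u) := rfl
    rw [this, integral_indicator (measurableSet_Icc.inter measurableSet_Iic), integral_mul_const,
      setIntegral_deriv_smoothTransition, cut_eq hR]
  have e2 : ∀ s, (∫ u, S.indicator (fun p : (ℝ × ℝ) × ℝ =>
      deriv Real.smoothTransition p.2 * f p.1) (u, s))
      = (Icc (0 : ℝ) 1).indicator (fun s => deriv Real.smoothTransition s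
          * ∫ u in disc (Real.sqrt (2 - s) * R), f u) s := by
    intro s
    by_cases hs : s ∈ Icc (0 : ℝ) 1
    · rw [indicator_of_mem hs, ← integral_const_mul,
        ← integral_indicator (isCompact_disc _).measurableSet]
      congr 1
      funext u
      by_cases hu : u ∈ disc (Real.sqrt (2 - s) * R)
      · rw [indicator_of_mem hu, indicator_of_mem]
        exact ⟨hs, (hmem u s hs).2 hu⟩
      · rw [indicator_of_notMem hu, indicator_of_notMem]
        exact fun h => hu ((hmem u s hs).1 h.2)
    · rw [indicator_of_notMem hs]
      have : ∀ u, S.indicator (fun p : (ℝ × ℝ) × ℝ =>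
          deriv Real.smoothTransition p.2 * f p.1) (u, s) = 0 := fun u =>
        indicator_of_notMem (fun h => hs h.1) _
      simp_rw [this, integral_zero]
  have hi := hint.integral_prod_right
  simp_rw [e2] at hi
  refine ⟨(integrable_indicator_iff measurableSet_Icc).1 hi, ?_⟩
  simp_rw [e1, e2] at h
  rw [h, integral_indicator measurableSet_Icc]

/-- If the integrals over discs converge, those with a smooth cutoff converge to the same limit. -/
theorem tendsto_integral_cut {f : ℝ × ℝ → ℝ} (hf : Continuous f) {J : ℝ}
    (h : Tendsto (fun R => ∫ u in disc R, f u) atTop (𝓝 J)) :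
    Tendsto (fun R => ∫ u, cut R u * f u) atTop (𝓝 J) := by
  have hT : ContDiff ℝ 1 Real.smoothTransition := Real.smoothTransition.contDiff
  have hd := hT.continuous_deriv le_rfl
  obtain ⟨C, hC⟩ := (isCompact_Icc (a := (0 : ℝ)) (b := 1)).exists_bound_of_continuousOn
    hd.continuousOn
  have hC0 : 0 ≤ C := (norm_nonneg _).trans (hC 0 (by simp))
  rw [Metric.tendsto_atTop] at h ⊢
  intro ε hε
  obtain ⟨R₀, hR₀⟩ := h (ε / (C + 1)) (by positivity)
  refine ⟨max R₀ 1, fun R hR => ?_⟩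
  have hR1 : 1 ≤ R := (le_max_right _ _).trans hR
  have hRpos : 0 < R := by linarith
  have hone : ∫ s in Icc (0 : ℝ) 1, deriv Real.smoothTransition s = 1 := by
    have := setIntegral_deriv_smoothTransition 1
    rwa [inter_eq_left.2 (fun s hs => hs.2), Real.smoothTransition.one] at this
  set G : ℝ → ℝ := fun s => ∫ u in disc (Real.sqrt (2 - s) * R), f u with hG
  have hGb : ∀ s ∈ Icc (0 : ℝ) 1, |G s - J| < ε / (C + 1) := by
    intro s hs
    have : R ≤ Real.sqrt (2 - s) * R :=
      le_mul_of_one_le_left hRpos.le (Real.one_le_sqrt.2 (by linarith [hs.2]))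
    have h2 := hR₀ (Real.sqrt (2 - s) * R) (((le_max_left _ _).trans hR).trans this)
    rwa [Real.dist_eq] at h2
  obtain ⟨hi, he⟩ := integral_cut_eq hf hRpos
  rw [he, Real.dist_eq]
  have e : (∫ s in Icc (0 : ℝ) 1, deriv Real.smoothTransition s * G s) - J
      = ∫ s in Icc (0 : ℝ) 1, deriv Real.smoothTransition s * (G s - J) := by
    have hj : IntegrableOn (fun s => deriv Real.smoothTransition s * J) (Icc 0 1) :=
      (hd.mul continuous_const).continuousOn.integrableOn_compact isCompact_Icc
    simp_rw [mul_sub]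
    rw [integral_sub hi hj, integral_mul_const, hone, one_mul]
  rw [e, ← Real.norm_eq_abs]
  have hb := norm_setIntegral_le_of_norm_le_const (μ := volume) (s := Icc (0 : ℝ) 1)
    (f := fun s => deriv Real.smoothTransition s * (G s - J)) (C := C * (ε / (C + 1)))
    isCompact_Icc.measure_lt_top fun s hs => by
      rw [norm_mul]
      exact mul_le_mul (hC s hs) (hGb s hs).le (norm_nonneg _) hC0
  refine hb.trans_lt ?_
  rw [Real.volume_real_Icc_of_le zero_le_one, sub_zero, mul_one, mul_div_assoc',
    div_lt_iff₀ (by positivity)]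
  nlinarith

end Cutoffs

/-! ### Uniform bounds in the far field -/

section Far

/-- Bounds for the motion at time `t` that are uniform in the far field: `R₁` is a radius beyond
which the bounds for `Φ`, `∇Φ` and the free surface hold, and which contains the body. -/
structure FarBounds (P : Params) (B : RigidBody) (M : Motion) (m : ℕ) (C R₁ t : ℝ) : Prop where
  one_le : 1 ≤ C
  le_radius : C ≤ R₁
  pot : ∀ x ∈ closedFluid B M t, R₁ ≤ ‖x‖ → |M.Φ t x| ≤ C / ‖x‖ ^ 2
  vel : ∀ x ∈ closedFluid B M t, R₁ ≤ ‖x‖ → ‖vel M t x‖ ≤ C / ‖x‖ ^ m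
  normal : ∀ u, u ∉ disc R₁ → ‖graphNormalVec (M.η t) u‖ ≤ C
  elev : ∀ u, u ∉ disc R₁ → |M.η t u - P.η₀| ≤ C / (u.1 ^ 2 + u.2 ^ 2)
  height : ∀ u, |M.η t u| ≤ C
  body : ∀ x ∈ bodyAt B M t, ‖x‖ ≤ R₁
  bodyV : ‖M.V t‖ ≤ C
  bodyVel : ∀ x ∈ bodyAt B M t, ‖bodyVel M t x‖ ≤ C

variable {P : Params} {B : RigidBody} {M : Motion} {I : Set ℝ} {t : ℝ} {m : ℕ}

lemma norm_sq_graphPoint_ge (ψ : ℝ × ℝ → ℝ) (u : ℝ × ℝ) :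
    u.1 ^ 2 + u.2 ^ 2 ≤ ‖graphPoint ψ u‖ ^ 2 := by
  rw [norm_sq_eq_sum, graphPoint, point_zero, point_one]
  exact le_add_of_nonneg_right (sq_nonneg _)

lemma le_norm_graphPoint (ψ : ℝ × ℝ → ℝ) {u : ℝ × ℝ} {R : ℝ} (hu : R ^ 2 ≤ u.1 ^ 2 + u.2 ^ 2) :
    R ≤ ‖graphPoint ψ u‖ :=
  le_of_sq_le_sq (hu.trans (norm_sq_graphPoint_ge ψ u)) (norm_nonneg _)

/-- The far-field bounds hold with common constants at all times close to a given one. -/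
theorem IsSolution.exists_farBounds (hS : IsSolution P B M I) (hI : IsOpen I)
    (hF : FarField P B M m I) (hm : 1 ≤ m) {t₀ : ℝ} (ht₀ : t₀ ∈ I) :
    ∃ C R₁, ∀ᶠ t in 𝓝 t₀, t ∈ I ∧ FarBounds P B M m C R₁ t := by
  obtain ⟨K, hKc, hKI, hK⟩ := exists_compact_subset hI ht₀
  have hK0 : K ∈ 𝓝 t₀ := mem_interior_iff_mem_nhds.1 hKI
  obtain ⟨C₀, R₀, hR₀, hb⟩ := hF.2 K hK hKc
  set c := max C₀ 1 with hc
  have hc1 : 1 ≤ c := le_max_right _ _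
  have hC₀c : C₀ ≤ c := le_max_left _ _
  have hg := P.g_pos
  set R := max R₀ 1 with hR
  have hR1 : 1 ≤ R := le_max_right _ _
  have hRsq : ∀ {u : ℝ × ℝ} {r : ℝ}, R ≤ r → u ∉ disc r → R ^ 2 < u.1 ^ 2 + u.2 ^ 2 := by
    intro u r hr hu
    exact lt_of_le_of_lt (pow_le_pow_left₀ (by linarith) hr 2) (not_le.1 hu)
  set c₃ := (c + c ^ 2) / P.g with hc₃
  have hc₃0 : 0 ≤ c₃ := by positivity
  -- On the free surface Bernoulli's equation bounds the elevation by `∂Φ/∂t` and `|∇Φ|²`, both of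
  -- which are of order `|x|⁻²`.
  have helev : ∀ t ∈ K, ∀ u, u ∉ disc R → |M.η t u - P.η₀| ≤ c₃ / (u.1 ^ 2 + u.2 ^ 2) := by
    intro t ht u hu
    have hu' := hRsq le_rfl hu
    have hx := le_norm_graphPoint (M.η t) hu'.le
    have hx0 : R₀ ≤ ‖graphPoint (M.η t) u‖ := (le_max_left _ _).trans hx
    have hx1 : 1 ≤ ‖graphPoint (M.η t) u‖ := hR1.trans hx
    obtain ⟨-, b1, b2⟩ := (hb t ht).1 _ (hS.graphPoint_mem (hK ht) u) hx0
    set x := graphPoint (M.η t) u with hxdef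
    have hd := hS.dynamic t (hK ht) u
    rw [pressure] at hd
    have h3 : x 2 = M.η t u := by simp [hxdef, graphPoint]
    rw [← hxdef, h3] at hd
    have h4 : P.ρf * (P.g * (M.η t u - P.η₀) + (potRate M t x + ‖vel M t x‖ ^ 2 / 2)) = 0 := by
      linarith
    have h5 := (mul_eq_zero.1 h4).resolve_left P.ρf_pos.ne'
    have b1' : |potRate M t x| ≤ c / ‖x‖ ^ 2 :=
      b1.trans (div_le_div_of_nonneg_right hC₀c (by positivity))
    have b2' : ‖vel M t x‖ ≤ c / ‖x‖ := by
      refine (b2.trans (div_le_div_of_nonneg_right hC₀c (by positivity))).trans ?_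
      exact div_le_div_of_nonneg_left (by linarith) (by linarith)
        (le_self_pow₀ hx1 (by omega))
    have b3 : ‖vel M t x‖ ^ 2 ≤ c ^ 2 / ‖x‖ ^ 2 := by
      rw [← div_pow]
      exact pow_le_pow_left₀ (norm_nonneg _) b2' 2
    have b4 : P.g * |M.η t u - P.η₀| ≤ (c + c ^ 2) / ‖x‖ ^ 2 := by
      rw [← abs_of_pos hg, ← abs_mul, show P.g * (M.η t u - P.η₀)
        = -(potRate M t x + ‖vel M t x‖ ^ 2 / 2) by linarith, abs_neg, add_div]
      refine (abs_add_le _ _).trans (add_le_add b1' ?_)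
      rw [abs_of_nonneg (by positivity)]
      exact (half_le_self (sq_nonneg _)).trans b3
    have hupos : 0 < u.1 ^ 2 + u.2 ^ 2 := lt_of_le_of_lt (by positivity) hu'
    rw [hc₃, div_div, mul_comm, ← div_div, le_div_iff₀ hg, mul_comm]
    exact b4.trans (div_le_div_of_nonneg_left (by positivity) hupos (norm_sq_graphPoint_ge _ u))
  obtain ⟨H, hH⟩ := (hKc.prod (isCompact_disc R)).exists_bound_of_continuousOn
    (f := fun q : ℝ × (ℝ × ℝ) => M.η q.1 q.2) fun q hq =>
      (hS.contDiffAt_η q.1 (hK hq.1) q.2).continuousAt.continuousWithinAt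
  have hH0 : 0 ≤ H := (norm_nonneg _).trans
    (hH (t₀, 0) ⟨mem_of_mem_nhds hK0, by simp [disc]; positivity⟩)
  have hheight : ∀ t ∈ K, ∀ u, |M.η t u| ≤ |P.η₀| + c₃ + H := by
    intro t ht u
    by_cases hu : u ∈ disc R
    · have := hH (t, u) ⟨ht, hu⟩
      rw [Real.norm_eq_abs] at this
      have := abs_nonneg P.η₀
      simp only at *
      linarith
    · have h1 := helev t ht u hu
      have h2 := hRsq le_rfl hu
      have h3 : c₃ / (u.1 ^ 2 + u.2 ^ 2) ≤ c₃ := div_le_self hc₃0 (by nlinarith)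
      have h4 := abs_sub_abs_le_abs_sub (M.η t u) P.η₀
      linarith
  have hV := ((hS.continuousOn_V.continuousAt (hI.mem_nhds ht₀)).norm.eventually
    (gt_mem_nhds (lt_add_one ‖M.V t₀‖)))
  have hΩ := ((hS.continuousOn_Ω.continuousAt (hI.mem_nhds ht₀)).norm.eventually
    (gt_mem_nhds (lt_add_one ‖M.Ω t₀‖)))
  have hcc := ((hS.hasDerivAt_c t₀ ht₀).continuousAt.norm.eventually
    (gt_mem_nhds (lt_add_one ‖M.c t₀‖)))
  obtain ⟨ρ, hρ⟩ := B.isCompact_carrier.exists_bound_of_continuousOn continuousOn_id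
  have hρ' : ∀ l ∈ B.carrier, ‖l‖ ≤ |ρ| := fun l hl => (hρ l hl).trans (le_abs_self ρ)
  set v := ‖M.V t₀‖ + 1
  set o := ‖M.Ω t₀‖ + 1
  have hv0 : 0 ≤ v := by positivity
  have ho0 : 0 ≤ o := by positivity
  have hη0 := abs_nonneg P.η₀
  set C := (1 + 2 * c) + c₃ + (|P.η₀| + c₃ + H) + (v + o * |ρ|) with hC
  have hoρ : 0 ≤ o * |ρ| := by positivity
  set R₁ := C + R + (|ρ| + (‖M.c t₀‖ + 1)) with hR₁
  have hρ0 := abs_nonneg ρ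
  have hcn := norm_nonneg (M.c t₀)
  have hcC : c ≤ C := by linarith
  have hCR : C ≤ R₁ := by linarith
  have hRR : R ≤ R₁ := by linarith
  refine ⟨C, R₁, ?_⟩
  filter_upwards [hK0, hV, hΩ, hcc] with t ht hVt hΩt hct
  have hbt := hb t ht
  refine ⟨hK ht, by linarith, hCR, ?_, ?_, ?_, ?_, ?_, ?_, ?_, ?_⟩
  · intro x hx hxR
    refine (hbt.1 x hx ?_).1.trans
      (div_le_div_of_nonneg_right ((le_max_left _ _).trans hcC) (by positivity))
    exact ((le_max_left _ _).trans hRR).trans hxR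
  · intro x hx hxR
    refine (hbt.1 x hx ?_).2.2.trans
      (div_le_div_of_nonneg_right ((le_max_left _ _).trans hcC) (by positivity))
    exact ((le_max_left _ _).trans hRR).trans hxR
  · intro u hu
    have hu0 : u ∉ disc R₀ := fun h => by
      have h1 : u.1 ^ 2 + u.2 ^ 2 ≤ R₀ ^ 2 := h
      have h2 := pow_le_pow_left₀ hR₀.le (le_max_left R₀ 1) 2
      have h3 := hRsq hRR hu
      linarith
    obtain ⟨h1, h2⟩ := hbt.2 u hu0
    have h1' := sq_le_sq' (abs_le.1 (h1.trans (le_max_left _ 1))).1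
      (abs_le.1 (h1.trans (le_max_left _ 1))).2
    have h2' := sq_le_sq' (abs_le.1 (h2.trans (le_max_left _ 1))).1
      (abs_le.1 (h2.trans (le_max_left _ 1))).2
    refine le_trans ?_ (show 1 + 2 * c ≤ C by linarith)
    refine le_of_sq_le_sq ?_ (by linarith)
    rw [norm_sq_eq_sum]
    simp only [graphNormalVec]
    simp only [Matrix.cons_val_zero, Matrix.cons_val_one, Matrix.cons_val]
    rw [← hc] at h1' h2'
    nlinarith
  · intro u hu
    have h1 := hRsq hRR hu
    refine (helev t ht u fun h => absurd h (not_le.2 h1)).trans ?_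
    exact div_le_div_of_nonneg_right (by linarith) (by positivity)
  · exact fun u => (hheight t ht u).trans (by linarith)
  · rintro _ ⟨l, hl, rfl⟩
    have h1 := norm_add_le (M.Q t l) (M.c t)
    rw [(M.Q t).norm_map] at h1
    have h2 := hρ' l hl
    rw [place]
    linarith
  · linarith
  · rintro _ ⟨l, hl, rfl⟩
    have h1 := norm_add_le (M.V t) (cross (M.Ω t) (place M t l - M.c t))
    have h2 := norm_cross_le (M.Ω t) (place M t l - M.c t)
    have h3 : ‖place M t l - M.c t‖ ≤ |ρ| := by
      rw [place, add_sub_cancel_right, (M.Q t).norm_map]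
      exact hρ' l hl
    have h4 : ‖M.Ω t‖ * ‖place M t l - M.c t‖ ≤ o * |ρ| :=
      mul_le_mul hΩt.le h3 (norm_nonneg _) ho0
    rw [WaterBody.bodyVel]
    linarith

end Far

/-! ### Estimates of the error terms -/

section Errors

variable {P : Params} {B : RigidBody} {M : Motion} {I : Set ℝ} {t : ℝ} {m : ℕ} {C R₁ R : ℝ}

lemma volume_box (a b c d e f : ℝ) :
    volume {x : E3 | (a ≤ x 0 ∧ x 0 ≤ b) ∧ (c ≤ x 1 ∧ x 1 ≤ d) ∧ e ≤ x 2 ∧ x 2 ≤ f}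
      = ENNReal.ofReal (b - a) * ENNReal.ofReal (d - c) * ENNReal.ofReal (f - e) := by
  have h : (pointL : (ℝ × ℝ) × ℝ → E3) ⁻¹'
      {x : E3 | (a ≤ x 0 ∧ x 0 ≤ b) ∧ (c ≤ x 1 ∧ x 1 ≤ d) ∧ e ≤ x 2 ∧ x 2 ≤ f}
      = (Icc a b ×ˢ Icc c d) ×ˢ Icc e f := by
    ext ⟨⟨x, y⟩, z⟩
    simp only [mem_preimage, pointL_apply, mem_ofPred_eq, point_zero, point_one, point_two,
      mem_prod, mem_Icc, and_assoc]
  rw [← measurePreserving_pointL.measure_preimage_emb measurableEmbedding_pointL, h,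
    Measure.volume_eq_prod, Measure.prod_prod, Measure.volume_eq_prod, Measure.prod_prod]
  simp only [Real.volume_Icc]

/-- The region which contains the support of the cutoff of radius `R`. -/
def cutRegion (R : ℝ) : Set E3 := {x | x 0 ^ 2 + x 1 ^ 2 ≤ 2 * R ^ 2 ∧ -(2 * R) ≤ x 2}

lemma fderiv_cut3_of_notMem (hR : 0 < R) {x : E3} (hx : x ∉ cutRegion R) :
    fderiv ℝ (cut3 R) x = 0 := by
  refine fderiv_cut3_eq_zero hR (Or.inr ?_)
  by_contra! h
  exact hx h

lemma measurableSet_cutRegion : MeasurableSet (cutRegion R) := by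
  have h := fun i => (contDiff_coord (n := 0) i).continuous
  exact ((isClosed_le (((h 0).pow 2).add ((h 1).pow 2)) continuous_const).inter
    (isClosed_le continuous_const (h 2))).measurableSet

lemma abs_le_of_mem_cutRegion (hR : 0 < R) {a b : ℝ} (h : a ^ 2 + b ^ 2 ≤ 2 * R ^ 2) :
    |a| ≤ 2 * R ∧ |b| ≤ 2 * R :=
  ⟨abs_le_of_sq_le_sq (by nlinarith [sq_nonneg b]) (by linarith),
    abs_le_of_sq_le_sq (by nlinarith [sq_nonneg a]) (by linarith)⟩

/-- The fluid in a large region: its volume is of order `R²` over a bottom of finite depth, and of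
order `R³` in an infinitely deep fluid. -/
lemma exists_volume_le (C : ℝ)
    (hd : (m = 2 ∧ ∃ h : ℝ, M.bottom = h) ∨ (m = 3 ∧ M.bottom = ⊥)) :
    ∃ W : ℝ, 0 ≤ W ∧ ∀ t R, 0 < R → C ≤ R → (∀ u, |M.η t u| ≤ C) →
      volume (fluid B M t ∩ cutRegion R) ≤ ENNReal.ofReal (W * R ^ m) := by
  have key : ∀ t R e, 0 < R → (∀ u, |M.η t u| ≤ C) →
      (∀ x ∈ fluid B M t ∩ cutRegion R, e ≤ x 2) →
      volume (fluid B M t ∩ cutRegion R) ≤ ENNReal.ofReal (16 * R ^ 2 * max (C - e) 0) := by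
    intro t R e hR hη he
    have hsub : fluid B M t ∩ cutRegion R ⊆ {x : E3 | (-(2 * R) ≤ x 0 ∧ x 0 ≤ 2 * R) ∧
        (-(2 * R) ≤ x 1 ∧ x 1 ≤ 2 * R) ∧ e ≤ x 2 ∧ x 2 ≤ C} := fun x hx => by
      obtain ⟨h1, h2⟩ := abs_le_of_mem_cutRegion hR hx.2.1
      exact ⟨abs_le.1 h1, abs_le.1 h2, he x hx, hx.1.1.2.le.trans ((le_abs_self _).trans (hη _))⟩
    refine (measure_mono hsub).trans ?_
    rw [volume_box, ← ENNReal.ofReal_mul (by linarith)]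
    refine (mul_le_mul_right (ENNReal.ofReal_le_ofReal (le_max_left (C - e) 0)) _).trans ?_
    rw [← ENNReal.ofReal_mul (by nlinarith)]
    exact ENNReal.ofReal_le_ofReal (le_of_eq (by ring))
  rcases hd with ⟨rfl, h, hb⟩ | ⟨rfl, hb⟩
  · refine ⟨16 * max (C - h) 0, by positivity, fun t R hR hCR hη => ?_⟩
    refine (key t R h hR hη fun x hx => ?_).trans (le_of_eq (by ring_nf))
    have := hx.1.1.1
    rw [hb] at this
    exact (WithBot.coe_lt_coe.1 this).le
  · refine ⟨48, by norm_num, fun t R hR hCR hη => ?_⟩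
    refine (key t R (-(2 * R)) hR hη fun x hx => hx.2.2).trans (ENNReal.ofReal_le_ofReal ?_)
    have : max (C - -(2 * R)) 0 ≤ 3 * R := max_le (by linarith) (by linarith)
    nlinarith [mul_le_mul_of_nonneg_left this (by positivity : 0 ≤ 16 * R ^ 2)]

/-- Bound for an integral over the fluid of a function that vanishes off the region of the
cutoff. -/
lemma abs_setIntegral_fluid_le {W c : ℝ} (hW : 0 ≤ W) (hR : 0 < R)
    (hvol : volume (fluid B M t ∩ cutRegion R) ≤ ENNReal.ofReal (W * R ^ m)) {f : E3 → ℝ}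
    (h0 : ∀ x, x ∉ cutRegion R → f x = 0) (hc : 0 ≤ c)
    (hf : ∀ x ∈ fluid B M t, x ∈ cutRegion R → |f x| ≤ c) :
    |∫ x in fluid B M t, f x| ≤ c * (W * R ^ m) := by
  have e : ∫ x in fluid B M t, f x = ∫ x in fluid B M t ∩ cutRegion R, f x := by
    rw [← setIntegral_indicator measurableSet_cutRegion]
    congr 1
    funext x
    by_cases hx : x ∈ cutRegion R
    · rw [indicator_of_mem hx]
    · rw [indicator_of_notMem hx, h0 x hx]
  rw [e]
  have h1 := norm_setIntegral_le_of_norm_le_const (μ := volume) (s := fluid B M t ∩ cutRegion R)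
    (f := f) (C := c) (hvol.trans_lt ENNReal.ofReal_lt_top) fun x hx => hf x hx.1 hx.2
  refine h1.trans (mul_le_mul_of_nonneg_left ?_ hc)
  exact ENNReal.toReal_le_of_le_ofReal (by positivity) hvol

/-- Bound for an integral over the annulus in which the horizontal cutoff varies. -/
lemma abs_integral_annulus_le {c : ℝ} (hR : 0 < R) (hc : 0 ≤ c) {f : ℝ × ℝ → ℝ}
    (h0 : ∀ u : ℝ × ℝ, u.1 ^ 2 + u.2 ^ 2 < R ^ 2 → f u = 0)
    (h1 : ∀ u : ℝ × ℝ, 2 * R ^ 2 < u.1 ^ 2 + u.2 ^ 2 → f u = 0)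
    (hf : ∀ u : ℝ × ℝ, R ^ 2 ≤ u.1 ^ 2 + u.2 ^ 2 → u.1 ^ 2 + u.2 ^ 2 ≤ 2 * R ^ 2 → |f u| ≤ c) :
    |∫ u, f u| ≤ c * (16 * R ^ 2) := by
  set S : Set (ℝ × ℝ) := Icc (-(2 * R)) (2 * R) ×ˢ Icc (-(2 * R)) (2 * R) with hS
  have hvol : volume S = ENNReal.ofReal (16 * R ^ 2) := by
    rw [hS, Measure.volume_eq_prod, Measure.prod_prod, Real.volume_Icc,
      ← ENNReal.ofReal_mul (by linarith)]
    congr 1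
    ring
  have e : ∫ u, f u = ∫ u in S, f u := by
    rw [setIntegral_eq_integral_of_forall_compl_eq_zero]
    intro u hu
    refine h1 u ?_
    by_contra h
    obtain ⟨h2, h3⟩ := abs_le_of_mem_cutRegion hR (not_lt.1 h)
    exact hu ⟨abs_le.1 h2, abs_le.1 h3⟩
  rw [e]
  have h2 := norm_setIntegral_le_of_norm_le_const (μ := volume) (s := S)
    (f := f) (C := c) (by rw [hvol]; exact ENNReal.ofReal_lt_top) fun u _ => by
      by_cases hu : u.1 ^ 2 + u.2 ^ 2 < R ^ 2
      · rw [h0 u hu, norm_zero]; exact hc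
      by_cases hu' : 2 * R ^ 2 < u.1 ^ 2 + u.2 ^ 2
      · rw [h1 u hu', norm_zero]; exact hc
      exact hf u (not_lt.1 hu) (not_lt.1 hu')
  refine h2.trans (le_of_eq ?_)
  rw [Measure.real, hvol, ENNReal.toReal_ofReal (by positivity)]

namespace FarBounds

variable (hb : FarBounds P B M m C R₁ t)
include hb

lemma pos (hR : R₁ < R) : 1 < R := lt_of_le_of_lt (hb.one_le.trans hb.le_radius) hR

lemma notMem_disc (hR : R₁ < R) {u : ℝ × ℝ} (hu : R ^ 2 ≤ u.1 ^ 2 + u.2 ^ 2) : u ∉ disc R₁ := by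
  have h0 : 0 ≤ R₁ := by linarith [hb.one_le, hb.le_radius]
  exact not_le.2 (lt_of_lt_of_le (pow_lt_pow_left₀ hR h0 two_ne_zero) hu)

lemma one_add_norm_le (hR : R₁ < R) {x : E3} (hx : x ∈ cutRegion R) (hx2 : x 2 ≤ C) :
    1 + ‖x‖ ≤ 4 * R := by
  have hR1 := hb.pos hR
  have h1 : x 2 ^ 2 ≤ (2 * R) ^ 2 := sq_le_sq' hx.2 (by linarith [hb.le_radius])
  have h2 : ‖x‖ ≤ 3 * R := by
    refine le_of_sq_le_sq ?_ (by linarith)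
    rw [norm_sq_eq_sum]
    nlinarith [hx.1]
  linarith

lemma graphPoint_mem_cutRegion (hR : R₁ < R) {u : ℝ × ℝ} (hu : u.1 ^ 2 + u.2 ^ 2 ≤ 2 * R ^ 2) :
    graphPoint (M.η t) u ∈ cutRegion R := by
  refine ⟨by simpa only [graphPoint, point_zero, point_one] using hu, ?_⟩
  rw [graphPoint, point_two]
  linarith [(abs_le.1 (hb.height u)).1, hb.le_radius, hb.pos hR]

lemma abs_elev_le (hR : R₁ < R) {u : ℝ × ℝ} (hu : R ^ 2 ≤ u.1 ^ 2 + u.2 ^ 2) :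
    |M.η t u - P.η₀| ≤ C / R ^ 2 := by
  have := hb.pos hR
  exact (hb.elev u (hb.notMem_disc hR hu)).trans
    (div_le_div_of_nonneg_left (by linarith [hb.one_le]) (by positivity) hu)

lemma abs_pot_le (hR : R₁ < R) {x : E3} (hx : x ∈ closedFluid B M t) (hxR : R ≤ ‖x‖) :
    |M.Φ t x| ≤ C / R ^ 2 := by
  have := hb.pos hR
  exact (hb.pot x hx (hR.le.trans hxR)).trans
    (div_le_div_of_nonneg_left (by linarith [hb.one_le]) (by positivity)
      (pow_le_pow_left₀ (by linarith) hxR _))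

lemma norm_vel_le (hR : R₁ < R) {x : E3} (hx : x ∈ closedFluid B M t) (hxR : R ≤ ‖x‖) :
    ‖WaterBody.vel M t x‖ ≤ C / R ^ m := by
  have := hb.pos hR
  exact (hb.vel x hx (hR.le.trans hxR)).trans
    (div_le_div_of_nonneg_left (by linarith [hb.one_le]) (by positivity)
      (pow_le_pow_left₀ (by linarith) hxR _))

end FarBounds

lemma norm_horiz_le (x : E3) : ‖horiz x‖ ≤ ‖x‖ := by
  rw [Prod.norm_def]
  exact max_le (PiLp.norm_apply_le x 0) (PiLp.norm_apply_le x 1)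

lemma norm_stress_le (a b : E3) (f : E3 → ℝ) (x : E3) :
    ‖stress a b f x‖ ≤ 2 * ‖gradient f x‖ ^ 2 * ‖killing a b x‖ := by
  have h1 := norm_inner_le_norm (𝕜 := ℝ) (gradient f x) (killing a b x)
  refine (norm_sub_le _ _).trans ?_
  rw [norm_smul, norm_smul, Real.norm_of_nonneg (by positivity : 0 ≤ ‖gradient f x‖ ^ 2 / 2)]
  have h2 := mul_le_mul_of_nonneg_right h1 (norm_nonneg (gradient f x))
  nlinarith [mul_nonneg (sq_nonneg ‖gradient f x‖) (norm_nonneg (killing a b x))]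

end Errors

section Bounds

variable {P : Params} {B : RigidBody} {M : Motion} {I : Set ℝ} {t : ℝ} {m : ℕ} {C R₁ R D W : ℝ}

lemma div_pow_le_div {c R : ℝ} (hc : 0 ≤ c) (hR : 1 ≤ R) {k : ℕ} (hk : k ≠ 0) :
    c / R ^ k ≤ c / R :=
  div_le_div_of_nonneg_left hc (by linarith) (le_self_pow₀ hR hk)

namespace FarBounds

variable (hb : FarBounds P B M m C R₁ t)
include hb

lemma norm_killing_le (hR : R₁ < R) {x : E3} (hx : x ∈ cutRegion R) (hx2 : x 2 ≤ C) (a b : E3) :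
    ‖killing a b x‖ ≤ (‖a‖ + ‖b‖) * (4 * R) :=
  (WaterBody.norm_killing_le a b x).trans
    (mul_le_mul_of_nonneg_left (hb.one_add_norm_le hR hx hx2) (by positivity))

lemma fluid_le {x : E3} (hx : x ∈ fluid B M t) : x 2 ≤ C :=
  hx.1.2.le.trans ((le_abs_self _).trans (hb.height _))

lemma abs_fderiv_cut_le (hR : R₁ < R) (hD : 0 ≤ D) (hcut : ∀ u, ‖fderiv ℝ (cut R) u‖ ≤ D / R)
    {u : ℝ × ℝ} (hu : u.1 ^ 2 + u.2 ^ 2 ≤ 2 * R ^ 2) (a b : E3) :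
    |fderiv ℝ (cut R) u (horiz (killing a b (graphPoint (M.η t) u)))|
      ≤ 4 * D * (‖a‖ + ‖b‖) := by
  have hR1 := hb.pos hR
  have h1 : ‖killing a b (graphPoint (M.η t) u)‖ ≤ (‖a‖ + ‖b‖) * (4 * R) := by
    refine hb.norm_killing_le hR (hb.graphPoint_mem_cutRegion hR hu) ?_ a b
    rw [graphPoint, point_two]
    exact (le_abs_self _).trans (hb.height u)
  refine ((fderiv ℝ (cut R) u).le_opNorm _).trans ((mul_le_mul (hcut u)
    ((norm_horiz_le _).trans h1) (norm_nonneg _) (by positivity)).trans (le_of_eq ?_))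
  field_simp

/-- The error terms in the balance of momentum are of order `1 / R`. -/
theorem abs_momentumError_le (hS : IsSolution P B M I) (ht : t ∈ I) (hm : 1 ≤ m) (hR : R₁ < R)
    (hD : 0 ≤ D) (hcut : ∀ u, ‖fderiv ℝ (cut R) u‖ ≤ D / R)
    (hcut3 : ∀ x, ‖fderiv ℝ (cut3 R) x‖ ≤ D / R) (hW : 0 ≤ W)
    (hvol : volume (fluid B M t ∩ cutRegion R) ≤ ENNReal.ofReal (W * R ^ m)) (a b : E3) :
    |momentumError P B M (cut R) (cut3 R) a b t|
      ≤ (P.g * (16 * D * ‖b‖ * C ^ 3 + 64 * D * (‖a‖ + ‖b‖) * C ^ 2)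
        + 64 * D * (‖a‖ + ‖b‖) * C ^ 3 + 8 * D * (‖a‖ + ‖b‖) * C ^ 2 * W) / R := by
  have hR1 := hb.pos hR
  have hR0 : 0 < R := by linarith
  have hC : 1 ≤ C := hb.one_le
  have hC0 : 0 ≤ C := by linarith
  have hg := P.g_pos
  set A := ‖a‖ + ‖b‖ with hA
  have hA0 : 0 ≤ A := by positivity
  have z1 : ∀ u : ℝ × ℝ, u.1 ^ 2 + u.2 ^ 2 < R ^ 2 → ∀ v, fderiv ℝ (cut R) u v = 0 :=
    fun u hu v => by rw [fderiv_cut_eq_zero_of_lt hR0 hu, zero_apply]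
  have z2 : ∀ u : ℝ × ℝ, 2 * R ^ 2 < u.1 ^ 2 + u.2 ^ 2 → ∀ v, fderiv ℝ (cut R) u v = 0 :=
    fun u hu v => by rw [fderiv_cut_eq_zero_of_gt hR0 hu, zero_apply]
  -- The annulus has area of order `R²`, the derivative of the cutoff is of order `R⁻¹`, the
  -- elevation of order `R⁻²` and the rigid velocity field of order `R`.
  have i1 : |∫ u, fderiv ℝ (cut R) u (b 1, -b 0) * (M.η t u - P.η₀) ^ 3|
      ≤ 16 * D * ‖b‖ * C ^ 3 / R := by
    refine (abs_integral_annulus_le (c := (D / R * ‖b‖) * (C / R ^ 2) ^ 3) hR0 (by positivity)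
      (fun u hu => by rw [z1 u hu, zero_mul]) (fun u hu => by rw [z2 u hu, zero_mul])
      fun u hu hu' => ?_).trans ?_
    · rw [abs_mul, abs_pow]
      refine mul_le_mul ?_ (pow_le_pow_left₀ (abs_nonneg _) (hb.abs_elev_le hR hu) 3)
        (by positivity) (by positivity)
      refine ((fderiv ℝ (cut R) u).le_opNorm _).trans
        (mul_le_mul (hcut u) ?_ (norm_nonneg _) (by positivity))
      rw [Prod.norm_def, norm_neg]
      exact max_le (PiLp.norm_apply_le b 1) (PiLp.norm_apply_le b 0)
    · rw [show D / R * ‖b‖ * (C / R ^ 2) ^ 3 * (16 * R ^ 2) = 16 * D * ‖b‖ * C ^ 3 / R ^ 5 by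
        field_simp]
      exact div_pow_le_div (by positivity) hR1.le (by norm_num)
  have i2 : |∫ u, fderiv ℝ (cut R) u (horiz (killing a b (graphPoint (M.η t) u)))
      * (M.η t u - P.η₀) ^ 2| ≤ 64 * D * A * C ^ 2 / R := by
    refine (abs_integral_annulus_le (c := (4 * D * A) * (C / R ^ 2) ^ 2) hR0 (by positivity)
      (fun u hu => by rw [z1 u hu, zero_mul]) (fun u hu => by rw [z2 u hu, zero_mul])
      fun u hu hu' => ?_).trans ?_
    · rw [abs_mul, abs_pow]
      exact mul_le_mul (hb.abs_fderiv_cut_le hR hD hcut hu' a b)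
        (pow_le_pow_left₀ (abs_nonneg _) (hb.abs_elev_le hR hu) 2) (by positivity) (by positivity)
    · rw [show 4 * D * A * (C / R ^ 2) ^ 2 * (16 * R ^ 2) = 64 * D * A * C ^ 2 / R ^ 2 by
        field_simp; ring]
      exact div_pow_le_div (by positivity) hR1.le (by norm_num)
  have i3 : |∫ u, fderiv ℝ (cut R) u (horiz (killing a b (graphPoint (M.η t) u)))
      * (M.Φ t (graphPoint (M.η t) u)
        * inner ℝ (WaterBody.vel M t (graphPoint (M.η t) u)) (graphNormalVec (M.η t) u))|
      ≤ 64 * D * A * C ^ 3 / R := by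
    refine (abs_integral_annulus_le (c := (4 * D * A) * (C / R ^ 2 * (C / R ^ m * C))) hR0
      (by positivity) (fun u hu => by rw [z1 u hu, zero_mul])
      (fun u hu => by rw [z2 u hu, zero_mul]) fun u hu hu' => ?_).trans ?_
    · have hx := hS.graphPoint_mem ht u
      have hxR := le_norm_graphPoint (M.η t) hu
      rw [abs_mul, abs_mul]
      refine mul_le_mul (hb.abs_fderiv_cut_le hR hD hcut hu' a b)
        (mul_le_mul (hb.abs_pot_le hR hx hxR) ?_ (abs_nonneg _) (by positivity))
        (by positivity) (by positivity)
      exact (abs_real_inner_le_norm _ _).trans (mul_le_mul (hb.norm_vel_le hR hx hxR)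
        (hb.normal u (hb.notMem_disc hR hu)) (norm_nonneg _) (by positivity))
    · rw [show 4 * D * A * (C / R ^ 2 * (C / R ^ m * C)) * (16 * R ^ 2)
          = 64 * D * A * C ^ 3 / R ^ m by field_simp; ring]
      exact div_pow_le_div (by positivity) hR1.le (by omega)
  -- The stress is of order `R⁻²ᵐ R`, the region of integration has volume of order `Rᵐ`.
  have i4 : |∫ x in fluid B M t, fderiv ℝ (cut3 R) x (stress a b (M.Φ t) x)|
      ≤ 8 * D * A * C ^ 2 * W / R := by
    refine (abs_setIntegral_fluid_le (m := m) (c := D / R * (2 * (C / R ^ m) ^ 2 * (A * (4 * R))))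
      hW hR0 hvol (fun x hx => by rw [fderiv_cut3_of_notMem hR0 hx, zero_apply])
      (by positivity) fun x hx hxR => ?_).trans ?_
    · rcases lt_or_ge ‖x‖ R with h | h
      · rw [fderiv_cut3_eq_zero hR0 (Or.inl h), zero_apply, abs_zero]
        positivity
      refine ((fderiv ℝ (cut3 R) x).le_opNorm _).trans
        (mul_le_mul (hcut3 x) ((norm_stress_le _ _ _ _).trans ?_) (norm_nonneg _) (by positivity))
      have h1 := hb.norm_vel_le hR (fluid_subset_closedFluid hx) h
      exact mul_le_mul (mul_le_mul_of_nonneg_left (pow_le_pow_left₀ (norm_nonneg _) h1 2)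
        zero_le_two) (hb.norm_killing_le hR hxR (hb.fluid_le hx) a b) (norm_nonneg _)
        (by positivity)
    · rw [show D / R * (2 * (C / R ^ m) ^ 2 * (A * (4 * R))) * (W * R ^ m)
          = 8 * D * A * C ^ 2 * W / R ^ m by field_simp; ring]
      exact div_pow_le_div (by positivity) hR1.le (by omega)
  have hi1 := abs_le.1 i1
  have hi2 := abs_le.1 i2
  have hi3 := abs_le.1 i3
  have hi4 := abs_le.1 i4
  rw [momentumError]
  set J1 := ∫ u, fderiv ℝ (cut R) u (b 1, -b 0) * (M.η t u - P.η₀) ^ 3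
  set J2 := ∫ u, fderiv ℝ (cut R) u (horiz (killing a b (graphPoint (M.η t) u)))
      * (M.η t u - P.η₀) ^ 2
  have e1 : 0 ≤ 16 * D * ‖b‖ * C ^ 3 / R := by positivity
  have e2 : 0 ≤ 64 * D * A * C ^ 2 / R := by positivity
  have hJ : |P.g * ((1 / 6) * J1 - (1 / 2) * J2)|
      ≤ P.g * (16 * D * ‖b‖ * C ^ 3 / R + 64 * D * A * C ^ 2 / R) := by
    rw [abs_mul, abs_of_pos hg]
    refine mul_le_mul_of_nonneg_left ?_ hg.le
    rw [abs_le]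
    constructor <;> linarith [hi1.1, hi1.2, hi2.1, hi2.2]
  refine (abs_add_le _ _).trans ((add_le_add ((abs_add_le _ _).trans (add_le_add hJ i3)) i4).trans
    (le_of_eq ?_))
  ring

/-- The rate of change of the displaced mass and of its moments, apart from the momentum of the
fluid, is bounded. -/
theorem abs_elevationError_le (hm : m ≤ 3) (hR : R₁ < R)
    (hD : 0 ≤ D) (hcut3 : ∀ x, ‖fderiv ℝ (cut3 R) x‖ ≤ D / R) (hW : 0 ≤ W)
    (hvol : volume (fluid B M t ∩ cutRegion R) ≤ ENNReal.ofReal (W * R ^ m)) (a b : E3) :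
    |∫ x in fluid B M t, (killing a b x 2 * fderiv ℝ (cut3 R) x (WaterBody.vel M t x)
        - M.Φ t x * fderiv ℝ (cut3 R) x (cross kvec b))|
      ≤ (4 * (‖a‖ + ‖b‖) * D * C + C * D * ‖cross kvec b‖) * W := by
  have hR1 := hb.pos hR
  have hR0 : 0 < R := by linarith
  have hC : 1 ≤ C := hb.one_le
  set A := ‖a‖ + ‖b‖ with hA
  have hA0 : 0 ≤ A := by positivity
  set w := ‖cross kvec b‖
  have hw0 : 0 ≤ w := norm_nonneg _
  refine (abs_setIntegral_fluid_le (m := m) (c := A * (4 * R) * (D / R * (C / R ^ m))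
      + C / R ^ 2 * (D / R * w))
      hW hR0 hvol (fun x hx => by
        rw [fderiv_cut3_of_notMem hR0 hx, zero_apply, zero_apply, mul_zero, mul_zero, sub_zero])
      (by positivity) fun x hx hxR => ?_).trans ?_
  · rcases lt_or_ge ‖x‖ R with h | h
    · rw [fderiv_cut3_eq_zero hR0 (Or.inl h), zero_apply, zero_apply, mul_zero, mul_zero, sub_zero,
        abs_zero]
      positivity
    have hxc := fluid_subset_closedFluid hx
    refine (abs_sub _ _).trans (add_le_add ?_ ?_) <;> rw [abs_mul]
    · refine mul_le_mul ((PiLp.norm_apply_le _ 2).trans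
        (hb.norm_killing_le hR hxR (hb.fluid_le hx) a b)) ?_ (abs_nonneg _) (by positivity)
      exact ((fderiv ℝ (cut3 R) x).le_opNorm _).trans
        (mul_le_mul (hcut3 x) (hb.norm_vel_le hR hxc h) (norm_nonneg _) (by positivity))
    · refine mul_le_mul (hb.abs_pot_le hR hxc h) ?_ (abs_nonneg _) (by positivity)
      exact ((fderiv ℝ (cut3 R) x).le_opNorm _).trans
        (mul_le_mul_of_nonneg_right (hcut3 x) (norm_nonneg _))
  · have h1 : A * (4 * R) * (D / R * (C / R ^ m)) * (W * R ^ m) = 4 * A * D * C * W := by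
      field_simp
    have h2 : C / R ^ 2 * (D / R * w) * (W * R ^ m) ≤ C * D * w * W := by
      rw [show C / R ^ 2 * (D / R * w) * (W * R ^ m) = C * D * w * W * (R ^ m / R ^ 3) by
        field_simp]
      refine mul_le_of_le_one_right (by positivity) ?_
      exact (div_le_one (by positivity)).2 (pow_le_pow_right₀ hR1.le hm)
    rw [add_mul (A * (4 * R) * _), h1]
    linarith

lemma cut3_graphPoint (hR : R₁ < R) (u : ℝ × ℝ) :
    cut3 R (graphPoint (M.η t) u) = cut R u :=
  cut3_eq_cut (by linarith [hb.pos hR])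
    (by linarith [(abs_le.1 (hb.height u)).1, hb.le_radius])

lemma cut3_body (hR : R₁ < R) : ∀ x ∈ frontier (bodyAt B M t), cut3 R x = 1 := fun x hx =>
  cut3_eq_one (by linarith [hb.pos hR])
    ((hb.body x (isCompact_bodyAt.isClosed.frontier_subset hx)).trans hR.le)

lemma cut3_eq_zero (hR : R₁ < R) :
    ∀ x ∈ closedFluid B M t, x ∉ Metric.closedBall (0 : E3) (4 * R) → cut3 R x = 0 := by
  intro x hx hxK
  have hR0 : 0 < R := by linarith [hb.pos hR]
  by_contra h
  have h1 : x 0 ^ 2 + x 1 ^ 2 < 2 * R ^ 2 := by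
    by_contra h1
    exact h (cut3_eq_zero_of_horiz hR0 (not_lt.1 h1))
  have h2 : -(2 * R) < x 2 := by
    by_contra h1
    exact h (cut3_eq_zero_of_below hR0 (not_lt.1 h1))
  have h3 : x 2 ≤ C := hx.1.2.trans ((le_abs_self _).trans (hb.height _))
  have h4 := hb.one_add_norm_le hR ⟨h1.le, h2.le⟩ h3
  refine hxK ?_
  rw [mem_closedBall_zero_iff]
  linarith

/-- The evolution of the cutoff momentum, for a cutoff radius in the far field. -/
theorem hasDerivAt_cutMomentum (hS : IsSolution P B M I) (hI : IsOpen I) (ht : t ∈ I)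
    (hR : R₁ < R) (a b : E3) :
    HasDerivAt (cutMomentum P B M (cut R) a b)
      (P.ρf * (P.g * elevationMoment P M (cut R) a b t
          + momentumError P B M (cut R) (cut3 R) a b t
          - bottomIntegral M.bottom
              (fun x => cut3 R x * (‖WaterBody.vel M t x‖ ^ 2 / 2 * killing a b x 2)))
        + (P.ρf - P.ρb) * P.g * B.vol * killing a b (M.c t) 2) t := by
  have hR0 : 0 < R := by linarith [hb.pos hR]
  refine hS.hasDerivAt_cutMomentum hI ht (contDiff_cut R) (hasCompactSupport_cut hR0)
    (contDiff_cut3 R) (hb.cut3_graphPoint hR) (hb.cut3_body hR) (isCompact_closedBall 0 (4 * R))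
    (hb.cut3_eq_zero hR) a b

end FarBounds

end Bounds

/-! ### Removing the cutoff -/

section Limits

variable {P : Params} {B : RigidBody} {M : Motion} {I : Set ℝ} {t : ℝ} {m : ℕ} {C R₁ R : ℝ}

/-- With the smooth cutoff the flux of `Φ ξ` through the free surface has the same limit as over
discs, a component of the improper surface integrals. -/
lemma IsSolution.tendsto_surfaceFlux (hS : IsSolution P B M I) (ht : t ∈ I)
    (hM : MomentaConverge M t) (a b : E3) :
    Tendsto (fun R => surfaceFlux M (cut R) a b t) atTop
      (𝓝 (inner ℝ (freeSurfaceIntegral M t (fun r n => M.Φ t r • n)) a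
        + inner ℝ (freeSurfaceIntegral M t (fun r n => cross r (M.Φ t r • n))) b)) := by
  obtain ⟨⟨J₁, h₁⟩, ⟨J₂, h₂⟩⟩ := hM
  rw [freeSurfaceIntegral, h₁.limUnder_eq, freeSurfaceIntegral, h₂.limUnder_eq]
  have hη := hS.contDiff_one_η ht
  have hgp := continuous_graphPoint hη
  have hΦc := hS.continuous_Φ_comp ht hgp (hS.graphPoint_mem ht)
  have hkc := (continuous_killing a b).comp hgp
  have hNc := continuous_graphNormalVec hη
  have hf : Continuous fun u => M.Φ t (graphPoint (M.η t) u)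
      * inner ℝ (killing a b (graphPoint (M.η t) u)) (graphNormalVec (M.η t) u) :=
    hΦc.mul (hkc.inner (𝕜 := ℝ) hNc)
  refine tendsto_integral_cut hf (((h₁.inner tendsto_const_nhds).add
    (h₂.inner tendsto_const_nhds)).congr fun R => ?_)
  have c₁ : Continuous fun u => M.Φ t (graphPoint (M.η t) u) • graphNormalVec (M.η t) u :=
    hΦc.smul hNc
  have c₂ : Continuous fun u => crossB (graphPoint (M.η t) u)
      (M.Φ t (graphPoint (M.η t) u) • graphNormalVec (M.η t) u) :=
    (crossB.continuous.comp hgp).clm_apply c₁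
  have i₁ := c₁.continuousOn.integrableOn_compact (μ := volume) (isCompact_disc R)
  have i₂ := c₂.continuousOn.integrableOn_compact (μ := volume) (isCompact_disc R)
  have e₁ : freeSurfaceIntegralOn M R t (fun r n => M.Φ t r • n)
      = ∫ u in disc R, M.Φ t (graphPoint (M.η t) u) • graphNormalVec (M.η t) u := by
    rw [freeSurfaceIntegralOn, graphIntegral]
    simp_rw [smul_comm (areaDensity _ _), areaDensity_smul_graphNormal]
  have e₂ : freeSurfaceIntegralOn M R t (fun r n => cross r (M.Φ t r • n))
      = ∫ u in disc R, crossB (graphPoint (M.η t) u)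
          (M.Φ t (graphPoint (M.η t) u) • graphNormalVec (M.η t) u) := by
    rw [freeSurfaceIntegralOn, graphIntegral]
    simp_rw [← crossB_apply, ← map_smul, smul_comm (areaDensity _ _), areaDensity_smul_graphNormal]
  rw [e₁, e₂, real_inner_comm, ← integral_inner i₁, real_inner_comm, ← integral_inner i₂,
    ← integral_add (i₁.const_inner a) (i₂.const_inner b)]
  congr 1
  funext u
  simp only [crossB_apply, killing, inner_eq_sum, cross_apply_zero, cross_apply_one,
    cross_apply_two, PiLp.add_apply, PiLp.smul_apply, smul_eq_mul]
  ring

/-- The cutoff momentum of a translation tends to the component of `𝓛`. -/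
lemma IsSolution.tendsto_cutMomentum_linear (hS : IsSolution P B M I) (hI : IsOpen I) (ht : t ∈ I)
    (hM : MomentaConverge M t) (a : E3) :
    Tendsto (fun R => cutMomentum P B M (cut R) a 0 t) atTop
      (𝓝 (inner ℝ (linearMomentum P B M t) a)) := by
  have h := ((((hS.tendsto_surfaceFlux ht hM a 0).sub_const (bodyFlux B M a 0 t)).const_mul
    P.ρf).add_const (inner ℝ (bodyLinear P B M t) a + inner ℝ (bodyAngular P B M t) 0))
  refine h.congr' ?_ |>.mono_right (le_of_eq ?_)
  · exact Eventually.of_forall fun R => rfl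
  · congr 1
    rw [linearMomentum, inner_add_left, inner_add_left, real_inner_smul_left, real_inner_smul_left,
      hS.inner_linear_surface hI ht a]
    simp only [inner_zero_right]
    ring

/-- The cutoff momentum of a rotation tends to the component of `𝓐`. -/
lemma IsSolution.tendsto_cutMomentum_angular (hS : IsSolution P B M I) (hI : IsOpen I) (ht : t ∈ I)
    (hM : MomentaConverge M t) (b : E3) :
    Tendsto (fun R => cutMomentum P B M (cut R) 0 b t) atTop
      (𝓝 (inner ℝ (angularMomentum P B M t) b)) := by
  have h := ((((hS.tendsto_surfaceFlux ht hM 0 b).sub_const (bodyFlux B M 0 b t)).const_mul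
    P.ρf).add_const (inner ℝ (bodyLinear P B M t) 0 + inner ℝ (bodyAngular P B M t) b))
  refine h.congr' ?_ |>.mono_right (le_of_eq ?_)
  · exact Eventually.of_forall fun R => rfl
  · congr 1
    rw [angularMomentum, inner_add_left, inner_add_left, inner_neg_left, real_inner_smul_left,
      real_inner_smul_left, hS.inner_angular_surface hI ht b]
    simp only [inner_zero_right]
    ring

/-- The displaced mass and its moments, with a cutoff, tend to zero. -/
lemma IsSolution.tendsto_elevationMoment (hS : IsSolution P B M I) (ht : t ∈ I)
    (h₁ : MassCondition P M t) (h₂ : AngularMassCondition P M t) (a b : E3) :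
    Tendsto (fun R => elevationMoment P M (cut R) a b t) atTop (𝓝 0) := by
  have hη := (hS.contDiff_one_η ht).continuous
  have hpc : Continuous fun u : ℝ × ℝ => point u 0 := continuous_graphPoint (ψ := fun _ => 0)
    contDiff_const
  have hf : Continuous fun u => (P.η₀ - M.η t u) * killing a b (point u 0) 2 :=
    (continuous_const.sub hη).mul
      ((contDiff_coord (n := 0) 2).continuous.comp ((continuous_killing a b).comp hpc))
  have hρ : P.ρf * P.g ≠ 0 := (mul_pos P.ρf_pos P.g_pos).ne'
  have j₁ := h₁.const_mul ((P.ρf * P.g)⁻¹ * a 2)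
  have j₂ := (h₂.inner (tendsto_const_nhds (x := b))).const_mul (P.ρf * P.g)⁻¹
  refine tendsto_integral_cut hf ?_
  have h := j₁.add j₂
  rw [mul_zero, inner_zero_left, mul_zero, add_zero] at h
  refine h.congr fun R => ?_
  have c₁ : Continuous fun u => P.η₀ - M.η t u := continuous_const.sub hη
  have c₂ : Continuous fun u => crossB (point u 0) ((P.η₀ - M.η t u) • kvec) :=
    (crossB.continuous.comp hpc).clm_apply (c₁.smul continuous_const)
  have i₁ := c₁.continuousOn.integrableOn_compact (μ := volume) (isCompact_disc R)
  have i₂ := c₂.continuousOn.integrableOn_compact (μ := volume) (isCompact_disc R)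
  simp only [← crossB_apply]
  have e : ∀ s X Y : ℝ, s ≠ 0 → s⁻¹ * a 2 * (s * X) + s⁻¹ * (s * Y) = X * a 2 + Y :=
    fun s X Y hs => by field_simp
  rw [real_inner_smul_left, real_inner_comm, ← integral_inner i₂, e _ _ _ hρ, ← integral_mul_const,
    ← integral_add (i₁.mul_const (a 2)) (i₂.const_inner b)]
  congr 1
  funext u
  simp only [crossB_apply, killing_two, inner_eq_sum, cross_apply_zero, cross_apply_one,
    cross_apply_two, PiLp.smul_apply, smul_eq_mul, point_zero, point_one, point_two]
  simp [kvec]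
  ring

/-! ### Integrals over the bottom -/

/-- An integrable weight on the horizontal plane. -/
def decay (u : ℝ × ℝ) : ℝ := (1 + ‖u‖) ^ (-(3 : ℝ))

lemma integrable_decay : Integrable decay :=
  integrable_one_add_norm (by simp; norm_num)

lemma decay_pos (u : ℝ × ℝ) : 0 < decay u := by
  rw [decay]
  positivity

lemma decay_eq (u : ℝ × ℝ) : decay u = ((1 + ‖u‖) ^ 3)⁻¹ := by
  rw [decay, Real.rpow_neg (by positivity)]
  norm_cast

/-- The kinetic energy density and its moment decay like `|x|⁻³`. -/
lemma norm_sq_half_le {V : Type*} [NormedAddCommGroup V] {v : V} {x : E3} (hx : 1 ≤ ‖x‖)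
    (hv : ‖v‖ ≤ C / ‖x‖ ^ 2) : ‖v‖ ^ 2 / 2 * (1 + ‖x‖) ≤ C ^ 2 / ‖x‖ ^ 3 := by
  have hx0 : 0 < ‖x‖ := by linarith
  calc ‖v‖ ^ 2 / 2 * (1 + ‖x‖) ≤ (C / ‖x‖ ^ 2) ^ 2 / 2 * (2 * ‖x‖) := by
        gcongr
        linarith
    _ = C ^ 2 / ‖x‖ ^ 3 := by field_simp

lemma div_norm_cube_le {x : E3} (hx : 1 ≤ ‖x‖) :
    C ^ 2 / ‖x‖ ^ 3 ≤ 8 * C ^ 2 * decay (horiz x) := by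
  have h := norm_horiz_le x
  have hx0 : 0 < ‖x‖ := by linarith
  rw [decay_eq, ← div_eq_mul_inv, div_le_div_iff₀ (by positivity) (by positivity)]
  have h1 : (1 + ‖horiz x‖) ^ 3 ≤ (2 * ‖x‖) ^ 3 := pow_le_pow_left₀ (by positivity) (by linarith) 3
  nlinarith [mul_le_mul_of_nonneg_left h1 (sq_nonneg C)]

lemma tendsto_integral_one_sub_cut :
    Tendsto (fun R => ∫ u, (1 - cut R u) * decay u) atTop (𝓝 0) := by
  have h0 : (0 : ℝ) = ∫ _ : ℝ × ℝ, (0 : ℝ) := by simp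
  rw [h0]
  refine tendsto_integral_filter_of_dominated_convergence decay ?_ ?_ integrable_decay ?_
  · exact Eventually.of_forall fun R =>
      (continuous_const.sub (contDiff_cut R).continuous).aestronglyMeasurable.mul
        integrable_decay.aestronglyMeasurable
  · refine Eventually.of_forall fun R => Eventually.of_forall fun u => ?_
    have h1 := cut_nonneg R u
    have h2 := cut_le_one R u
    rw [norm_mul, Real.norm_of_nonneg (by linarith), Real.norm_of_nonneg (decay_pos u).le]
    exact mul_le_of_le_one_left (decay_pos u).le (by linarith)
  · refine Eventually.of_forall fun u => tendsto_const_nhds.congr' ?_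
    filter_upwards [eventually_ge_atTop (max 1 (u.1 ^ 2 + u.2 ^ 2))] with R hR
    have h1 : 1 ≤ R := (le_max_left _ _).trans hR
    have h2 : u.1 ^ 2 + u.2 ^ 2 ≤ R := (le_max_right _ _).trans hR
    rw [cut_eq_one (by linarith) (by nlinarith), sub_self, zero_mul]

lemma IsSolution.continuous_vel_bottom (hS : IsSolution P B M I) (ht : t ∈ I) {h : ℝ}
    (hh : M.bottom = h) : Continuous fun u : ℝ × ℝ => vel M t (point u h) :=
  hS.continuous_vel_comp ht (continuous_graphPoint (ψ := fun _ => h) contDiff_const) fun u =>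
    hS.bottom_mem ht (by rw [hh]; simp)

/-- A function on the bottom of the size of the kinetic energy density and its moment is
integrable. -/
lemma IsSolution.integrable_bottom (hS : IsSolution P B M I) (ht : t ∈ I) {h : ℝ}
    (hh : M.bottom = h) (hv : ∀ x ∈ closedFluid B M t, R₁ ≤ ‖x‖ → ‖vel M t x‖ ≤ C / ‖x‖ ^ 2)
    {V : Type*} [NormedAddCommGroup V] {f : ℝ × ℝ → V} (hf : Continuous f) {A : ℝ}
    (hA : 0 ≤ A) (hfA : ∀ u, ‖f u‖ ≤ A * (‖vel M t (point u h)‖ ^ 2 / 2 * (1 + ‖point u h‖))) :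
    Integrable f := by
  refine (hf.locallyIntegrable (μ := volume)).integrable_of_isBigO_cocompact (g := decay) ?_
    (integrable_decay.integrableAtFilter _)
  refine Asymptotics.IsBigO.of_bound (A * (8 * C ^ 2)) ?_
  have h1 := (isCompact_closedBall (0 : ℝ × ℝ) (max 1 R₁)).compl_mem_cocompact
  filter_upwards [h1] with u hu
  have h2 : max 1 R₁ < ‖u‖ := by simpa using hu
  have h3 : max 1 R₁ ≤ ‖point u h‖ := by
    have := norm_horiz_le (point u h)
    rw [horiz_point] at this
    exact h2.le.trans this
  have h4 : 1 ≤ ‖point u h‖ := (le_max_left _ _).trans h3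
  have h5 := (norm_sq_half_le h4 (hv _ (hS.bottom_mem ht (by rw [hh]; simp))
    ((le_max_right _ _).trans h3))).trans (div_norm_cube_le h4)
  rw [horiz_point] at h5
  rw [Real.norm_of_nonneg (decay_pos u).le]
  calc ‖f u‖ ≤ _ := hfA u
    _ ≤ A * (8 * C ^ 2 * decay u) := mul_le_mul_of_nonneg_left h5 hA
    _ = _ := by ring

/-- The effect of the cutoff on an integral over the bottom. -/
lemma FarBounds.abs_bottom_sub_le (hb : FarBounds P B M 2 C R₁ t) (hS : IsSolution P B M I)
    (ht : t ∈ I) {h : ℝ} (hh : M.bottom = h) (hR : R₁ < R) (hRh : |h| ≤ R) (a b : E3) :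
    |(∫ u, cut3 R (point u h)
          * (‖WaterBody.vel M t (point u h)‖ ^ 2 / 2 * killing a b (point u h) 2))
        - ∫ u, ‖WaterBody.vel M t (point u h)‖ ^ 2 / 2 * killing a b (point u h) 2|
      ≤ (‖a‖ + ‖b‖) * (8 * C ^ 2) * ∫ u, (1 - cut R u) * decay u := by
  have hR1 := hb.pos hR
  have hR0 : 0 < R := by linarith
  have hcut : ∀ u, cut3 R (point u h) = cut R u := fun u =>
    cut3_eq_cut hR0 (by linarith [(abs_le.1 hRh).1])
  simp_rw [hcut]
  have hpc : Continuous fun u : ℝ × ℝ => point u h := continuous_graphPoint (ψ := fun _ => h)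
    contDiff_const
  set q : ℝ × ℝ → ℝ := fun u => ‖WaterBody.vel M t (point u h)‖ ^ 2 / 2 * killing a b (point u h) 2
    with hq
  have hqc : Continuous q := (((hS.continuous_vel_bottom ht hh).norm.pow 2).div_const 2).mul
    ((contDiff_coord (n := 0) 2).continuous.comp ((continuous_killing a b).comp hpc))
  have hqA : ∀ u, ‖q u‖ ≤ (‖a‖ + ‖b‖)
      * (‖WaterBody.vel M t (point u h)‖ ^ 2 / 2 * (1 + ‖point u h‖)) := by
    intro u
    rw [hq, norm_mul, Real.norm_of_nonneg (by positivity)]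
    have := (PiLp.norm_apply_le (killing a b (point u h)) 2).trans
      (WaterBody.norm_killing_le a b (point u h))
    calc _ ≤ ‖WaterBody.vel M t (point u h)‖ ^ 2 / 2 * ((‖a‖ + ‖b‖) * (1 + ‖point u h‖)) :=
          mul_le_mul_of_nonneg_left this (by positivity)
      _ = _ := by ring
  have hA : 0 ≤ ‖a‖ + ‖b‖ := by positivity
  have hcn : ∀ u, ‖cut R u‖ ≤ 1 := fun u => by
    rw [Real.norm_of_nonneg (cut_nonneg R u)]
    exact cut_le_one R u
  have i₁ : Integrable q := hS.integrable_bottom ht hh hb.vel hqc hA hqA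
  have i₂ : Integrable fun u => cut R u * q u :=
    hS.integrable_bottom ht hh hb.vel ((contDiff_cut R).continuous.mul hqc) hA fun u => by
      rw [norm_mul]
      exact (mul_le_of_le_one_left (norm_nonneg _) (hcn u)).trans (hqA u)
  have i₃ : Integrable fun u => (1 - cut R u) * decay u := by
    refine integrable_decay.mono' ((continuous_const.sub
      (contDiff_cut R).continuous).aestronglyMeasurable.mul
        integrable_decay.aestronglyMeasurable) (Eventually.of_forall fun u => ?_)
    have h1 := cut_nonneg R u
    have h2 := cut_le_one R u
    rw [norm_mul, Real.norm_of_nonneg (by linarith), Real.norm_of_nonneg (decay_pos u).le]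
    exact mul_le_of_le_one_left (decay_pos u).le (by linarith)
  rw [← integral_sub i₂ i₁, ← integral_const_mul, ← Real.norm_eq_abs]
  refine norm_integral_le_of_norm_le (i₃.const_mul _) (Eventually.of_forall fun u => ?_)
  rw [← sub_one_mul, norm_mul, norm_sub_rev, Real.norm_of_nonneg (sub_nonneg.2 (cut_le_one R u))]
  by_cases hu : u.1 ^ 2 + u.2 ^ 2 ≤ R ^ 2
  · rw [cut_eq_one hR0 hu]
    simp
  have hx : R ≤ ‖point u h‖ := le_norm_graphPoint (fun _ => h) (not_le.1 hu).le
  have h4 : 1 ≤ ‖point u h‖ := hR1.le.trans hx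
  have h5 := (norm_sq_half_le h4 (hb.vel _ (hS.bottom_mem ht (by rw [hh]; simp))
    (hR.le.trans hx))).trans (div_norm_cube_le h4)
  rw [horiz_point] at h5
  calc (1 - cut R u) * ‖q u‖ ≤ (1 - cut R u) * ((‖a‖ + ‖b‖) * (8 * C ^ 2 * decay u)) :=
        mul_le_mul_of_nonneg_left ((hqA u).trans (mul_le_mul_of_nonneg_left h5 hA))
          (sub_nonneg.2 (cut_le_one R u))
    _ = _ := by ring

end Limits

/-! ### The evolution of the momenta -/

section Final

variable {P : Params} {B : RigidBody} {M : Motion} {I : Set ℝ} {t₀ : ℝ} {m : ℕ} {C R₁ R : ℝ}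

/-- The mean value inequality for a family of functions whose derivatives are bounded near a point,
uniformly in the parameter `R`. -/
lemma eventually_abs_sub_le {F : ℝ → ℝ → ℝ} {N R₂ : ℝ}
    (h : ∀ᶠ t in 𝓝 t₀, ∀ R, R₂ < R → ∃ d, HasDerivAt (F R) d t ∧ |d| ≤ N) :
    ∀ᶠ t in 𝓝 t₀, ∀ R, R₂ < R → |F R t - F R t₀| ≤ N * |t - t₀| := by
  obtain ⟨δ, hδ, hball⟩ := Metric.eventually_nhds_iff_ball.1 h
  filter_upwards [Metric.ball_mem_nhds t₀ hδ] with t ht R hR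
  choose! d hd hdN using fun s hs => hball s hs R hR
  exact (convex_ball t₀ δ).norm_image_sub_le_of_norm_hasDerivWithin_le
    (fun s hs => (hd s hs).hasDerivWithinAt) hdN (Metric.mem_ball_self hδ) ht

/-- A family of functions that tends to zero at `t₀` as `R → ∞`, with derivatives bounded uniformly
near `t₀`, tends to zero jointly as `R → ∞` and `t → t₀`. -/
lemma tendsto_prod_of_deriv_bounded {F : ℝ → ℝ → ℝ} {N R₂ : ℝ}
    (h : ∀ᶠ t in 𝓝 t₀, ∀ R, R₂ < R → ∃ d, HasDerivAt (F R) d t ∧ |d| ≤ N)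
    (h0 : Tendsto (fun R => F R t₀) atTop (𝓝 0)) :
    Tendsto (fun p : ℝ × ℝ => F p.1 p.2) (atTop ×ˢ 𝓝 t₀) (𝓝 0) := by
  have h1 := (eventually_gt_atTop R₂).prod_mk (eventually_abs_sub_le h)
  refine squeeze_zero_norm' (a := fun p : ℝ × ℝ => |F p.1 t₀| + N * |p.2 - t₀|) ?_ ?_
  · filter_upwards [h1] with p hp
    have := hp.2 p.1 hp.1
    have h3 := abs_sub_abs_le_abs_sub (F p.1 p.2) (F p.1 t₀)
    rw [Real.norm_eq_abs]
    linarith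
  · have h2 : Tendsto (fun t => N * |t - t₀|) (𝓝 t₀) (𝓝 0) := by
      have : ContinuousAt (fun t => N * |t - t₀|) t₀ := by fun_prop
      simpa [ContinuousAt] using this
    have h3 := (h0.abs.comp (tendsto_fst (f := atTop) (g := 𝓝 t₀))).add
      (h2.comp (tendsto_snd (f := (atTop : Filter ℝ)) (g := 𝓝 t₀)))
    simpa using h3

lemma kvec_cross_two (b : E3) : cross kvec b 2 = 0 := by simp [cross_apply_two, kvec]

lemma killing_zero_two {w : E3} (hw : w 2 = 0) (x : E3) : killing w 0 x 2 = 0 := by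
  simp [killing_two, hw]

/-- The uniform far-field bounds, the volume bound and the bounds for the cutoffs, collected. -/
lemma IsSolution.exists_errorBounds (hS : IsSolution P B M I) (hI : IsOpen I)
    (hF : FarField P B M m I)
    (hd : (m = 2 ∧ ∃ h : ℝ, M.bottom = h) ∨ (m = 3 ∧ M.bottom = ⊥)) (ht₀ : t₀ ∈ I) :
    ∃ C R₁ D W, 0 ≤ D ∧ 0 ≤ W ∧ 1 ≤ C ∧
      (∀ R, 0 < R → (∀ u, ‖fderiv ℝ (cut R) u‖ ≤ D / R) ∧ ∀ x, ‖fderiv ℝ (cut3 R) x‖ ≤ D / R) ∧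
      ∀ᶠ t in 𝓝 t₀, t ∈ I ∧ FarBounds P B M m C R₁ t ∧ ∀ R, R₁ < R →
        volume (fluid B M t ∩ cutRegion R) ≤ ENNReal.ofReal (W * R ^ m) := by
  have hm : 1 ≤ m := by
    rcases hd with ⟨rfl, -⟩ | ⟨rfl, -⟩ <;> norm_num
  obtain ⟨C, R₁, hev⟩ := hS.exists_farBounds hI hF hm ht₀
  obtain ⟨D, hD, hcut⟩ := exists_norm_fderiv_cut_le
  obtain ⟨W, hW, hvol⟩ := exists_volume_le (B := B) C hd
  refine ⟨C, R₁, D, W, hD, hW, hev.self_of_nhds.2.one_le, hcut, ?_⟩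
  filter_upwards [hev] with t ht
  exact ⟨ht.1, ht.2, fun R hR => hvol t R (by linarith [ht.2.pos hR])
    (ht.2.le_radius.trans hR.le) ht.2.height⟩

/-- Near a given time the error terms in the balance of momentum tend to zero uniformly. -/
lemma IsSolution.exists_momentumError_le (hS : IsSolution P B M I) (hI : IsOpen I)
    (hF : FarField P B M m I)
    (hd : (m = 2 ∧ ∃ h : ℝ, M.bottom = h) ∨ (m = 3 ∧ M.bottom = ⊥)) (ht₀ : t₀ ∈ I) (a b : E3) :
    ∃ E R₁, 0 ≤ E ∧ ∀ᶠ t in 𝓝 t₀, t ∈ I ∧ ∀ R, R₁ < R → 1 < R ∧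
      |momentumError P B M (cut R) (cut3 R) a b t| ≤ E / R := by
  have hm : 1 ≤ m := by
    rcases hd with ⟨rfl, -⟩ | ⟨rfl, -⟩ <;> norm_num
  obtain ⟨C, R₁, D, W, hD, hW, hC, hcut, hev⟩ := hS.exists_errorBounds hI hF hd ht₀
  have hg := P.g_pos
  refine ⟨P.g * (16 * D * ‖b‖ * C ^ 3 + 64 * D * (‖a‖ + ‖b‖) * C ^ 2)
    + 64 * D * (‖a‖ + ‖b‖) * C ^ 3 + 8 * D * (‖a‖ + ‖b‖) * C ^ 2 * W, R₁, by positivity,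
    hev.mono fun t ht => ⟨ht.1, fun R hR => ?_⟩⟩
  have hR1 := ht.2.1.pos hR
  have hR0 : 0 < R := by linarith
  exact ⟨hR1, ht.2.1.abs_momentumError_le hS ht.1 hm hR hD (hcut R hR0).1 (hcut R hR0).2 hW
    (ht.2.2 R hR) a b⟩

/-- For a horizontal translation the cutoff momentum is bounded near a given time: gravity, the
pressure on the bottom and buoyancy have no horizontal component. -/
lemma IsSolution.exists_cutMomentum_le (hS : IsSolution P B M I) (hI : IsOpen I)
    (hF : FarField P B M m I)
    (hd : (m = 2 ∧ ∃ h : ℝ, M.bottom = h) ∨ (m = 3 ∧ M.bottom = ⊥)) (ht₀ : t₀ ∈ I)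
    (hM : MomentaConverge M t₀) {w : E3} (hw : w 2 = 0) :
    ∃ N R₂, ∀ᶠ t in 𝓝 t₀, ∀ R, R₂ < R → |cutMomentum P B M (cut R) w 0 t| ≤ N := by
  obtain ⟨C, R₁, _, _, -, -, -, -, hev⟩ := hS.exists_errorBounds hI hF hd ht₀
  obtain ⟨E, R₃, hE, herr⟩ := hS.exists_momentumError_le hI hF hd ht₀ w 0
  have hk := killing_zero_two hw
  have hder : ∀ᶠ t in 𝓝 t₀, ∀ R, max R₁ R₃ < R →
      ∃ d, HasDerivAt (cutMomentum P B M (cut R) w 0) d t ∧ |d| ≤ P.ρf * E := by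
    filter_upwards [hev, herr] with t ht ht' R hR
    obtain ⟨h1, h2⟩ := max_lt_iff.1 hR
    obtain ⟨hR1, h3⟩ := ht'.2 R h2
    refine ⟨P.ρf * momentumError P B M (cut R) (cut3 R) w 0 t,
      (ht.2.1.hasDerivAt_cutMomentum hS hI ht.1 h1 w 0).congr_deriv ?_, ?_⟩
    · -- All terms but the error contain the vertical component of the constant field `w`.
      have e1 : elevationMoment P M (cut R) w 0 t = 0 := by simp [elevationMoment, hk]
      have e2 : bottomIntegral M.bottom
          (fun x => cut3 R x * (‖vel M t x‖ ^ 2 / 2 * killing w 0 x 2)) = 0 := by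
        simp only [hk, mul_zero]
        generalize M.bottom = h
        induction h with
        | bot => simp
        | coe h => simp
      rw [e1, e2, hk]
      ring
    · rw [abs_mul, abs_of_pos P.ρf_pos]
      exact mul_le_mul_of_nonneg_left (h3.trans (div_le_self hE hR1.le)) P.ρf_pos.le
  have hlim := (hS.tendsto_cutMomentum_linear hI ht₀ hM w).abs.eventually
    (gt_mem_nhds (lt_add_one _))
  obtain ⟨R₄, hR₄⟩ := eventually_atTop.1 hlim
  refine ⟨P.ρf * E * 1 + (|inner ℝ (linearMomentum P B M t₀) w| + 1), max (max R₁ R₃) R₄, ?_⟩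
  filter_upwards [eventually_abs_sub_le hder, Metric.ball_mem_nhds t₀ one_pos] with t ht ht1 R hR
  obtain ⟨h1, h2⟩ := max_lt_iff.1 hR
  have h3 := ht R h1
  have h4 := hR₄ R h2.le
  have h5 : |t - t₀| ≤ 1 := (Metric.mem_ball.1 ht1).le
  have h6 := abs_sub_abs_le_abs_sub (cutMomentum P B M (cut R) w 0 t)
    (cutMomentum P B M (cut R) w 0 t₀)
  have h7 : P.ρf * E * |t - t₀| ≤ P.ρf * E * 1 :=
    mul_le_mul_of_nonneg_left h5 (mul_nonneg P.ρf_pos.le hE)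
  linarith

/-- The displaced mass and its moments tend to zero uniformly near a given time: they do so at that
time, and their rate of change is bounded, being essentially a momentum. -/
lemma IsSolution.tendsto_elevationMoment_prod (hS : IsSolution P B M I) (hI : IsOpen I)
    (hF : FarField P B M m I)
    (hd : (m = 2 ∧ ∃ h : ℝ, M.bottom = h) ∨ (m = 3 ∧ M.bottom = ⊥)) (ht₀ : t₀ ∈ I)
    (hM : MomentaConverge M t₀) (h₁ : MassCondition P M t₀) (h₂ : AngularMassCondition P M t₀)
    (a b : E3) :
    Tendsto (fun p : ℝ × ℝ => elevationMoment P M (cut p.1) a b p.2) (atTop ×ˢ 𝓝 t₀) (𝓝 0) := by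
  have hm : m ≤ 3 := by
    rcases hd with ⟨rfl, -⟩ | ⟨rfl, -⟩ <;> norm_num
  obtain ⟨C, R₁, D, W, hD, hW, hC, hcut, hev⟩ := hS.exists_errorBounds hI hF hd ht₀
  -- `w` is the horizontal gradient of the weight `ξ · k`.
  obtain ⟨N, R₂, hN⟩ := hS.exists_cutMomentum_le hI hF hd ht₀ hM (kvec_cross_two b)
  set w := cross kvec b with hw
  have hρ := P.ρf_pos
  refine tendsto_prod_of_deriv_bounded (F := fun R t => elevationMoment P M (cut R) a b t)
    (R₂ := max R₁ R₂)
    (N := (4 * (‖a‖ + ‖b‖) * D * C + C * D * ‖w‖) * W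
      + (N + P.ρb * |B.vol| * (C * ‖w‖)) / P.ρf + ‖w‖ * C * B.vol)
    ?_ (hS.tendsto_elevationMoment ht₀ h₁ h₂ a b)
  filter_upwards [hev, hN] with t ht htN R hR
  obtain ⟨hR1, hR2⟩ := max_lt_iff.1 hR
  have hb := ht.2.1
  have hR0 : 0 < R := by linarith [hb.pos hR1]
  refine ⟨_, hS.hasDerivAt_elevationMoment hI ht.1 (contDiff_cut R) (hasCompactSupport_cut hR0)
    (contDiff_cut3 R) (hb.cut3_graphPoint hR1) (hb.cut3_body hR1) (isCompact_closedBall 0 (4 * R))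
    (hb.cut3_eq_zero hR1) a b, ?_⟩
  rw [abs_neg]
  refine (abs_add_le _ _).trans (add_le_add ((abs_add_le _ _).trans (add_le_add ?_ ?_)) ?_)
  · exact hb.abs_elevationError_le hm hR1 hD (hcut R hR0).2 hW (ht.2.2 R hR1) a b
  · -- The momentum of the fluid in the horizontal direction `w`.
    have e : surfaceFlux M (cut R) w 0 t - bodyFlux B M w 0 t
        = (cutMomentum P B M (cut R) w 0 t - inner ℝ (bodyLinear P B M t) w) / P.ρf := by
      rw [cutMomentum, inner_zero_right]
      field_simp
      ring
    rw [e, abs_div, abs_of_pos hρ]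
    refine div_le_div_of_nonneg_right ((abs_sub _ _).trans (add_le_add (htN R hR2) ?_)) hρ.le
    refine (abs_real_inner_le_norm _ _).trans ?_
    rw [bodyLinear, norm_smul, norm_mul, Real.norm_of_nonneg P.ρb_pos.le, Real.norm_eq_abs,
      mul_assoc]
    have h3 := hb.bodyV
    have h4 := P.ρb_pos
    gcongr
  · rw [setIntegral_bodyAt, ← Real.norm_eq_abs]
    refine norm_setIntegral_le_of_norm_le_const (μ := volume) (s := B.carrier)
      B.isCompact_carrier.measure_lt_top fun l hl => ?_
    exact (norm_inner_le_norm (𝕜 := ℝ) _ _).trans (mul_le_mul_of_nonneg_left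
      (hb.bodyVel _ (mem_image_of_mem _ hl)) (norm_nonneg _))

/-- The integrals over the bottom with a cutoff converge uniformly near a given time. -/
lemma IsSolution.tendsto_bottom_prod (hS : IsSolution P B M I) (hI : IsOpen I)
    (hF : FarField P B M m I)
    (hd : (m = 2 ∧ ∃ h : ℝ, M.bottom = h) ∨ (m = 3 ∧ M.bottom = ⊥)) (ht₀ : t₀ ∈ I) (a b : E3) :
    Tendsto (fun p : ℝ × ℝ => bottomIntegral M.bottom
          (fun x => cut3 p.1 x * (‖vel M p.2 x‖ ^ 2 / 2 * killing a b x 2))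
        - bottomIntegral M.bottom (fun x => ‖vel M p.2 x‖ ^ 2 / 2 * killing a b x 2))
      (atTop ×ˢ 𝓝 t₀) (𝓝 0) := by
  rcases hd with ⟨rfl, h, hh⟩ | ⟨rfl, hh⟩
  · obtain ⟨C, R₁, hev⟩ := hS.exists_farBounds hI hF one_le_two ht₀
    rw [hh]
    simp only [bottomIntegral_coe]
    refine squeeze_zero_norm' (a := fun p : ℝ × ℝ => (‖a‖ + ‖b‖) * (8 * C ^ 2)
      * ∫ u, (1 - cut p.1 u) * decay u) ?_ ?_
    · filter_upwards [((eventually_gt_atTop R₁).and (eventually_ge_atTop |h|)).prod_mk hev]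
        with p hp
      exact hp.2.2.abs_bottom_sub_le hS hp.2.1 hh hp.1.1 hp.1.2 a b
    · have h3 := (tendsto_integral_one_sub_cut.const_mul ((‖a‖ + ‖b‖) * (8 * C ^ 2))).comp
        (tendsto_fst (f := atTop) (g := 𝓝 t₀))
      simpa [Function.comp_def] using h3
  · simp [hh]

/-- The evolution of the limit of the cutoff momenta: their derivatives converge uniformly near
`t₀`, in the sense that they converge jointly as `R → ∞` and `t → t₀`. -/
theorem IsSolution.hasDerivAt_limit (hS : IsSolution P B M I) (hI : IsOpen I)
    (hF : FarField P B M m I)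
    (hd : (m = 2 ∧ ∃ h : ℝ, M.bottom = h) ∨ (m = 3 ∧ M.bottom = ⊥)) (ht₀ : t₀ ∈ I)
    (hM : MomentaConverge M t₀) (h₁ : MassCondition P M t₀) (h₂ : AngularMassCondition P M t₀)
    (a b : E3) {G : ℝ → ℝ}
    (hG : ∀ t ∈ I, Tendsto (fun R => cutMomentum P B M (cut R) a b t) atTop (𝓝 (G t))) :
    HasDerivAt G (-(P.ρf * bottomIntegral M.bottom
          (fun x => ‖vel M t₀ x‖ ^ 2 / 2 * killing a b x 2))
        + (P.ρf - P.ρb) * P.g * B.vol * killing a b (M.c t₀) 2) t₀ := by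
  obtain ⟨C, R₁, _, _, -, -, -, -, hev⟩ := hS.exists_errorBounds hI hF hd ht₀
  obtain ⟨E, R₂, hE, herr⟩ := hS.exists_momentumError_le hI hF hd ht₀ a b
  have herr0 : Tendsto (fun p : ℝ × ℝ => momentumError P B M (cut p.1) (cut3 p.1) a b p.2)
      (atTop ×ˢ 𝓝 t₀) (𝓝 0) := by
    refine squeeze_zero_norm' (a := fun p : ℝ × ℝ => E / p.1) ?_ ?_
    · filter_upwards [(eventually_gt_atTop R₂).prod_mk herr] with p hp
      exact (hp.2.2 p.1 hp.1).2
    · exact (tendsto_const_nhds.div_atTop tendsto_id).comp (tendsto_fst (f := atTop) (g := 𝓝 t₀))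
  have hel := hS.tendsto_elevationMoment_prod hI hF hd ht₀ hM h₁ h₂ a b
  have hbo := hS.tendsto_bottom_prod hI hF hd ht₀ a b
  refine hasDerivAt_of_tendstoUniformlyOnFilter (l := atTop)
    (f := fun R => cutMomentum P B M (cut R) a b)
    (f' := fun R t => P.ρf * (P.g * elevationMoment P M (cut R) a b t
          + momentumError P B M (cut R) (cut3 R) a b t
          - bottomIntegral M.bottom
              (fun x => cut3 R x * (‖vel M t x‖ ^ 2 / 2 * killing a b x 2)))
        + (P.ρf - P.ρb) * P.g * B.vol * killing a b (M.c t) 2)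
    (g' := fun t => -(P.ρf * bottomIntegral M.bottom
          (fun x => ‖vel M t x‖ ^ 2 / 2 * killing a b x 2))
        + (P.ρf - P.ρb) * P.g * B.vol * killing a b (M.c t) 2) ?_ ?_ ?_
  · rw [Metric.tendstoUniformlyOnFilter_iff]
    intro ε hε
    have h := (((hel.const_mul P.g).add herr0).sub hbo).const_mul P.ρf
    rw [mul_zero, add_zero, sub_zero, mul_zero] at h
    filter_upwards [h.eventually (Metric.ball_mem_nhds 0 hε)] with p hp
    rw [dist_comm, Real.dist_eq]
    rw [Real.dist_eq, sub_zero] at hp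
    refine lt_of_eq_of_lt (congrArg abs ?_) hp
    ring
  · filter_upwards [(eventually_gt_atTop R₁).prod_mk hev] with p hp
    exact hp.2.2.1.hasDerivAt_cutMomentum hS hI hp.2.1 hp.1 a b
  · filter_upwards [hI.mem_nhds ht₀] with t ht using hG t ht

lemma hasDerivAt_of_inner {f : ℝ → E3} {f' : E3}
    (h : ∀ a, HasDerivAt (fun t => inner ℝ (f t) a) (inner ℝ f' a) t₀) : HasDerivAt f f' t₀ := by
  have h1 : HasDerivAt (fun t => (f t).ofLp) f'.ofLp t₀ := by
    rw [hasDerivAt_pi]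
    intro i
    have h2 := h (EuclideanSpace.single i 1)
    simpa only [EuclideanSpace.inner_single_right, one_mul, conj_trivial] using h2
  exact (PiLp.continuousLinearEquiv 2 ℝ (fun _ : Fin 3 => ℝ)).symm.toContinuousLinearMap
    |>.hasFDerivAt.comp_hasDerivAt t₀ h1

/-- The evolution of the linear momentum, obtained by testing with translations; `F` is the integral
of `(|∇Φ|² / 2) n` over the bottom, zero if there is none. -/
lemma Admissible.hasDerivAt_linearMomentum (hA : Admissible P B M m I) (hI : IsOpen I)
    (hd : (m = 2 ∧ ∃ h : ℝ, M.bottom = h) ∨ (m = 3 ∧ M.bottom = ⊥)) (ht₀ : t₀ ∈ I) {F : E3}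
    (hF : ∀ a, inner ℝ F a = bottomIntegral M.bottom (fun x => ‖vel M t₀ x‖ ^ 2 / 2 * a 2)) :
    HasDerivAt (linearMomentum P B M)
      (-(P.ρf • F) + ((P.ρf - P.ρb) * P.g * B.vol) • kvec) t₀ := by
  refine hasDerivAt_of_inner fun a => ?_
  have h := hA.isSolution.hasDerivAt_limit hI hA.farField hd ht₀ (hA.momentaConverge t₀ ht₀)
    (hA.mass t₀ ht₀) (hA.angularMass t₀ ht₀) a 0 fun t ht =>
      hA.isSolution.tendsto_cutMomentum_linear hI ht (hA.momentaConverge t ht) a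
  refine h.congr_deriv ?_
  have hk : ∀ x, killing a 0 x 2 = a 2 := fun x => by simp [killing_two]
  simp only [hk]
  rw [inner_add_left, inner_neg_left, real_inner_smul_left, real_inner_smul_left, hF,
    real_inner_comm, inner_kvec]

/-- The evolution of the angular momentum, obtained by testing with rotations; `F` is the integral
of `r × (|∇Φ|² / 2) n` over the bottom, zero if there is none. -/
lemma Admissible.hasDerivAt_angularMomentum (hA : Admissible P B M m I) (hI : IsOpen I)
    (hd : (m = 2 ∧ ∃ h : ℝ, M.bottom = h) ∨ (m = 3 ∧ M.bottom = ⊥)) (ht₀ : t₀ ∈ I) {F : E3}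
    (hF : ∀ b, inner ℝ F b
      = bottomIntegral M.bottom (fun x => ‖vel M t₀ x‖ ^ 2 / 2 * killing 0 b x 2)) :
    HasDerivAt (angularMomentum P B M)
      (-(P.ρf • F) + cross (M.c t₀) (((P.ρf - P.ρb) * P.g * B.vol) • kvec)) t₀ := by
  refine hasDerivAt_of_inner fun b => ?_
  have h := hA.isSolution.hasDerivAt_limit hI hA.farField hd ht₀ (hA.momentaConverge t₀ ht₀)
    (hA.mass t₀ ht₀) (hA.angularMass t₀ ht₀) 0 b fun t ht =>
      hA.isSolution.tendsto_cutMomentum_angular hI ht (hA.momentaConverge t ht) b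
  refine h.congr_deriv ?_
  rw [inner_add_left, inner_neg_left, real_inner_smul_left, hF]
  simp [killing_two, inner_eq_sum, cross_apply_zero, cross_apply_one, cross_apply_two, kvec]
  ring

/-! ### The terms on the bottom -/

lemma norm_kvec : ‖kvec‖ = 1 := by
  have h : ‖kvec‖ ^ 2 = 1 := by rw [norm_sq_eq_sum]; simp [kvec]
  nlinarith [norm_nonneg kvec]

lemma norm_bottomDensity (h t : ℝ) (u : ℝ × ℝ) :
    ‖bottomDensity M h t u‖ = ‖vel M t (point u h)‖ ^ 2 / 2 := by
  rw [bottomDensity, norm_smul, norm_kvec, mul_one, Real.norm_of_nonneg (by positivity)]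

lemma norm_bottomDensity_le (h t : ℝ) (u : ℝ × ℝ) :
    ‖bottomDensity M h t u‖ ≤ ‖vel M t (point u h)‖ ^ 2 / 2 * (1 + ‖point u h‖) := by
  rw [norm_bottomDensity]
  exact le_mul_of_one_le_right (by positivity) (by linarith [norm_nonneg (point u h)])

lemma norm_bottomMoment_le (h t : ℝ) (u : ℝ × ℝ) :
    ‖bottomMoment M h t u‖ ≤ ‖vel M t (point u h)‖ ^ 2 / 2 * (1 + ‖point u h‖) := by
  refine (norm_cross_le _ _).trans ?_
  rw [norm_bottomDensity, mul_comm]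
  exact mul_le_mul_of_nonneg_left (by linarith) (by positivity)

lemma IsSolution.continuous_bottomDensity {t : ℝ} (hS : IsSolution P B M I) (ht : t ∈ I) {h : ℝ}
    (hh : M.bottom = h) : Continuous (bottomDensity M h t) :=
  (((hS.continuous_vel_bottom ht hh).norm.pow 2).div_const 2).smul continuous_const

lemma IsSolution.continuous_bottomMoment {t : ℝ} (hS : IsSolution P B M I) (ht : t ∈ I) {h : ℝ}
    (hh : M.bottom = h) : Continuous (bottomMoment M h t) :=
  (crossB.continuous.comp (continuous_graphPoint (ψ := fun _ => h) contDiff_const)).clm_apply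
    (hS.continuous_bottomDensity ht hh)

/-- As the bottom recedes, integrals over it of quantities of the size of the kinetic energy density
and its moment vanish: on the bottom they are bounded by an integrable function that does not depend
on its depth. -/
lemma tendsto_integral_bottom {N : ℕ → Motion} {h : ℕ → ℝ} {t : ℝ} (hh : Tendsto h atTop atBot)
    (hN : ∀ n, (N n).bottom = (h n : WithBot ℝ) ∧ IsSolution P B (N n) {t} ∧
      FarFieldAt B (N n) 2 C R₁ t) {f : ℕ → ℝ × ℝ → E3} (hf : ∀ n, Continuous (f n))
    (hfN : ∀ n u, ‖f n u‖ ≤ ‖vel (N n) t (point u (h n))‖ ^ 2 / 2 * (1 + ‖point u (h n)‖)) :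
    Tendsto (fun n => ∫ u, f n u) atTop (𝓝 0) := by
  have hlow : ∀ n u, |h n| ≤ ‖point u (h n)‖ := fun n u => by
    have := PiLp.norm_apply_le (point u (h n)) 2
    rwa [point_two, Real.norm_eq_abs] at this
  have hev : ∀ᶠ n in atTop, h n ≤ -(max 1 R₁) := hh.eventually_le_atBot _
  have hbd : ∀ᶠ n in atTop, ∀ u, 1 ≤ ‖point u (h n)‖ ∧
      ‖f n u‖ ≤ C ^ 2 / ‖point u (h n)‖ ^ 3 := by
    filter_upwards [hev] with n hn u
    have h1 : max 1 R₁ ≤ ‖point u (h n)‖ := by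
      refine le_trans ?_ (hlow n u)
      linarith [neg_le_abs (h n)]
    have h2 : 1 ≤ ‖point u (h n)‖ := (le_max_left _ _).trans h1
    refine ⟨h2, (hfN n u).trans (norm_sq_half_le h2 ?_)⟩
    exact ((hN n).2.2.1 _ ((hN n).2.1.bottom_mem (mem_singleton t)
      (by rw [(hN n).1, point_two])) ((le_max_right _ _).trans h1)).2.2
  have h0 : (0 : E3) = ∫ _ : ℝ × ℝ, (0 : E3) := by simp
  rw [h0]
  refine tendsto_integral_filter_of_dominated_convergence (fun u => 8 * C ^ 2 * decay u)
    (Eventually.of_forall fun n => (hf n).aestronglyMeasurable) ?_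
    (integrable_decay.const_mul _) (Eventually.of_forall fun u => ?_)
  · filter_upwards [hbd] with n hn
    refine Eventually.of_forall fun u => (hn u).2.trans ?_
    have := div_norm_cube_le (C := C) (hn u).1
    rwa [horiz_point] at this
  · have hinf : Tendsto (fun n => ‖point u (h n)‖) atTop atTop :=
      tendsto_atTop_mono (fun n => hlow n u) (tendsto_abs_atBot_atTop.comp hh)
    refine squeeze_zero_norm' (hbd.mono fun n hn => (hn u).2) ?_
    exact tendsto_const_nhds.div_atTop ((tendsto_pow_atTop (by norm_num)).comp hinf)

end Final

end WaterBody

end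

theorem mainTheorem2 (P : WaterBody.Params) (B : WaterBody.RigidBody) :
    -- evolution of the momenta over a bottom at finite depth
    (∀ (M : WaterBody.Motion) (h : ℝ) (I : Set ℝ), IsOpen I → M.bottom = (h : WithBot ℝ) →
      WaterBody.Admissible P B M 2 I → ∀ t ∈ I,
        Integrable (WaterBody.bottomDensity M h t) ∧
        Integrable (WaterBody.bottomMoment M h t) ∧
        HasDerivAt (WaterBody.linearMomentum P B M)
          (-(P.ρf • ∫ u, WaterBody.bottomDensity M h t u)
            + ((P.ρf - P.ρb) * P.g * B.vol) • WaterBody.kvec) t ∧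
        HasDerivAt (WaterBody.angularMomentum P B M)
          (-(P.ρf • ∫ u, WaterBody.bottomMoment M h t u)
            + WaterBody.cross (M.c t) (((P.ρf - P.ρb) * P.g * B.vol) • WaterBody.kvec)) t) ∧
    -- the bottom terms disappear as the bottom is sent to minus infinity
    (∀ (M : ℕ → WaterBody.Motion) (h : ℕ → ℝ) (t C R₀ : ℝ), Tendsto h atTop atBot →
      (∀ n, (M n).bottom = (h n : WithBot ℝ) ∧ WaterBody.IsSolution P B (M n) {t} ∧
        WaterBody.FarFieldAt B (M n) 2 C R₀ t) →
      Tendsto (fun n => ∫ u, WaterBody.bottomDensity (M n) (h n) t u) atTop (𝓝 0) ∧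
      Tendsto (fun n => ∫ u, WaterBody.bottomMoment (M n) (h n) t u) atTop (𝓝 0)) ∧
    -- conservation for a neutrally buoyant body in a fluid with its bottom at minus infinity
    (∀ (M : WaterBody.Motion) (I : Set ℝ), IsOpen I → I.OrdConnected → M.bottom = ⊥ →
      P.ρb = P.ρf → WaterBody.Admissible P B M 3 I →
        (∀ t ∈ I, HasDerivAt (WaterBody.linearMomentum P B M) 0 t ∧
          HasDerivAt (WaterBody.angularMomentum P B M) 0 t) ∧
        ∀ s ∈ I, ∀ t ∈ I,
          WaterBody.linearMomentum P B M s = WaterBody.linearMomentum P B M t ∧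
          WaterBody.angularMomentum P B M s = WaterBody.angularMomentum P B M t) := by
  refine ⟨fun M h I hI hh hA t ht => ?_, fun M h t C R₀ hh hM => ⟨?_, ?_⟩,
    fun M I hI hIc hh hρ hA => ?_⟩
  · have hS := hA.isSolution
    have hd : ((2 : ℕ) = 2 ∧ ∃ h : ℝ, M.bottom = h) ∨ ((2 : ℕ) = 3 ∧ M.bottom = ⊥) :=
      Or.inl ⟨rfl, h, hh⟩
    obtain ⟨C, R₁, hev⟩ := hS.exists_farBounds hI hA.farField one_le_two ht
    have hb := hev.self_of_nhds.2
    have i₁ : Integrable (WaterBody.bottomDensity M h t) :=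
      hS.integrable_bottom ht hh hb.vel (hS.continuous_bottomDensity ht hh) zero_le_one fun u => by
        rw [one_mul]
        exact WaterBody.norm_bottomDensity_le h t u
    have i₂ : Integrable (WaterBody.bottomMoment M h t) :=
      hS.integrable_bottom ht hh hb.vel (hS.continuous_bottomMoment ht hh) zero_le_one fun u => by
        rw [one_mul]
        exact WaterBody.norm_bottomMoment_le h t u
    refine ⟨i₁, i₂, hA.hasDerivAt_linearMomentum hI hd ht fun a => ?_,
      hA.hasDerivAt_angularMomentum hI hd ht fun b => ?_⟩
    · rw [hh, WaterBody.bottomIntegral_coe, real_inner_comm, ← integral_inner i₁]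
      congr 1
      funext u
      rw [WaterBody.bottomDensity, real_inner_smul_right, WaterBody.inner_kvec]
    · rw [hh, WaterBody.bottomIntegral_coe, real_inner_comm, ← integral_inner i₂]
      congr 1
      funext u
      simp [WaterBody.bottomMoment, WaterBody.bottomDensity, WaterBody.killing_two,
        WaterBody.inner_eq_sum, WaterBody.cross_apply_zero, WaterBody.cross_apply_one,
        WaterBody.cross_apply_two, WaterBody.kvec]
      ring
  · exact WaterBody.tendsto_integral_bottom hh hM
      (fun n => (hM n).2.1.continuous_bottomDensity (mem_singleton t) (hM n).1)
      fun n u => WaterBody.norm_bottomDensity_le (h n) t u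
  · exact WaterBody.tendsto_integral_bottom hh hM
      (fun n => (hM n).2.1.continuous_bottomMoment (mem_singleton t) (hM n).1)
      fun n u => WaterBody.norm_bottomMoment_le (h n) t u
  · have hd : ((3 : ℕ) = 2 ∧ ∃ h : ℝ, M.bottom = h) ∨ ((3 : ℕ) = 3 ∧ M.bottom = ⊥) :=
      Or.inr ⟨rfl, hh⟩
    have key : ∀ t ∈ I, HasDerivAt (WaterBody.linearMomentum P B M) 0 t ∧
        HasDerivAt (WaterBody.angularMomentum P B M) 0 t := by
      intro t ht
      have h₁ := hA.hasDerivAt_linearMomentum hI hd ht (F := 0) fun a => by simp [hh]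
      have h₂ := hA.hasDerivAt_angularMomentum hI hd ht (F := 0) fun b => by simp [hh]
      rw [hρ] at h₁ h₂
      refine ⟨h₁.congr_deriv (by simp), h₂.congr_deriv (by simp [WaterBody.cross])⟩
    -- A function with zero derivative on an interval is constant.
    have hconst : ∀ f : ℝ → WaterBody.E3, (∀ t ∈ I, HasDerivAt f 0 t) →
        ∀ s ∈ I, ∀ t ∈ I, f s = f t := fun f hf s hs t ht =>
      hI.is_const_of_deriv_eq_zero hIc.isPreconnected
        (fun r hr => (hf r hr).differentiableAt.differentiableWithinAt)
        (fun r hr => (hf r hr).deriv) hs ht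
    exact ⟨key, fun s hs t ht => ⟨hconst _ (fun r hr => (key r hr).1) s hs t ht,
      hconst _ (fun r hr => (key r hr).2) s hs t ht⟩⟩
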